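/- Let $\Lambda$ be the von Mangoldt function. For $j\ge 0$ let $\Lambda_j$ be its $j$-fold Dirichlet convolution power, so $\sum_n \Lambda_j(n)n^{-s}=(-\zeta'(s)/\zeta(s))^j$ for $\operatorname{Re} s>1$; in particular $\Lambda_0(1)=1$ and $\Lambda_0(n)=0$ for $n>1$. Put $\alpha_0=-\Lambda$ and $\alpha_k=\Lambda_{k-1}*(\Lambda\log)$ for $k\ge1$, where $*$ is Dirichlet convolution and $\Lambda\log$ is the function $n\mapsto\Lambda(n)\log n$. For integers $k,\ell\ge 0$ and real $x\ge1$ let $$A_{k,\ell}(x)=\sum_{n\le x}\alpha_k(n)\alpha_\ell(n).$$ For an integer $K\ge1$ and real $T>2\pi$ let $\mathcal L=\tfrac12\log\frac{T}{2\pi}$ and $$A(x)=A(x,K,T)=\sum_{n\le x}\Bigl|\sum_{k=0}^K\frac{\alpha_k(n)}{\mathcal L^k}\Bigr|^2 .$$ **Proposition.** The following hold for all real $x\ge 1$, where implied constants may depend on $k$ and $\ell$, and on $\varepsilon$ where it occurs, and $\varepsilon>0$ is arbitrary: 1. $A_{0,0}(x)=x\log x+O(x)$, $\ A_{1,0}(x)=-x\log^2x+O(x\log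 x)$, and $A_{k,0}(x)=O(x^{1/2+\varepsilon})$ for $k\ge2$. 2. $A_{1,1}(x)=x\log^3x+O(x\log^2x)$, and $A_{k,1}(x)=O(x^{1/2+\varepsilon})$ for $k\ge2$. 3. For $k\ge1$, $\ A_{k,k}(x)=2\,\dfrac{(k-1)!}{(2k)!}\,x\log^{2k+1}x+O(x\log^{2k}x)$. 4. For $k>\ell\ge2$, $\ A_{k,\ell}(x)=O(x\log^{k+\ell}x)$. Consequently, for every integer $K\ge1$ and all fixed real $C_0>0$ and $T_0>2\pi$, $$A(x)=x\log x\left(1-2\,\frac{\log x}{\mathcal L}+2\sum_{k=1}^K\frac{(k-1)!}{(2k)!}\Bigl(\frac{\log x}{\mathcal L}\Bigr)^{2k}\right)+O(x)$$ for all $T\ge T_0$ and all $x=T^{a}$ with $0<a\le C_0$, where the implied constant depends only on $K$, $C_0$ and $T_0$. -/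

import Mathlib

noncomputable section

namespace XiPrime

/-- The `j`-fold Dirichlet convolution of the von Mangoldt function, i.e. the coefficients of
`(-ζ'/ζ)^j`. The power is taken in the ring of arithmetic functions; `convLambda 0` is the
convolution identity. -/
def convLambda (j : ℕ) : ArithmeticFunction ℝ :=
  ArithmeticFunction.vonMangoldt ^ j

/-- The pointwise product `n ↦ Λ(n) log n`. -/
def lambdaLog : ArithmeticFunction ℝ :=
  ArithmeticFunction.pmul ArithmeticFunction.vonMangoldt ArithmeticFunction.log

/-- `α_0 = -Λ` and `α_k = Λ_{k-1} * (Λ log)` (Dirichlet convolution) for `k ≥ 1`. -/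
def alpha : ℕ → ArithmeticFunction ℝ
  | 0 => -ArithmeticFunction.vonMangoldt
  | k + 1 => convLambda k * lambdaLog

/-- `A_{k,ℓ}(x) = ∑_{n ≤ x} α_k(n) α_ℓ(n)`. -/
def Akl (k l : ℕ) (x : ℝ) : ℝ :=
  ∑ n ∈ Finset.Icc 1 ⌊x⌋₊, alpha k n * alpha l n

/-- `𝓛 = (1/2) log (T / 2π)`. -/
def calL (T : ℝ) : ℝ := (1 / 2) * Real.log (T / (2 * Real.pi))

/-- `A(x) = A(x, K, T) = ∑_{n ≤ x} |∑_{k=0}^K α_k(n) / 𝓛^k|²`. -/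
def bigA (K : ℕ) (T x : ℝ) : ℝ :=
  ∑ n ∈ Finset.Icc 1 ⌊x⌋₊, |∑ k ∈ Finset.range (K + 1), alpha k n / calL T ^ k| ^ 2

end XiPrime

end

namespace XiPrime

open Complex Set MeasureTheory Filter Topology

/-! Multiplication by `log` is a derivation for Dirichlet convolution, so the power rule gives
`(k+1) α_{k+1} = log · Λ_{k+1}` (`alpha_succ_apply`), and everything reduces to moments of the
convolution powers `Λ_k`. At a squarefree `n`, `Λ_k(n)` vanishes unless `n` has exactly `k` prime
factors, and then it is `k! ∏ log p` (`pow_apply_of_squarefree`). Hence, on squarefree integers,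
distinct powers have product zero, and `Λ_k² = k! · (Λ²)^{*k}`.

The sum of `(Λ²)^{*k}` follows by induction from `∑_{n ≤ x} Λ(n)² = x log x + O(x)`: convolving with
`Λ²` turns the main term into a logarithmic Riesz mean of `Λ(n)²/n`, which integrates to the next
power of `log x` over the next odd factorial (`exists_abs_psum_lambdaSq_pow_sub_le`). Integers that
are not squarefree lose a logarithm: a factorization of such an integer into prime powers contains a
proper prime power or repeats a prime, and both are sparse (`convLambda_succ_le_of_not_squarefree`,
`exists_psum_not_squarefree_le`). This gives the diagonal terms, and with Cauchy–Schwarz the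
off-diagonal ones. If one index is at most 1 and the other at least 2, only proper prime powers
contribute, whence the exponent `1/2 + ε`.

The cases with both indices at most 1 need `∑ Λ(n)² log^j n` with one logarithm saved, that is, the
prime number theorem in the form `∑_{n ≤ x} (Λ(n) - 1) log² n = O(x log x)` (`exists_abs_cfSum_le`).
The Dirichlet series of these coefficients is the second derivative of `-ζ'/ζ - ζ`. The 3-4-1
inequality gives a zero-free region of polynomial width, wide enough that this derivative is
`O(|s|)` up to the line `Re s = 1` (`exists_norm_iteratedDeriv_zetaAux_le`). Its quotient by `s` is
the Fourier transform of the damped summatory function; testing against a bump of width `1 / log x`,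
and using that the summatory function cannot drop fast because `Λ ≥ 0`, gives the pointwise bound.

The formula for `A(x)` follows by expanding the square. Its error terms are `O(x)` because `(1 + log
x)/𝓛` stays bounded when `x = T^a` with `a ≤ C₀` and `T ≥ T₀`. -/

/-! ### The Riemann zeta function to the right of the imaginary axis -/

/-- The fractional part, cut off to the half line `t > N`. -/
noncomputable def fractTail (N : ℕ) (t : ℝ) : ℂ := (Ioi (N : ℝ)).indicator (fun t => ((Int.fract t : ℝ) : ℂ)) t

lemma measurable_fractTail (N : ℕ) : Measurable (fractTail N) := by
  unfold fractTail
  exact (Complex.measurable_ofReal.comp measurable_fract).indicator measurableSet_Ioi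

lemma norm_fractTail_le (N : ℕ) (t : ℝ) : ‖fractTail N t‖ ≤ 1 := by
  unfold fractTail
  by_cases h : t ∈ Ioi (N : ℝ)
  · rw [indicator_of_mem h, Complex.norm_real, Real.norm_of_nonneg (Int.fract_nonneg t)]
    exact (Int.fract_lt_one t).le
  · simp [indicator_of_notMem h]

lemma differentiableAt_mellin_fractTail {N : ℕ} (hN : 1 ≤ N) {s : ℂ} (hs : 0 < s.re) :
    DifferentiableAt ℂ (fun s => mellin (fractTail N) (-s)) s := by
  have hN' : (1 : ℝ) ≤ N := by exact_mod_cast hN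
  have key : DifferentiableAt ℂ (mellin (fractTail N)) (-s) := by
    -- The function is bounded at infinity, hence `a = 0`; it vanishes near 0 because `N ≥ 1`, so
    -- any `b` below `-s.re` would serve.
    refine mellin_differentiableAt_of_isBigO_rpow (a := 0) (b := -s.re - 1) ?_ ?_ (by simpa using hs)
      ?_ (by simp)
    · apply LocallyIntegrable.locallyIntegrableOn
      refine (locallyIntegrable_const (1 : ℝ)).mono (measurable_fractTail N).aestronglyMeasurable ?_
      exact Eventually.of_forall fun t => by simpa using norm_fractTail_le N t
    · refine Asymptotics.IsBigO.of_bound 1 (Eventually.of_forall fun t => ?_)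
      simpa using norm_fractTail_le N t
    · refine Asymptotics.IsBigO.of_bound 1 ?_
      have : ∀ᶠ t : ℝ in 𝓝[>] 0, t < 1 :=
        eventually_nhdsWithin_of_eventually_nhds (eventually_lt_nhds one_pos)
      filter_upwards [this] with t ht
      have : t ∉ Ioi (N : ℝ) := by simp only [mem_Ioi, not_lt]; linarith
      simp only [fractTail, indicator_of_notMem this, norm_zero]
      positivity
  exact key.comp s differentiableAt_id.neg

lemma mellin_fractTail (N : ℕ) (s : ℂ) :
    mellin (fractTail N) (-s) = ∫ t in Ioi (N : ℝ), ((Int.fract t : ℝ) : ℂ) * (t : ℂ) ^ (-(s + 1)) := by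
  have hsub : Ioi (N : ℝ) ⊆ Ioi 0 := Ioi_subset_Ioi (Nat.cast_nonneg N)
  rw [mellin, setIntegral_eq_of_subset_of_forall_sdiff_eq_zero measurableSet_Ioi hsub]
  · refine setIntegral_congr_fun measurableSet_Ioi fun t ht => ?_
    rw [fractTail, indicator_of_mem ht, smul_eq_mul, mul_comm]
    congr 2
    ring
  · intro t ht
    rw [fractTail, indicator_of_notMem ht.2, smul_zero]

lemma integrableOn_fract_mul_cpow {N : ℕ} (hN : 1 ≤ N) {s : ℂ} (hs : 0 < s.re) :
    IntegrableOn (fun t : ℝ => ((Int.fract t : ℝ) : ℂ) * (t : ℂ) ^ (-(s + 1))) (Ioi (N : ℝ)) := by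
  have hN' : (0 : ℝ) < N := by exact_mod_cast hN
  have h := integrableOn_Ioi_cpow_of_lt (a := -(s + 1)) (by simp; linarith) hN'
  refine h.bdd_mul (c := 1)
    (Complex.measurable_ofReal.comp measurable_fract).aestronglyMeasurable ?_
  refine Eventually.of_forall fun t => ?_
  rw [Complex.norm_real, Real.norm_of_nonneg (Int.fract_nonneg t)]
  exact (Int.fract_lt_one t).le

lemma norm_mellin_fractTail_le {N : ℕ} (hN : 1 ≤ N) {s : ℂ} (hs : 0 < s.re) :
    ‖mellin (fractTail N) (-s)‖ ≤ (N : ℝ) ^ (-s.re) / s.re := by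
  have hN' : (0 : ℝ) < N := by exact_mod_cast hN
  rw [mellin_fractTail]
  have h1 : ∫ t in Ioi (N : ℝ), t ^ (-s.re - 1) = (N : ℝ) ^ (-s.re) / s.re := by
    rw [integral_Ioi_rpow_of_lt (by linarith) hN']
    simp only [sub_add_cancel]
    rw [div_neg, neg_div, neg_neg]
  rw [← h1]
  refine norm_integral_le_of_norm_le (integrableOn_Ioi_rpow_of_lt (by linarith) hN') ?_
  refine (ae_restrict_mem measurableSet_Ioi).mono fun t ht => ?_
  have ht0 : 0 < t := hN'.trans ht
  rw [norm_mul, Complex.norm_real, Real.norm_of_nonneg (Int.fract_nonneg t),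
    norm_cpow_eq_rpow_re_of_pos ht0]
  have : (-(s + 1)).re = -s.re - 1 := by simp; ring
  rw [this]
  exact mul_le_of_le_one_left (by positivity) (Int.fract_lt_one t).le

lemma LSeries_indicator_gt (N : ℕ) {s : ℂ} (hs : 1 < s.re) :
    LSeries (fun n => if N < n then 1 else 0) s =
      riemannZeta s - ∑ n ∈ Finset.Icc 1 N, (n : ℂ) ^ (-s) := by
  have hg : ∀ n ∉ Finset.Icc 1 N, LSeries.term (fun n => if N < n then 0 else 1) s n = 0 := by
    intro n hn
    rcases Nat.eq_zero_or_pos n with rfl | hpos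
    · simp
    · have : N < n := by simp at hn; omega
      simp [LSeries.term, this]
  have hsum : LSeriesHasSum (fun n => if N < n then 0 else 1) s
      (∑ n ∈ Finset.Icc 1 N, (n : ℂ) ^ (-s)) := by
    have h : HasSum _ _ := hasSum_sum_of_ne_finset_zero hg
    rw [LSeriesHasSum]
    convert! h using 1
    refine Finset.sum_congr rfl fun n hn => ?_
    have h1 := Finset.mem_Icc.mp hn
    have hn0 : n ≠ 0 := by omega
    rw [LSeries.term_of_ne_zero hn0, if_neg (by omega), cpow_neg, one_div]
  have h1 := LSeriesHasSum_one hs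
  have h2 := h1.LSeriesSummable
  rw [← hsum.LSeries_eq, ← h1.LSeries_eq, ← LSeries_sub h2 hsum.LSeriesSummable]
  congr 1
  ext n
  by_cases h : N < n <;> simp [h]

lemma sum_indicator_gt (N M : ℕ) :
    ∑ k ∈ Finset.Icc 1 M, (if N < k then (1 : ℂ) else 0) = ((M - N : ℕ) : ℂ) := by
  rw [Finset.sum_ite, Finset.sum_const_zero, add_zero, Finset.sum_const, nsmul_one]
  congr 1
  have : (Finset.Icc 1 M).filter (N < ·) = Finset.Ioc N M := by ext; simp; omega
  rw [this, Nat.card_Ioc]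

/-- Abel summation over the tail `n > N`: its counting function is `⌊t⌋ - N = t - N - {t}`. The
integrals of the first two terms are elementary and combine to `N^{1-s}/(s-1)`; the third is the
Mellin transform of the truncated fractional part. -/
lemma riemannZeta_eq_sum_of_one_lt {N : ℕ} (hN : 1 ≤ N) {s : ℂ} (hs : 1 < s.re) :
    riemannZeta s = ∑ n ∈ Finset.Icc 1 N, (n : ℂ) ^ (-s) + (N : ℂ) ^ (1 - s) / (s - 1)
      - s * mellin (fractTail N) (-s) := by
  have hN1 : (1 : ℝ) ≤ N := by exact_mod_cast hN
  have hN' : (0 : ℝ) < N := by linarith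
  have hNc : (N : ℂ) ≠ 0 := by exact_mod_cast hN'.ne'
  have hs0 : s ≠ 0 := by rintro rfl; simp at hs; linarith
  have hs1 : s - 1 ≠ 0 := by
    intro h
    rw [sub_eq_zero.mp h] at hs
    simp at hs
  have hL := LSeries_eq_mul_integral' (fun n => if N < n then 1 else 0) zero_le_one hs (by
    refine Asymptotics.IsBigO.of_bound 1 (Eventually.of_forall fun n => ?_)
    rw [Real.rpow_one, Real.norm_of_nonneg (by positivity), Real.norm_of_nonneg (by positivity),
      one_mul]
    refine (Finset.sum_le_sum (g := fun _ => (1 : ℝ)) fun k _ => ?_).trans (by simp)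
    split_ifs <;> simp)
  rw [LSeries_indicator_gt N hs] at hL
  have h1 : ∫ t in Ioi (1 : ℝ), (∑ k ∈ Finset.Icc 1 ⌊t⌋₊, (if N < k then (1 : ℂ) else 0)) *
      (t : ℂ) ^ (-(s + 1)) = ∫ t in Ioi (N : ℝ), ((t : ℂ) ^ (-s) - N * (t : ℂ) ^ (-(s + 1)) -
        ((Int.fract t : ℝ) : ℂ) * (t : ℂ) ^ (-(s + 1))) := by
    rw [setIntegral_eq_of_subset_of_forall_sdiff_eq_zero measurableSet_Ioi (Ioi_subset_Ioi hN1)]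
    · refine setIntegral_congr_fun measurableSet_Ioi fun t ht => ?_
      have ht0 : (0 : ℝ) < t := hN'.trans ht
      have htc : (t : ℂ) ≠ 0 := by exact_mod_cast ht0.ne'
      have hfl : N ≤ ⌊t⌋₊ := Nat.le_floor (le_of_lt ht)
      have e1 : (t : ℂ) ^ (-s) = t * (t : ℂ) ^ (-(s + 1)) := by
        rw [neg_add, cpow_add _ _ htc, cpow_neg_one]
        field_simp
      have e2 : ((⌊t⌋₊ : ℕ) : ℂ) = t - ((Int.fract t : ℝ) : ℂ) := by
        have : ((⌊t⌋₊ : ℕ) : ℝ) = t - Int.fract t := by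
          rw [natCast_floor_eq_intCast_floor ht0.le, Int.self_sub_fract]
        exact_mod_cast congrArg (fun r : ℝ => (r : ℂ)) this
      rw [sum_indicator_gt, Nat.cast_sub hfl, e1, e2]
      ring
    · intro t ht
      have : t ≤ N := not_lt.mp ht.2
      have hfl : ⌊t⌋₊ ≤ N := by
        have := Nat.floor_le_floor this
        simpa using this
      rw [sum_indicator_gt, Nat.sub_eq_zero_of_le hfl]
      simp
  have i1 : IntegrableOn (fun t : ℝ => (t : ℂ) ^ (-s)) (Ioi (N : ℝ)) :=
    integrableOn_Ioi_cpow_of_lt (by simpa using hs) hN'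
  have i2 : IntegrableOn (fun t : ℝ => (t : ℂ) ^ (-(s + 1))) (Ioi (N : ℝ)) :=
    integrableOn_Ioi_cpow_of_lt (by simp; linarith) hN'
  have i3 := integrableOn_fract_mul_cpow hN (s := s) (by linarith)
  have i4 : IntegrableOn (fun t : ℝ => (N : ℂ) * (t : ℂ) ^ (-(s + 1))) (Ioi (N : ℝ)) :=
    i2.const_mul _
  have i5 : IntegrableOn (fun t : ℝ => (t : ℂ) ^ (-s) - (N : ℂ) * (t : ℂ) ^ (-(s + 1)))
    (Ioi (N : ℝ)) := i1.sub i4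
  rw [h1, integral_sub i5 i3, integral_sub i1 i4, integral_const_mul, integral_Ioi_cpow_of_lt (by simpa using hs) hN',
    integral_Ioi_cpow_of_lt (by simp; linarith) hN', ← mellin_fractTail] at hL
  have e3 : (((N : ℝ) : ℂ)) ^ (-s + 1) = (N : ℂ) ^ (1 - s) := by
    rw [neg_add_eq_sub]; norm_cast
  have e4 : (N : ℂ) * ((N : ℝ) : ℂ) ^ (-(s + 1) + 1) = (N : ℂ) ^ (1 - s) := by
    have : -(s + 1) + 1 = -s := by ring
    rw [this, sub_eq_add_neg, cpow_add _ _ hNc, cpow_one]; norm_cast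
  have e5 : -s + 1 = -(s - 1) := by ring
  have e6 : -(s + 1) + 1 = -s := by ring
  rw [e3, mul_div_assoc', mul_neg, e4, e5, e6] at hL
  rw [sub_eq_iff_eq_add] at hL
  rw [hL]
  field_simp
  ring

/-- Identity theorem on the half plane `Re s > 0`: multiplication by `s - 1` removes the pole, so
both sides are analytic there, and they agree near `2`. -/
theorem riemannZeta₁_eq {N : ℕ} (hN : 1 ≤ N) {s : ℂ} (hs : 0 < s.re) :
    riemannZeta₁ s = (s - 1) * ∑ n ∈ Finset.Icc 1 N, (n : ℂ) ^ (-s) + (N : ℂ) ^ (1 - s)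
      - s * (s - 1) * mellin (fractTail N) (-s) := by
  have hN0 : (N : ℂ) ≠ 0 := by exact_mod_cast (by omega : N ≠ 0)
  set U : Set ℂ := {s | 0 < s.re}
  have hU : IsOpen U := isOpen_lt continuous_const continuous_re
  refine AnalyticOnNhd.eqOn_of_preconnected_of_eventuallyEq (𝕜 := ℂ) (f := riemannZeta₁)
    (g := fun s => (s - 1) * ∑ n ∈ Finset.Icc 1 N, (n : ℂ) ^ (-s) + (N : ℂ) ^ (1 - s)
      - s * (s - 1) * mellin (fractTail N) (-s)) (U := U) (z₀ := 2) ?_ ?_ ?_ (by simp [U]) ?_ hs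
  · exact differentiable_riemannZeta₁.differentiableOn.analyticOnNhd hU
  · refine DifferentiableOn.analyticOnNhd (fun z hz => ?_) hU
    apply DifferentiableAt.differentiableWithinAt
    have h1 := differentiableAt_mellin_fractTail hN hz
    have h2 : DifferentiableAt ℂ (fun s : ℂ => ∑ n ∈ Finset.Icc 1 N, (n : ℂ) ^ (-s)) z := by
      refine DifferentiableAt.fun_sum fun n hn => ?_
      have : (n : ℂ) ≠ 0 := by
        have := (Finset.mem_Icc.mp hn).1
        exact_mod_cast (by omega : n ≠ 0)
      exact differentiableAt_id.neg.const_cpow (Or.inl this)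
    have h3 : DifferentiableAt ℂ (fun s : ℂ => (N : ℂ) ^ (1 - s)) z :=
      (differentiableAt_id.const_sub 1).const_cpow (Or.inl hN0)
    fun_prop
  · exact (convex_halfSpace_re_gt 0).isPreconnected
  · have : {s : ℂ | 1 < s.re} ∈ 𝓝 (2 : ℂ) :=
      (isOpen_lt continuous_const continuous_re).mem_nhds (by simp)
    filter_upwards [this] with z hz
    have hz1 : z ≠ 1 := by rintro rfl; simp at hz
    have hz2 := sub_ne_zero.mpr hz1
    have h := riemannZeta_eq_sum_of_one_lt hN hz
    rw [riemannZeta_eq_inv_sub_mul hz1] at h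
    field_simp at h
    rw [h]

end XiPrime

/-! ### Growth of zeta near the line `Re s = 1` and a zero-free region -/

namespace XiPrime

open Complex Set MeasureTheory Filter Topology

/-- Bernoulli's inequality for the exponent `1/16` gives `(n+1)^{-15/16} ≤ 16 ((n+1)^{1/16} -
n^{1/16})`, and the right side telescopes. -/
lemma sum_rpow_neg_le (N : ℕ) :
    ∑ n ∈ Finset.Icc 1 N, (n : ℝ) ^ (-(15 / 16) : ℝ) ≤ 16 * (N : ℝ) ^ (1 / 16 : ℝ) := by
  induction N with
  | zero => simp
  | succ n ih =>
    rw [Finset.sum_Icc_succ_top (by omega)]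
    have hpos : (0 : ℝ) < n + 1 := by positivity
    have h := _root_.rpow_one_add_le_one_add_mul_self (s := -((n : ℝ) + 1)⁻¹) (p := 1 / 16)
      (by rw [neg_le_neg_iff]; exact inv_le_one_of_one_le₀ (by linarith [Nat.cast_nonneg (α := ℝ) n]))
      (by norm_num) (by norm_num)
    have e1 : 1 + -((n : ℝ) + 1)⁻¹ = n / (n + 1) := by field_simp; ring
    rw [e1, Real.div_rpow (by positivity) hpos.le, div_le_iff₀ (by positivity)] at h
    have e2 : ((n : ℝ) + 1) ^ (1 / 16 : ℝ) = ((n : ℝ) + 1) ^ (-(15 / 16) : ℝ) * (n + 1) := by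
      rw [← Real.rpow_add_one hpos.ne']; norm_num
    push_cast
    have e3 : (1 + 1 / 16 * -((n : ℝ) + 1)⁻¹) * ((n : ℝ) + 1) ^ (1 / 16 : ℝ) =
        ((n : ℝ) + 1) ^ (1 / 16 : ℝ) - 1 / 16 * ((n : ℝ) + 1) ^ (-(15 / 16) : ℝ) := by
      rw [e2]; field_simp; ring
    rw [e3] at h
    linarith

/-- Truncating at `N = ⌈|t|⌉` makes the partial sum, the polar term and the remainder at most 16, 1
and 10 times `N^{1/16}`; then `N ≤ 2|t|` doubles the total 27. The exponent `1/16` is small enough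
for fifteen such factors to stay below `|t|` later on. -/
lemma norm_riemannZeta_le {s : ℂ} (h1 : 15 / 16 ≤ s.re) (h2 : s.re ≤ 4) (ht : 1 ≤ |s.im|) :
    ‖riemannZeta s‖ ≤ 54 * |s.im| ^ (1 / 16 : ℝ) := by
  set t := |s.im|
  set N := ⌈t⌉₊
  have htN : t ≤ N := Nat.le_ceil t
  have hNt : (N : ℝ) ≤ 2 * t := by
    have := (Nat.ceil_lt_add_one (by linarith : 0 ≤ t)).le
    linarith
  have hN1 : (1 : ℝ) ≤ N := ht.trans htN
  have hN : 1 ≤ N := by exact_mod_cast hN1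
  have hN0 : (0 : ℝ) < N := by linarith
  have hs1 : s ≠ 1 := by rintro rfl; simp [t] at ht; linarith
  have hs1' := sub_ne_zero.mpr hs1
  have htn : t ≤ ‖s - 1‖ := by
    have := abs_im_le_norm (s - 1)
    simpa [t] using this
  have hsn : ‖s‖ ≤ 5 * N := by
    have := norm_le_abs_re_add_abs_im s
    rw [abs_of_nonneg (by linarith)] at this
    have h3 : |s.im| ≤ N := htN
    linarith
  have hz : riemannZeta s = ∑ n ∈ Finset.Icc 1 N, (n : ℂ) ^ (-s) + (N : ℂ) ^ (1 - s) / (s - 1)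
      - s * mellin (fractTail N) (-s) := by
    rw [riemannZeta_eq_inv_sub_mul hs1, riemannZeta₁_eq hN (by linarith : 0 < s.re)]
    field_simp
  have b1 : ‖∑ n ∈ Finset.Icc 1 N, (n : ℂ) ^ (-s)‖ ≤ 16 * (N : ℝ) ^ (1 / 16 : ℝ) := by
    refine (norm_sum_le _ _).trans (le_trans (Finset.sum_le_sum fun n hn => ?_) (sum_rpow_neg_le N))
    have hn1 := (Finset.mem_Icc.mp hn).1
    rw [norm_natCast_cpow_of_pos (by omega)]
    exact Real.rpow_le_rpow_of_exponent_le (by exact_mod_cast hn1) (by simp; linarith)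
  have b2 : ‖(N : ℂ) ^ (1 - s) / (s - 1)‖ ≤ (N : ℝ) ^ (1 / 16 : ℝ) := by
    rw [norm_div, norm_natCast_cpow_of_pos (by omega)]
    refine (div_le_self (by positivity) (ht.trans htn)).trans ?_
    exact Real.rpow_le_rpow_of_exponent_le hN1 (by simp; linarith)
  have b3 : ‖s * mellin (fractTail N) (-s)‖ ≤ 10 * (N : ℝ) ^ (1 / 16 : ℝ) := by
    rw [norm_mul]
    have h3 := norm_mellin_fractTail_le hN (by linarith : 0 < s.re)
    have h4 : (N : ℝ) ^ (-s.re) / s.re ≤ 2 * (N : ℝ) ^ (-(15 / 16) : ℝ) := by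
      rw [div_le_iff₀ (by linarith)]
      have : (N : ℝ) ^ (-s.re) ≤ (N : ℝ) ^ (-(15 / 16) : ℝ) :=
        Real.rpow_le_rpow_of_exponent_le hN1 (by linarith)
      have h0 : 0 ≤ (N : ℝ) ^ (-(15 / 16) : ℝ) := by positivity
      nlinarith
    calc _ ≤ (5 * N) * (2 * (N : ℝ) ^ (-(15 / 16) : ℝ)) := by gcongr; exact h3.trans h4
      _ = 10 * ((N : ℝ) ^ (-(15 / 16) : ℝ) * N) := by ring
      _ = _ := by rw [← Real.rpow_add_one hN0.ne']; norm_num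
  have b4 : (N : ℝ) ^ (1 / 16 : ℝ) ≤ 2 * t ^ (1 / 16 : ℝ) := by
    calc (N : ℝ) ^ (1 / 16 : ℝ) ≤ (2 * t) ^ (1 / 16 : ℝ) := by gcongr
      _ = 2 ^ (1 / 16 : ℝ) * t ^ (1 / 16 : ℝ) := Real.mul_rpow (by norm_num) (by linarith)
      _ ≤ 2 * t ^ (1 / 16 : ℝ) := by
        gcongr
        calc (2 : ℝ) ^ (1 / 16 : ℝ) ≤ 2 ^ (1 : ℝ) :=
              Real.rpow_le_rpow_of_exponent_le (by norm_num) (by norm_num)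
          _ = 2 := Real.rpow_one 2
  rw [hz]
  calc _ ≤ _ := norm_sub_le _ _
    _ ≤ (16 * (N : ℝ) ^ (1 / 16 : ℝ) + (N : ℝ) ^ (1 / 16 : ℝ)) + 10 * (N : ℝ) ^ (1 / 16 : ℝ) :=
      add_le_add ((norm_add_le _ _).trans (add_le_add b1 b2)) b3
    _ ≤ _ := by linarith

/-- Moving a point of large height by at most one at most doubles the sixteenth root. -/
lemma rpow_im_le {s w : ℂ} {r : ℝ} (hr : r ≤ 1) (hw : ‖w - s‖ ≤ r) (ht : 2 ≤ |s.im|) :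
    1 ≤ |w.im| ∧ |s.im| - r ≤ |w.im| ∧ |w.im| ^ (1 / 16 : ℝ) ≤ 2 * |s.im| ^ (1 / 16 : ℝ) := by
  have h1 := abs_im_le_norm (w - s)
  rw [sub_im] at h1
  have h2 : |w.im - s.im| ≤ r := h1.trans hw
  have h3 := abs_sub_abs_le_abs_sub s.im w.im
  rw [abs_sub_comm] at h3
  have h4 := abs_sub_abs_le_abs_sub w.im s.im
  refine ⟨by linarith, by linarith, ?_⟩
  calc |w.im| ^ (1 / 16 : ℝ) ≤ (2 * |s.im|) ^ (1 / 16 : ℝ) := by gcongr; linarith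
    _ = 2 ^ (1 / 16 : ℝ) * |s.im| ^ (1 / 16 : ℝ) := Real.mul_rpow (by norm_num) (by positivity)
    _ ≤ 2 * |s.im| ^ (1 / 16 : ℝ) := by
      gcongr
      calc (2 : ℝ) ^ (1 / 16 : ℝ) ≤ 2 ^ (1 : ℝ) :=
            Real.rpow_le_rpow_of_exponent_le (by norm_num) (by norm_num)
        _ = 2 := Real.rpow_one 2

lemma ne_one_of_im {s : ℂ} (h : 1 ≤ |s.im|) : s ≠ 1 := by
  rintro rfl
  simp at h
  linarith

lemma norm_deriv_riemannZeta_le {s : ℂ} (h1 : 31 / 32 ≤ s.re) (h2 : s.re ≤ 3) (ht : 2 ≤ |s.im|) :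
    ‖deriv riemannZeta s‖ ≤ 3456 * |s.im| ^ (1 / 16 : ℝ) := by
  have hball : ∀ w ∈ Metric.closedBall s (1 / 32), 1 ≤ |w.im| ∧
      |w.im| ^ (1 / 16 : ℝ) ≤ 2 * |s.im| ^ (1 / 16 : ℝ) := fun w hw => by
    have := rpow_im_le (by norm_num) (mem_closedBall_iff_norm.mp hw) ht
    exact ⟨this.1, this.2.2⟩
  -- Cauchy's estimate: radius `1/32` reaches from `31/32` down to `15/16`, and `108 = 2 · 54`
  -- absorbs the change of height on the circle.
  have h := norm_deriv_le_of_forall_mem_sphere_norm_le (c := s) (R := 1 / 32)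
    (C := 108 * |s.im| ^ (1 / 16 : ℝ)) (f := riemannZeta) (by norm_num) ?_ ?_
  · refine h.trans (le_of_eq (by ring))
  · refine DifferentiableOn.diffContOnCl fun w hw => ?_
    rw [closure_ball _ (by norm_num)] at hw
    exact (differentiableAt_riemannZeta (ne_one_of_im (hball w hw).1)).differentiableWithinAt
  · intro w hw
    have hw' := hball w (Metric.sphere_subset_closedBall hw)
    have h3 := abs_re_le_norm (w - s)
    rw [mem_sphere_iff_norm.mp hw, sub_re, abs_le] at h3
    refine (norm_riemannZeta_le (by linarith) (by linarith) hw'.1).trans ?_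
    linarith

/-- The pole at 1 is simple: `h ζ(1+h)` extends continuously to the compact interval `[0, 1]`. -/
lemma exists_norm_riemannZeta_le_div :
    ∃ C : ℝ, 1 ≤ C ∧ ∀ h : ℝ, 0 < h → h ≤ 1 → ‖riemannZeta (1 + h)‖ ≤ C / h := by
  have hc : ContinuousOn (fun h : ℝ => riemannZeta₁ (1 + h)) (Icc 0 1) := by
    have := differentiable_riemannZeta₁.continuous
    fun_prop
  obtain ⟨C, hC⟩ := isCompact_Icc.exists_bound_of_continuousOn hc
  refine ⟨max C 1, le_max_right _ _, fun h h0 h1 => ?_⟩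
  have hne : (1 : ℂ) + h ≠ 1 := by simp [h0.ne']
  rw [riemannZeta_eq_inv_sub_mul hne, add_sub_cancel_left, norm_mul, norm_inv, Complex.norm_real,
    Real.norm_of_nonneg h0.le, inv_mul_eq_div]
  gcongr
  exact (hC h ⟨h0.le, h1⟩).trans (le_max_left _ _)

lemma one_le_norm_riemannZeta_product {h : ℝ} (h0 : 0 < h) (t : ℝ) :
    1 ≤ ‖riemannZeta (1 + h)‖ ^ 3 * ‖riemannZeta (1 + h + I * t)‖ ^ 4 *
      ‖riemannZeta (1 + h + 2 * I * t)‖ := by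
  have := DirichletCharacter.norm_LFunction_product_ge_one (N := 1) 1 h0 t
  simpa [DirichletCharacter.LFunctionTrivChar, DirichletCharacter.LFunction_modOne_eq] using this

/-- The 3-4-1 inequality, with `ζ(σ) ≪ 1/(σ-1)` and the growth bound at twice the height. The
constant is written as `c ^ 4` (allowed since `c ≤ 1`) so that fourth roots come out cleanly. -/
lemma exists_le_norm_riemannZeta_pow_four :
    ∃ c : ℝ, 0 < c ∧ c ≤ 1 ∧ ∀ s : ℂ, 1 < s.re → s.re ≤ 2 → 2 ≤ |s.im| →
      c ^ 4 * (s.re - 1) ^ 3 / |s.im| ^ (1 / 16 : ℝ) ≤ ‖riemannZeta s‖ ^ 4 := by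
  obtain ⟨C, hC1, hC⟩ := exists_norm_riemannZeta_le_div
  refine ⟨(108 * C ^ 3)⁻¹, by positivity, inv_le_one_of_one_le₀ ?_, fun s h1 h2 ht => ?_⟩
  · have : 1 ≤ C ^ 3 := one_le_pow₀ hC1
    linarith
  have hh0 : 0 < s.re - 1 := by linarith
  have h3 := one_le_norm_riemannZeta_product hh0 s.im
  have e1 : (1 : ℂ) + (s.re - 1 : ℝ) + I * s.im = s := by
    apply Complex.ext <;> simp
  have e2 : (1 : ℂ) + (s.re - 1 : ℝ) + 2 * I * s.im = s + I * s.im := by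
    apply Complex.ext <;> simp
    ring
  rw [e1, e2] at h3
  have b1 := hC _ hh0 (by linarith)
  have him : (s + I * s.im).im = 2 * s.im := by simp; ring
  have b2 : ‖riemannZeta (s + I * s.im)‖ ≤ 108 * |s.im| ^ (1 / 16 : ℝ) := by
    refine (norm_riemannZeta_le (by simp; linarith) (by simp; linarith) ?_).trans ?_
    · rw [him, abs_mul, abs_two]; linarith
    · rw [him, abs_mul, abs_two, Real.mul_rpow (by norm_num) (by positivity)]
      have : (2 : ℝ) ^ (1 / 16 : ℝ) ≤ 2 := by
        calc (2 : ℝ) ^ (1 / 16 : ℝ) ≤ 2 ^ (1 : ℝ) :=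
              Real.rpow_le_rpow_of_exponent_le (by norm_num) (by norm_num)
          _ = 2 := Real.rpow_one 2
      have h0 : 0 ≤ |s.im| ^ (1 / 16 : ℝ) := by positivity
      nlinarith
  have hu : 0 < |s.im| ^ (1 / 16 : ℝ) := Real.rpow_pos_of_pos (by linarith) _
  have h4 : 1 ≤ (C / (s.re - 1)) ^ 3 * ‖riemannZeta s‖ ^ 4 * (108 * |s.im| ^ (1 / 16 : ℝ)) := by
    refine h3.trans ?_
    gcongr
  have h5 : (108 * C ^ 3)⁻¹ ^ 4 ≤ (108 * C ^ 3)⁻¹ := by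
    refine pow_le_of_le_one (by positivity) (inv_le_one_of_one_le₀ ?_) (by norm_num)
    have : 1 ≤ C ^ 3 := one_le_pow₀ hC1
    linarith
  calc _ ≤ (108 * C ^ 3)⁻¹ * (s.re - 1) ^ 3 / |s.im| ^ (1 / 16 : ℝ) := by gcongr
    _ ≤ (108 * C ^ 3)⁻¹ * (s.re - 1) ^ 3 / |s.im| ^ (1 / 16 : ℝ) *
        ((C / (s.re - 1)) ^ 3 * ‖riemannZeta s‖ ^ 4 * (108 * |s.im| ^ (1 / 16 : ℝ))) :=
      le_mul_of_one_le_right (by positivity) h4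
    _ = _ := by field_simp

/-- A zero-free region with a polynomial lower bound. -/
lemma exists_le_norm_riemannZeta :
    ∃ a c : ℝ, 0 < a ∧ a ≤ 1 / 4 ∧ 0 < c ∧ ∀ s : ℂ, 2 ≤ |s.im| →
      1 - a ^ 4 / (|s.im| ^ (1 / 16 : ℝ)) ^ 5 ≤ s.re → s.re ≤ 2 →
      c / (|s.im| ^ (1 / 16 : ℝ)) ^ 4 ≤ ‖riemannZeta s‖ := by
  obtain ⟨b, hb0, hb1, hb⟩ := exists_le_norm_riemannZeta_pow_four
  -- With `h = a⁴/u⁵`, this `a` makes the possible change `3456 u · 2h` of zeta across the strip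
  -- exactly half of the lower bound `b a³/u⁴` available at real part `1 + h`.
  set a : ℝ := b / (4 * 3456) with ha
  have ha0 : 0 < a := by positivity
  have ha4 : a ≤ 1 / 4 := by rw [ha]; linarith
  refine ⟨a, b * a ^ 3 / 2, ha0, ha4, by positivity, fun s ht h1 h2 => ?_⟩
  have hu1 : 1 ≤ |s.im| ^ (1 / 16 : ℝ) := Real.one_le_rpow (by linarith) (by norm_num)
  set u : ℝ := |s.im| ^ (1 / 16 : ℝ)
  have hu0 : 0 < u := by linarith
  set h : ℝ := a ^ 4 / u ^ 5 with hh
  have hh0 : 0 < h := by positivity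
  have hh1 : h ≤ 1 / 256 := by
    calc h ≤ a ^ 4 := div_le_self (by positivity) (one_le_pow₀ hu1)
      _ ≤ (1 / 4) ^ 4 := by gcongr
      _ = 1 / 256 := by norm_num
  have lower : ∀ w : ℂ, w.im = s.im → 1 + h ≤ w.re → w.re ≤ 2 →
      b * a ^ 3 / u ^ 4 ≤ ‖riemannZeta w‖ := by
    intro w hw hw1 hw2
    have h3 := hb w (by linarith) hw2 (by rw [hw]; exact ht)
    rw [hw] at h3
    refine le_of_pow_le_pow_left₀ (n := 4) (by norm_num) (norm_nonneg _) (le_trans ?_ h3)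
    -- The power `u⁵` in `h` is what makes `b⁴ h³/u` a perfect fourth power.
    calc (b * a ^ 3 / u ^ 4) ^ 4 = b ^ 4 * h ^ 3 / u := by rw [hh]; field_simp
      _ ≤ b ^ 4 * (w.re - 1) ^ 3 / u := by gcongr; linarith
  by_cases hcase : 1 + h ≤ s.re
  · refine le_trans ?_ (lower s rfl hcase h2)
    have : 0 < b * a ^ 3 := by positivity
    gcongr
    linarith
  · push Not at hcase
    set w : ℂ := ⟨1 + h, s.im⟩
    have hw := lower w rfl le_rfl (by simp only [w]; linarith)
    have hconv : Convex ℝ {z : ℂ | 31 / 32 ≤ z.re ∧ z.re ≤ 3 ∧ z.im = s.im} := by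
      intro x hx y hy p q hp hq hpq
      obtain ⟨x1, x2, x3⟩ := hx
      obtain ⟨y1, y2, y3⟩ := hy
      refine ⟨?_, ?_, ?_⟩
      · simp; nlinarith
      · simp; nlinarith
      · simp only [add_im, real_smul, mul_im, ofReal_re, ofReal_im, zero_mul, add_zero, x3, y3]
        rw [← add_mul, hpq, one_mul]
    -- Mean value inequality along the horizontal segment from `s` to real part `1 + h`, which stays
    -- in the region where the derivative is at most `3456 u`.
    have hmv := hconv.norm_image_sub_le_of_norm_deriv_le (f := riemannZeta) (C := 3456 * u)
      (x := s) (y := w) (fun z hz => differentiableAt_riemannZeta (ne_one_of_im (by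
        rw [hz.2.2]; linarith))) (fun z hz => by
        have := norm_deriv_riemannZeta_le hz.1 hz.2.1 (by rw [hz.2.2]; exact ht)
        rwa [hz.2.2] at this) ⟨by linarith, by linarith, rfl⟩
        ⟨by simp only [w]; linarith, by simp only [w]; linarith, rfl⟩
    have hdist : ‖w - s‖ ≤ 2 * h := by
      have : w - s = ((1 + h - s.re : ℝ) : ℂ) := by apply Complex.ext <;> simp [w]
      rw [this, Complex.norm_real, Real.norm_of_nonneg (by linarith)]
      linarith
    have h4 : ‖riemannZeta w‖ - ‖riemannZeta s‖ ≤ 3456 * u * (2 * h) :=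
      (norm_sub_norm_le _ _).trans (hmv.trans (by gcongr))
    have h5 : 3456 * u * (2 * h) = b * a ^ 3 / 2 / u ^ 4 := by
      rw [hh]
      have : b = a * (4 * 3456) := by rw [ha]; field_simp
      rw [this]; field_simp; ring
    have h6 : b * a ^ 3 / u ^ 4 = b * a ^ 3 / 2 / u ^ 4 + b * a ^ 3 / 2 / u ^ 4 := by ring
    linarith

end XiPrime

/-! ### The second derivative of `-ζ'/ζ - ζ` up to the line `Re s = 1` -/

namespace XiPrime

open Complex Set MeasureTheory Filter Topology

/-- The function `-ζ'/ζ - ζ`, with its singularity at `1` removed. -/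
noncomputable def zetaAux (s : ℂ) : ℂ := -(deriv riemannZeta₁ s / riemannZeta₁ s) - riemannZeta₀ s

lemma riemannZeta₁_ne_zero_of_ne {s : ℂ} (hs : s ≠ 1) (h : riemannZeta s ≠ 0) :
    riemannZeta₁ s ≠ 0 := by
  rw [riemannZeta_eq_inv_sub_mul hs] at h
  exact right_ne_zero_of_mul h

lemma riemannZeta₁_ne_zero_of_one_le_re {s : ℂ} (hs : 1 ≤ s.re) : riemannZeta₁ s ≠ 0 := by
  by_cases h : s = 1
  · simp [h]
  · exact riemannZeta₁_ne_zero_of_ne h (riemannZeta_ne_zero_of_one_le_re hs)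

/-- Both `-ζ'/ζ` and `ζ` have polar part `1/(s-1)`, so their difference is what the definition
expresses through the entire functions `riemannZeta₁` and `riemannZeta₀`. -/
lemma zetaAux_eq {s : ℂ} (hs : s ≠ 1) (h : riemannZeta s ≠ 0) :
    zetaAux s = -deriv riemannZeta s / riemannZeta s - riemannZeta s := by
  have h1 := riemannZeta₁_ne_zero_of_ne hs h
  have h2 := sub_ne_zero.mpr hs
  have h0 : riemannZeta₀ s = riemannZeta s - (s - 1)⁻¹ := by
    rw [riemannZeta_eq_inv_sub_add hs]; ring
  rw [zetaAux, h0, deriv_riemannZeta_eq_neg_inv_sub_sq_mul_add hs, riemannZeta_eq_inv_sub_mul hs]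
  field_simp
  ring

lemma isOpen_riemannZeta₁_ne_zero : IsOpen {s : ℂ | riemannZeta₁ s ≠ 0} :=
  isOpen_ne_fun differentiable_riemannZeta₁.continuous continuous_const

lemma analyticOnNhd_zetaAux : AnalyticOnNhd ℂ zetaAux {s | riemannZeta₁ s ≠ 0} := by
  refine DifferentiableOn.analyticOnNhd (fun s hs => ?_) isOpen_riemannZeta₁_ne_zero
  apply DifferentiableAt.differentiableWithinAt
  have h1 : DifferentiableAt ℂ (deriv riemannZeta₁) s := differentiable_riemannZeta₁.deriv s
  have h2 := differentiable_riemannZeta₁ s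
  have h3 := differentiable_riemannZeta₀ s
  exact ((h1.div h2 hs).neg).sub h3

/-- Cauchy's estimate on a disc inside the zero-free region. With `u = |t|^{1/16}` the function is
`O(u⁵)` on a disc of radius a multiple of `u⁻⁵`, so two derivatives cost `u¹⁰`, and `u¹⁵ ≤ u¹⁶ =
|t|`. -/
lemma exists_norm_iteratedDeriv_zetaAux_le_of_im_large :
    ∃ C : ℝ, 0 ≤ C ∧ ∀ s : ℂ, 1 ≤ s.re → s.re ≤ 3 / 2 → 3 ≤ |s.im| →
      ‖iteratedDeriv 2 zetaAux s‖ ≤ C * |s.im| := by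
  obtain ⟨a, c, ha0, ha4, hc0, hlow⟩ := exists_le_norm_riemannZeta
  set D : ℝ := 32 * (3456 / c + 54)
  refine ⟨2 * D / (a ^ 4 / 32) ^ 2, by positivity, fun s h1 h2 ht => ?_⟩
  have hu1 : 1 ≤ |s.im| ^ (1 / 16 : ℝ) := Real.one_le_rpow (by linarith) (by norm_num)
  have hupow : (|s.im| ^ (1 / 16 : ℝ)) ^ 16 = |s.im| := by
    rw [← Real.rpow_natCast, ← Real.rpow_mul (by positivity)]; norm_num
  set u : ℝ := |s.im| ^ (1 / 16 : ℝ)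
  have hu0 : 0 < u := by linarith
  -- `2u` rather than `u`: it bounds the sixteenth root of the height at every point of the disc, so
  -- the disc stays in the zero-free region.
  set r : ℝ := a ^ 4 / (2 * u) ^ 5 with hr
  have hr0 : 0 < r := by positivity
  have ha41 : a ^ 4 ≤ 1 / 256 := by
    calc a ^ 4 ≤ (1 / 4) ^ 4 := by gcongr
      _ = _ := by norm_num
  have hr1 : r ≤ 1 / 256 := (div_le_self (by positivity) (one_le_pow₀ (by linarith))).trans ha41
  have hball : ∀ w ∈ Metric.closedBall s r, w ≠ 1 ∧ riemannZeta w ≠ 0 ∧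
      ‖zetaAux w‖ ≤ D * u ^ 5 := by
    intro w hw
    have hwn := mem_closedBall_iff_norm.mp hw
    obtain ⟨hw1, hw2, hw3⟩ := rpow_im_le (by linarith) hwn (by linarith)
    have hwt : 2 ≤ |w.im| := by linarith
    have hwre := (abs_re_le_norm (w - s)).trans hwn
    rw [sub_re, abs_le] at hwre
    have hv1 : 1 ≤ |w.im| ^ (1 / 16 : ℝ) := Real.one_le_rpow (by linarith) (by norm_num)
    have hup := norm_riemannZeta_le (s := w) (by linarith) (by linarith) hw1
    have hder := norm_deriv_riemannZeta_le (s := w) (by linarith) (by linarith) hwt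
    have hlo := hlow w hwt
    set v : ℝ := |w.im| ^ (1 / 16 : ℝ)
    have hv0 : 0 < v := by linarith
    have hlo' := hlo (by
      have : r ≤ a ^ 4 / v ^ 5 := by rw [hr]; gcongr
      linarith) (by linarith)
    have hw0 : w ≠ 1 := ne_one_of_im hw1
    have hz : riemannZeta w ≠ 0 := by
      have : 0 < c / v ^ 4 := by positivity
      exact norm_pos_iff.mp (by linarith)
    refine ⟨hw0, hz, ?_⟩
    rw [zetaAux_eq hw0 hz]
    calc _ ≤ ‖-deriv riemannZeta w / riemannZeta w‖ + ‖riemannZeta w‖ := norm_sub_le _ _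
      _ ≤ 3456 * v / (c / v ^ 4) + 54 * v := by
        rw [norm_div, norm_neg]
        gcongr
      _ = (3456 / c) * v ^ 5 + 54 * v := by field_simp
      _ ≤ (3456 / c) * v ^ 5 + 54 * v ^ 5 := by
        gcongr
        exact le_self_pow₀ hv1 (by norm_num)
      _ = (3456 / c + 54) * v ^ 5 := by ring
      _ ≤ (3456 / c + 54) * (2 * u) ^ 5 := by gcongr
      _ = D * u ^ 5 := by simp only [D]; ring
  have h := norm_iteratedDeriv_le_of_forall_mem_sphere_norm_le (c := s) (C := D * u ^ 5)
    (f := zetaAux) 2 hr0 ?_ (fun w hw => (hball w (Metric.sphere_subset_closedBall hw)).2.2)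
  · refine h.trans ?_
    calc _ = 2 * D / (a ^ 4 / 32) ^ 2 * u ^ 15 := by
          rw [hr]
          simp only [Nat.factorial]
          field_simp
          norm_num
          ring
      _ ≤ 2 * D / (a ^ 4 / 32) ^ 2 * u ^ 16 := by
          gcongr
          norm_num
      _ = _ := by rw [hupow]
  · refine DifferentiableOn.diffContOnCl fun w hw => ?_
    rw [closure_ball _ hr0.ne'] at hw
    obtain ⟨h3, h4, _⟩ := hball w hw
    exact (analyticOnNhd_zetaAux w (riemannZeta₁_ne_zero_of_ne h3 h4)).differentiableAt.differentiableWithinAt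

/-- Compactness covers small heights. Linear growth in `‖s‖` is what is needed: the quotient by `s`
is then bounded uniformly as `Re s → 1`. -/
theorem exists_norm_iteratedDeriv_zetaAux_le :
    ∃ C : ℝ, 0 ≤ C ∧ ∀ s : ℂ, 1 ≤ s.re → s.re ≤ 3 / 2 →
      ‖iteratedDeriv 2 zetaAux s‖ ≤ C * ‖s‖ := by
  obtain ⟨C, hC0, hC⟩ := exists_norm_iteratedDeriv_zetaAux_le_of_im_large
  have hcont : ContinuousOn (iteratedDeriv 2 zetaAux) {s | riemannZeta₁ s ≠ 0} := by
    have := analyticOnNhd_zetaAux.deriv.deriv.continuousOn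
    rwa [iteratedDeriv_succ, iteratedDeriv_one]
  have hK : IsCompact (Icc (1 : ℝ) (3 / 2) ×ℂ Icc (-3 : ℝ) 3) := isCompact_Icc.reProdIm isCompact_Icc
  obtain ⟨D, hD⟩ := hK.exists_bound_of_continuousOn (hcont.mono fun s hs =>
    riemannZeta₁_ne_zero_of_one_le_re hs.1.1)
  refine ⟨max C D, hC0.trans (le_max_left _ _), fun s h1 h2 => ?_⟩
  have hM : 0 ≤ max C D := hC0.trans (le_max_left _ _)
  by_cases ht : 3 ≤ |s.im|
  · refine (hC s h1 h2 ht).trans ?_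
    gcongr
    · exact le_max_left _ _
    · exact abs_im_le_norm s
  · push Not at ht
    have h3 : 1 ≤ ‖s‖ := h1.trans (re_le_norm s)
    refine (hD s ⟨⟨h1, h2⟩, abs_le.mp ht.le⟩).trans ?_
    exact (le_max_right _ _).trans (le_mul_of_one_le_right hM h3)

end XiPrime

namespace XiPrime

open Complex Set MeasureTheory Filter Topology ArithmeticFunction FourierTransform

/-! ### A bump function with integrable Fourier transform -/

/-- The bump is the Fourier transform of a Schwartz function `ψ`, so `∫ g b = ∫ ĝ ψ`, which is at
most `‖ψ‖₁ sup |ĝ|`. -/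
lemma exists_bump_fourier_bound :
    ∃ b : ℝ → ℝ, Continuous b ∧ (∀ z, 0 ≤ b z) ∧ (∀ z, b z ≤ 1) ∧ (∀ z ∉ Icc (0 : ℝ) 1, b z = 0) ∧
      0 < ∫ z, b z ∧ Integrable b ∧
      ∃ K : ℝ, 0 ≤ K ∧ ∀ g : ℝ → ℂ, Integrable g → ∀ B : ℝ, (∀ τ, ‖𝓕 g τ‖ ≤ B) →
        ‖∫ z, g z * b z‖ ≤ K * B := by
  let b : ContDiffBump (1 / 2 : ℝ) := ⟨1 / 4, 1 / 2, by norm_num, by norm_num⟩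
  have hbc : HasCompactSupport (fun z => (b z : ℂ)) :=
    b.hasCompactSupport.comp_left (g := fun r : ℝ => (r : ℂ)) (by simp)
  have hbd : ContDiff ℝ (⊤ : ℕ∞) (fun z => (b z : ℂ)) := Complex.ofRealCLM.contDiff.comp b.contDiff
  let S : SchwartzMap ℝ ℂ := hbc.toSchwartzMap hbd
  let ψ : SchwartzMap ℝ ℂ := 𝓕⁻ S
  have hψ : ∀ z, 𝓕 (ψ : ℝ → ℂ) z = b z := by
    intro z
    have : 𝓕 ψ = S := by simp [ψ]
    have h2 := congrArg (fun f : SchwartzMap ℝ ℂ => f z) this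
    simpa [SchwartzMap.fourier_coe, S] using h2
  refine ⟨b, b.continuous, fun z => b.nonneg, fun z => b.le_one, fun z hz => ?_, b.integral_pos,
    b.integrable, ∫ z, ‖ψ z‖, integral_nonneg fun _ => norm_nonneg _, fun g hg B hB => ?_⟩
  · refine b.zero_of_le_dist ?_
    simp only [b]
    rw [Real.dist_eq]
    by_contra h
    push Not at h
    rw [abs_lt] at h
    exact hz ⟨by linarith, by linarith⟩
  · have hflip : ∫ τ, 𝓕 g τ • ψ τ = ∫ z, g z • 𝓕 (ψ : ℝ → ℂ) z := by
      simpa using! VectorFourier.integral_fourierIntegral_smul_eq_flip (L := innerₗ ℝ)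
        Real.continuous_fourierChar continuous_inner hg ψ.integrable
    have e : ∫ z, g z * b z = ∫ τ, 𝓕 g τ • ψ τ := by
      rw [hflip]
      simp only [hψ, smul_eq_mul]
    rw [e, mul_comm, ← integral_const_mul]
    refine norm_integral_le_of_norm_le (ψ.integrable.norm.const_mul B) (Eventually.of_forall fun τ => ?_)
    rw [norm_smul]
    gcongr
    exact hB τ

/-- A translation only multiplies the transform by a phase, and a dilation by `η` contributes the
factor `1/|η|`. -/
lemma norm_fourier_comp_affine_le {g : ℝ → ℂ} {B : ℝ} (hB : ∀ τ, ‖𝓕 g τ‖ ≤ B) (y : ℝ) {η : ℝ}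
    (hη : η ≠ 0) (τ : ℝ) : ‖𝓕 (fun z => g (y + η * z)) τ‖ ≤ B / |η| := by
  have h1 : 𝓕 (fun z => g (y + η * z)) τ =
      |η⁻¹| • (Complex.exp ((2 * Real.pi * (τ * y / η) : ℝ) * I) * 𝓕 g (τ / η)) := by
    rw [Real.fourier_real_eq_integral_exp_smul, Real.fourier_real_eq_integral_exp_smul,
      ← integral_const_mul]
    set h : ℝ → ℂ := fun v => Complex.exp ((2 * Real.pi * (τ * y / η) : ℝ) * I) *
      Complex.exp (((-2 * Real.pi * v * (τ / η) : ℝ) : ℂ) * I) • g v with hh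
    have h2 : ∫ v, h v = ∫ v, h (y + v) := (integral_add_left_eq_self h y).symm
    rw [h2, ← Measure.integral_comp_mul_left (fun v => h (y + v)) η]
    congr 1
    ext z
    simp only [hh, smul_eq_mul]
    rw [← mul_assoc, ← Complex.exp_add]
    congr 2
    push_cast
    have : (η : ℂ) ≠ 0 := by exact_mod_cast hη
    field_simp
    ring
  rw [h1, norm_smul, norm_mul, Complex.norm_exp_ofReal_mul_I, one_mul, Real.norm_of_nonneg (by positivity),
    abs_inv, inv_mul_eq_div]
  gcongr
  exact hB _

/-! ### Dirichlet series with coefficients `(Λ(n) - 1) log² n` -/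

/-- The coefficients `(Λ(n) - 1) log² n`. -/
noncomputable def cf (n : ℕ) : ℝ := (vonMangoldt n - 1) * Real.log n ^ 2

/-- The summatory function of `cf`. -/
noncomputable def cfSum (x : ℝ) : ℝ := ∑ n ∈ Finset.Icc 1 ⌊x⌋₊, cf n

/-- The coefficients of `-ζ'/ζ - ζ` are `Λ - 1`; each derivative multiplies them by `-log n`, and
the two signs cancel. -/
lemma LSeries_cf {s : ℂ} (hs : 1 < s.re) :
    LSeriesSummable (fun n => (cf n : ℂ)) s ∧
      LSeries (fun n => (cf n : ℂ)) s = iteratedDeriv 2 zetaAux s := by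
  set f₀ : ℕ → ℂ := fun n => (vonMangoldt n : ℂ) - 1
  have hsum : ∀ z : ℂ, 1 < z.re → LSeriesSummable f₀ z := fun z hz =>
    (LSeriesSummable_vonMangoldt hz).sub (LSeriesSummable_one_iff.mpr hz)
  have habs : LSeries.abscissaOfAbsConv f₀ < s.re := by
    refine lt_of_le_of_lt (LSeries.abscissaOfAbsConv_le_of_forall_lt_LSeriesSummable (x := 1)
      fun y hy => hsum y (by simpa using hy)) ?_
    exact_mod_cast hs
  have hlog : LSeries.logMul^[2] f₀ = fun n => (cf n : ℂ) := by
    ext n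
    simp only [Function.iterate_succ, Function.iterate_zero, Function.comp_apply, id_eq,
      LSeries.logMul, f₀, cf]
    push_cast
    rw [← Complex.natCast_log]
    ring
  constructor
  · rw [← hlog]
    refine LSeriesSummable_of_abscissaOfAbsConv_lt_re ?_
    rwa [LSeries.absicssaOfAbsConv_logPowMul]
  · have h := LSeries_iteratedDeriv 2 habs
    rw [hlog] at h
    simp only [even_two, Even.neg_pow, one_pow, one_mul] at h
    rw [← h]
    refine Filter.EventuallyEq.iteratedDeriv_eq 2 ?_
    filter_upwards [(isOpen_lt continuous_const continuous_re).mem_nhds hs] with z hz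
    have hz' : 1 < z.re := hz
    have hz1 : z ≠ 1 := by rintro rfl; simp at hz'
    rw [zetaAux_eq hz1 (riemannZeta_ne_zero_of_one_lt_re hz'),
      ← LSeries_vonMangoldt_eq_deriv_riemannZeta_div hz', ← LSeries_one_eq_riemannZeta hz',
      ← LSeries_sub (LSeriesSummable_vonMangoldt hz') (LSeriesSummable_one_iff.mpr hz')]
    rfl

lemma sum_abs_cf_le {x : ℝ} (hx : 1 ≤ x) :
    ∑ n ∈ Finset.Icc 1 ⌊x⌋₊, |cf n| ≤ (Real.log 4 + 5) * x * Real.log x ^ 2 := by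
  have h1 : ∀ n ∈ Finset.Icc 1 ⌊x⌋₊, |cf n| ≤ (vonMangoldt n + 1) * Real.log x ^ 2 := by
    intro n hn
    have hn1 := Finset.mem_Icc.mp hn
    have hn0 : (0 : ℝ) < n := by exact_mod_cast hn1.1
    have hnx : (n : ℝ) ≤ x := (Nat.le_floor_iff (by linarith)).mp hn1.2
    have hlog0 : 0 ≤ Real.log n := Real.log_natCast_nonneg n
    rw [cf, abs_mul, abs_of_nonneg (by positivity : 0 ≤ Real.log n ^ 2)]
    have : |vonMangoldt n - 1| ≤ vonMangoldt n + 1 := by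
      have := vonMangoldt_nonneg (n := n)
      rw [abs_le]; constructor <;> linarith
    have h0 := vonMangoldt_nonneg (n := n)
    gcongr
  refine (Finset.sum_le_sum h1).trans ?_
  rw [← Finset.sum_mul, Finset.sum_add_distrib]
  have h2 : ∑ n ∈ Finset.Icc 1 ⌊x⌋₊, vonMangoldt n ≤ (Real.log 4 + 4) * x :=
    Chebyshev.psi_le_const_mul_self (by linarith)
  have h3 : ∑ n ∈ Finset.Icc 1 ⌊x⌋₊, (1 : ℝ) ≤ x := by
    simpa using Nat.floor_le (by linarith : 0 ≤ x)
  gcongr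
  linarith

lemma exists_sum_abs_cf_le_rpow {r : ℝ} (hr : 1 < r) :
    ∃ A : ℝ, 0 ≤ A ∧ ∀ x : ℝ, 1 ≤ x → ∑ n ∈ Finset.Icc 1 ⌊x⌋₊, |cf n| ≤ A * x ^ r := by
  set δ := (r - 1) / 2 with hδ
  have hδ0 : 0 < δ := by rw [hδ]; linarith
  have hlog4 : 0 ≤ Real.log 4 := Real.log_nonneg (by norm_num)
  refine ⟨(Real.log 4 + 5) * (1 / δ) ^ 2, by positivity, fun x hx => (sum_abs_cf_le hx).trans ?_⟩
  have hx0 : 0 < x := by linarith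
  have h1 : Real.log x ≤ x ^ δ / δ := Real.log_le_rpow_div hx0.le hδ0
  have h0 : 0 ≤ Real.log x := Real.log_nonneg hx
  calc _ ≤ (Real.log 4 + 5) * x * (x ^ δ / δ) ^ 2 := by gcongr
    _ = (Real.log 4 + 5) * (1 / δ) ^ 2 * (x ^ (1 : ℝ) * (x ^ δ * x ^ δ)) := by
      rw [Real.rpow_one]; field_simp
    _ = _ := by
      rw [← Real.rpow_add hx0, ← Real.rpow_add hx0]
      congr 2
      rw [hδ]; ring

lemma abs_cfSum_le (x : ℝ) : |cfSum x| ≤ ∑ n ∈ Finset.Icc 1 ⌊x⌋₊, |cf n| :=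
  Finset.abs_sum_le_sum_abs _ _

lemma cfSum_of_lt_one {x : ℝ} (hx : x < 1) : cfSum x = 0 := by
  simp [cfSum, Nat.floor_eq_zero.mpr hx]

lemma measurable_cfSum : Measurable cfSum :=
  (measurable_from_nat (f := fun N => ∑ n ∈ Finset.Icc 1 N, cf n)).comp Nat.measurable_floor

lemma mellin_cfSum {s : ℂ} (hs : 1 < s.re) :
    mellin (fun t => (cfSum t : ℂ)) (-s) = iteratedDeriv 2 zetaAux s / s := by
  have hs0 : s ≠ 0 := by rintro rfl; simp at hs; linarith
  set r := (1 + s.re) / 2 with hr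
  have hr1 : 1 < r := by rw [hr]; linarith
  obtain ⟨A, hA0, hA⟩ := exists_sum_abs_cf_le_rpow hr1
  have hL := LSeries_eq_mul_integral' (fun n => (cf n : ℂ)) (r := r) (by linarith) (s := s)
    (by rw [hr]; linarith) (by
      refine Asymptotics.IsBigO.of_bound A ((eventually_ge_atTop 1).mono fun n hn => ?_)
      have := hA n (by exact_mod_cast hn)
      rw [Nat.floor_natCast] at this
      rw [Real.norm_of_nonneg (by positivity), Real.norm_of_nonneg (by positivity)]
      simpa using this)
  rw [(LSeries_cf hs).2] at hL
  rw [hL, mul_div_cancel_left₀ _ hs0, mellin]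
  symm
  have hset : ∫ t in Ioi (0 : ℝ), (t : ℂ) ^ (-s - 1) • (cfSum t : ℂ) =
      ∫ t in Ioi (1 : ℝ), (t : ℂ) ^ (-s - 1) • (cfSum t : ℂ) := by
    refine setIntegral_eq_of_subset_of_ae_sdiff_eq_zero measurableSet_Ioi.nullMeasurableSet
      (Ioi_subset_Ioi zero_le_one) ?_
    have : ∀ᵐ t : ℝ, t ≠ 1 := by simp [ae_iff]
    filter_upwards [this] with t ht1 ht
    have : t < 1 := lt_of_le_of_ne (not_lt.mp ht.2) ht1
    rw [cfSum_of_lt_one this]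
    simp
  rw [hset]
  refine setIntegral_congr_fun measurableSet_Ioi fun t _ => ?_
  simp only [cfSum, smul_eq_mul, neg_add]
  push_cast
  rw [mul_comm, sub_eq_add_neg]

/-- The summatory function of `cf` in logarithmic scale, exponentially damped. -/
noncomputable def dampedSum (σ u : ℝ) : ℝ := Real.exp (σ * u) * cfSum (Real.exp (-u))

lemma integrable_dampedSum {σ : ℝ} (hσ : 1 < σ) : Integrable (fun u => (dampedSum σ u : ℂ)) := by
  set r := (1 + σ) / 2 with hr
  have hr1 : 1 < r := by rw [hr]; linarith
  obtain ⟨A, hA0, hA⟩ := exists_sum_abs_cf_le_rpow hr1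
  have hexp : Integrable ((Iic (0 : ℝ)).indicator fun u => A * Real.exp ((σ - r) * u)) := by
    refine IntegrableOn.integrable_indicator ?_ measurableSet_Iic
    exact (integrableOn_exp_mul_Iic (by rw [hr]; linarith) 0).const_mul A
  suffices h : Integrable (dampedSum σ) from h.ofReal
  refine hexp.mono' ?_ (Eventually.of_forall fun u => ?_)
  · refine Measurable.aestronglyMeasurable ?_
    have h := measurable_cfSum
    exact (by fun_prop : Measurable fun u => Real.exp (σ * u) * cfSum (Real.exp (-u)))
  · rw [dampedSum, Real.norm_eq_abs, abs_mul, Real.abs_exp]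
    by_cases hu : u ∈ Iic (0 : ℝ)
    · rw [indicator_of_mem hu]
      have hu' : u ≤ 0 := hu
      have h1 := (abs_cfSum_le _).trans (hA (Real.exp (-u)) (Real.one_le_exp (by linarith)))
      calc _ ≤ Real.exp (σ * u) * (A * Real.exp (-u) ^ r) := by gcongr
        _ = _ := by
          rw [← Real.exp_mul, mul_left_comm, ← Real.exp_add]
          congr 2; ring
    · rw [indicator_of_notMem hu, cfSum_of_lt_one]
      · simp
      · have : 0 < u := not_le.mp hu
        exact Real.exp_zero ▸ Real.exp_lt_exp.mpr (by linarith : -u < 0)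

/-- On the vertical line of abscissa `σ` the Mellin transform is a Fourier transform in `u = -log
t`, with `s = σ - 2πiτ`. -/
lemma fourier_dampedSum {σ : ℝ} (hσ : 1 < σ) (τ : ℝ) :
    𝓕 (fun u => (dampedSum σ u : ℂ)) τ =
      iteratedDeriv 2 zetaAux (σ - 2 * Real.pi * τ * I) / (σ - 2 * Real.pi * τ * I) := by
  have hre : ((σ : ℂ) - 2 * Real.pi * τ * I).re = σ := by simp
  have him : (-((σ : ℂ) - 2 * Real.pi * τ * I)).im = 2 * Real.pi * τ := by simp
  rw [← mellin_cfSum (by rw [hre]; exact hσ), mellin_eq_fourier, neg_re, hre, him,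
    mul_div_cancel_left₀ _ (by positivity)]
  have : (fun u => (dampedSum σ u : ℂ)) =
      fun u => Real.exp (-(-σ) * u) • ((cfSum (Real.exp (-u)) : ℝ) : ℂ) := by
    funext u
    simp [dampedSum]
  rw [this]

end XiPrime

/-! ### The Tauberian argument -/

namespace XiPrime

open Complex Set MeasureTheory Filter Topology ArithmeticFunction FourierTransform

/-- The Tauberian condition: since `Λ ≥ 0`, each coefficient is at least `-log² n`, so the sum can
fall only slowly, although no comparable bound is available for its rise. -/
lemma cfSum_sub_le {x y : ℝ} (hxy : x ≤ y) (hy : 1 ≤ y) :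
    cfSum x - cfSum y ≤ (y - x + 1) * Real.log y ^ 2 := by
  have hfl : ⌊x⌋₊ ≤ ⌊y⌋₊ := Nat.floor_le_floor hxy
  have hsplit : cfSum y - cfSum x = ∑ n ∈ Finset.Ioc ⌊x⌋₊ ⌊y⌋₊, cf n := by
    have h : ∀ N : ℕ, Finset.Icc 1 N = Finset.Ioc 0 N := fun N => by ext; simp; omega
    rw [cfSum, cfSum, h, h, ← Finset.sum_Ioc_consecutive _ (Nat.zero_le _) hfl]
    ring
  have hterm : ∀ n ∈ Finset.Ioc ⌊x⌋₊ ⌊y⌋₊, -Real.log y ^ 2 ≤ cf n := by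
    intro n hn
    have hn' := Finset.mem_Ioc.mp hn
    have hn0 : (0 : ℝ) < n := by exact_mod_cast (by omega : 0 < n)
    have hny : (n : ℝ) ≤ y := (Nat.le_floor_iff (by linarith)).mp hn'.2
    have h0 := vonMangoldt_nonneg (n := n)
    have hlog0 : 0 ≤ Real.log n := Real.log_natCast_nonneg n
    have h1 : Real.log n ^ 2 ≤ Real.log y ^ 2 := by gcongr
    rw [cf]
    nlinarith [sq_nonneg (Real.log n)]
  have h := Finset.card_nsmul_le_sum _ _ _ hterm
  rw [← hsplit, Nat.card_Ioc, nsmul_eq_mul, Nat.cast_sub hfl] at h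
  have h1 := Nat.lt_floor_add_one x
  have h2 := Nat.floor_le (by linarith : 0 ≤ y)
  have h3 : ((⌊y⌋₊ : ℝ) - ⌊x⌋₊) * Real.log y ^ 2 ≤ (y - x + 1) * Real.log y ^ 2 := by
    gcongr; linarith
  linarith

/-- The Tauberian step: a one-sided bound for `cfSum` on a short interval is of size `x log x`. -/
lemma exists_le_of_le_cfSum :
    ∃ C : ℝ, 0 ≤ C ∧ ∀ x : ℝ, 0 < x → 2 ≤ Real.log x → ∀ e : ℝ, |e| = 1 → ∀ D : ℝ, 0 ≤ D →
      (∀ z ∈ Icc (0 : ℝ) 1, D ≤ e * cfSum (Real.exp (Real.log x + e * (Real.log x)⁻¹ * z))) →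
      D ≤ C * (x * Real.log x) := by
  obtain ⟨b, hbc, hb0, hb1, hbz, hbpos, hbi, K, hK0, hK⟩ := exists_bump_fourier_bound
  obtain ⟨B, hB0, hB⟩ := exists_norm_iteratedDeriv_zetaAux_le
  refine ⟨K * B * Real.exp 2 / ∫ z, b z, by positivity, fun x hx0 hx e he D hD hz => ?_⟩
  have hL0 : 0 < Real.log x := by linarith
  set L := Real.log x with hLdef
  -- At `u = -log x` the damping factor is then `e⁻¹/x`, and it is at least `e⁻²/x` throughout a
  -- window of length `1/L`.
  set σ : ℝ := 1 + L⁻¹ with hσ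
  have hinv0 : 0 < L⁻¹ := by positivity
  have hinv : L⁻¹ ≤ 1 / 2 := by
    rw [inv_eq_one_div]; gcongr
  have hσ1 : 1 < σ := by linarith
  have hfour : ∀ τ, ‖𝓕 (fun u => (dampedSum σ u : ℂ)) τ‖ ≤ B := by
    intro τ
    have hre : ((σ : ℂ) - 2 * Real.pi * τ * I).re = σ := by simp
    have hne : 0 < ‖(σ : ℂ) - 2 * Real.pi * τ * I‖ := by
      rw [norm_pos_iff]
      intro h
      rw [h, zero_re] at hre
      linarith
    rw [fourier_dampedSum hσ1, norm_div, div_le_iff₀ hne]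
    exact hB _ (by rw [hre]; exact hσ1.le) (by rw [hre]; linarith)
  have he0 : e ≠ 0 := by rintro rfl; simp at he
  have hη : -(e * L⁻¹) ≠ 0 := neg_ne_zero.mpr (mul_ne_zero he0 hinv0.ne')
  have habs : |-(e * L⁻¹)| = L⁻¹ := by rw [abs_neg, abs_mul, he, one_mul, abs_of_pos hinv0]
  -- Rescaling the window of length `1/L` to `[0, 1]` multiplies the Fourier bound by `L`; this is
  -- the factor `log x` in the result. The sign `e` puts the window to the right or to the left of
  -- `log x`.
  have hfour' := norm_fourier_comp_affine_le hfour (-L) hη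
  rw [habs] at hfour'
  have hgi : Integrable (fun z => (dampedSum σ (-L + -(e * L⁻¹) * z) : ℂ)) :=
    ((integrable_dampedSum hσ1).comp_add_left (-L)).comp_mul_left' hη
  have hmain := hK _ hgi _ hfour'
  have hreal : ∫ z, (dampedSum σ (-L + -(e * L⁻¹) * z) : ℂ) * b z =
      ((∫ z, dampedSum σ (-L + -(e * L⁻¹) * z) * b z : ℝ) : ℂ) := by
    refine Eq.trans ?_ integral_complex_ofReal
    simp
  rw [hreal, Complex.norm_real, Real.norm_eq_abs] at hmain
  have hgr : Integrable (fun z => dampedSum σ (-L + -(e * L⁻¹) * z) * b z) := by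
    have h1 : Integrable (fun z => dampedSum σ (-L + -(e * L⁻¹) * z)) := by
      simpa using! hgi.re
    refine h1.mul_bdd (c := 1) hbc.aestronglyMeasurable (Eventually.of_forall fun z => ?_)
    rw [Real.norm_of_nonneg (hb0 z)]
    exact hb1 z
  have hlow : ∫ z, Real.exp (-2) / x * D * b z ≤
      ∫ z, e * (dampedSum σ (-L + -(e * L⁻¹) * z) * b z) := by
    refine integral_mono (hbi.const_mul _) (hgr.const_mul e) fun z => ?_
    by_cases hzm : z ∈ Icc (0 : ℝ) 1
    · have h1 := hz z hzm
      have h2 : -(-L + -(e * L⁻¹) * z) = L + e * L⁻¹ * z := by ring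
      simp only [dampedSum, h2]
      have hez : |e * L⁻¹ * z| ≤ L⁻¹ := by
        rw [abs_mul, abs_mul, he, one_mul, abs_of_pos hinv0, abs_of_nonneg hzm.1]
        exact mul_le_of_le_one_right hinv0.le hzm.2
      have h3 : Real.exp (-2) / x ≤ Real.exp (σ * (-L + -(e * L⁻¹) * z)) := by
        have : Real.exp (-2) / x = Real.exp (-2 - L) := by
          rw [Real.exp_sub, hLdef, Real.exp_log hx0]
        rw [this]
        apply Real.exp_le_exp.mpr
        have h4 : σ * L = L + 1 := by rw [hσ]; field_simp
        have h5 : σ * (e * L⁻¹ * z) ≤ 1 := by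
          have := (abs_le.mp hez).2
          nlinarith
        nlinarith
      calc Real.exp (-2) / x * D * b z
          ≤ Real.exp (σ * (-L + -(e * L⁻¹) * z)) *
            (e * cfSum (Real.exp (L + e * L⁻¹ * z))) * b z := by
            have := hb0 z
            gcongr
        _ = _ := by ring
    · simp [hbz z hzm]
  rw [integral_const_mul, integral_const_mul] at hlow
  have h6 : e * ∫ z, dampedSum σ (-L + -(e * L⁻¹) * z) * b z ≤ K * (B / L⁻¹) := by
    refine (le_abs_self _).trans ?_
    rw [abs_mul, he, one_mul]
    exact hmain
  have h7 := hlow.trans h6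
  rw [div_mul_eq_mul_div, le_div_iff₀ hbpos]
  have h8 : Real.exp (-2) * Real.exp 2 = 1 := by rw [← Real.exp_add]; simp
  calc D * ∫ z, b z = (Real.exp (-2) / x * D * ∫ z, b z) * (x * Real.exp 2) := by
        have : (Real.exp (-2) / x * D * ∫ z, b z) * (x * Real.exp 2) =
            (Real.exp (-2) * Real.exp 2) * (x / x) * (D * ∫ z, b z) := by ring
        rw [this, h8, div_self hx0.ne', one_mul, one_mul]
    _ ≤ K * (B / L⁻¹) * (x * Real.exp 2) := by gcongr
    _ = _ := by field_simp

/-- The prime number theorem with a saving of one logarithm, in weighted form. -/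
theorem exists_abs_cfSum_le :
    ∃ C : ℝ, 0 ≤ C ∧ ∀ x : ℝ, 1 ≤ x → |cfSum x| ≤ C * (x * Real.log x) := by
  obtain ⟨C, hC0, hC⟩ := exists_le_of_le_cfSum
  have hlog4 : 0 ≤ Real.log 4 := Real.log_nonneg (by norm_num)
  refine ⟨2 * (Real.log 4 + 5) + (C + 20), by positivity, fun x hx => ?_⟩
  have hx0 : 0 < x := by linarith
  have hL : 0 ≤ Real.log x := Real.log_nonneg hx
  by_cases h2 : Real.log x ≤ 2
  · calc |cfSum x| ≤ (Real.log 4 + 5) * x * Real.log x ^ 2 := (abs_cfSum_le x).trans (sum_abs_cf_le hx)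
      _ = (Real.log 4 + 5) * (x * Real.log x) * Real.log x := by ring
      _ ≤ (Real.log 4 + 5) * (x * Real.log x) * 2 := by gcongr
      _ = 2 * (Real.log 4 + 5) * (x * Real.log x) := by ring
      _ ≤ _ := by gcongr; linarith
  push Not at h2
  set L := Real.log x with hLdef
  have hL0 : 0 < L := by linarith
  have hinv0 : 0 < L⁻¹ := by positivity
  have hinv : L⁻¹ ≤ 1 / 2 := by
    rw [inv_eq_one_div]; gcongr
  have hLx : L ≤ x := (Real.log_le_sub_one_of_pos hx0).trans (by linarith)
  -- Slow decrease propagates a large positive value to the right and a large negative value to the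
  -- left, with a loss of at most `20 x L` over the window, so the Tauberian step applies to what
  -- remains.
  have hkey : ∀ e : ℝ, |e| = 1 → (∀ z ∈ Icc (0 : ℝ) 1,
      e * cfSum x - 20 * (x * L) ≤ e * cfSum (Real.exp (L + e * L⁻¹ * z))) →
      e * cfSum x ≤ (C + 20) * (x * L) := by
    intro e he hz
    by_cases hD : 0 ≤ e * cfSum x - 20 * (x * L)
    · have := hC x hx0 h2.le e he _ hD hz
      linarith
    · push Not at hD
      have : 0 ≤ C * (x * L) := by positivity
      linarith
  have hup : cfSum x ≤ (C + 20) * (x * L) := by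
    have := hkey 1 (by simp) (fun z hz => ?_)
    · simpa using this
    · rw [one_mul, one_mul, one_mul]
      have hz0 : 0 ≤ L⁻¹ * z := mul_nonneg hinv0.le hz.1
      have hz1 : L⁻¹ * z ≤ L⁻¹ := mul_le_of_le_one_right hinv0.le hz.2
      have hy : Real.exp (L + L⁻¹ * z) = x * Real.exp (L⁻¹ * z) := by
        rw [Real.exp_add, hLdef, Real.exp_log hx0]
      have he1 : 1 ≤ Real.exp (L⁻¹ * z) := Real.one_le_exp hz0
      have he2 : Real.exp (L⁻¹ * z) ≤ 1 + 2 * L⁻¹ := by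
        have h := Real.abs_exp_sub_one_le (x := L⁻¹ * z) (by rw [abs_of_nonneg hz0]; linarith)
        rw [abs_of_nonneg hz0] at h
        linarith [(abs_le.mp h).2]
      have h3 := cfSum_sub_le (x := x) (y := Real.exp (L + L⁻¹ * z))
        (by rw [hy]; exact le_mul_of_one_le_right hx0.le he1) (by rw [hy]; nlinarith)
      rw [Real.log_exp] at h3
      have h4 : Real.exp (L + L⁻¹ * z) - x + 1 ≤ 3 * (x / L) := by
        have h5 : 1 ≤ x / L := by rw [le_div_iff₀ hL0]; linarith
        have h6 : x * Real.exp (L⁻¹ * z) ≤ x * (1 + 2 * L⁻¹) := by gcongr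
        rw [hy]
        have : x * (1 + 2 * L⁻¹) = x + 2 * (x / L) := by ring
        linarith
      have h7 : (L + L⁻¹ * z) ^ 2 ≤ (5 / 4 * L) ^ 2 := by gcongr; linarith
      have h8 : (Real.exp (L + L⁻¹ * z) - x + 1) * (L + L⁻¹ * z) ^ 2 ≤
          3 * (x / L) * (5 / 4 * L) ^ 2 := by
        gcongr
      have h9 : 3 * (x / L) * (5 / 4 * L) ^ 2 = 75 / 16 * (x * L) := by field_simp; norm_num
      have h10 : 0 ≤ x * L := by positivity
      linarith
  have hdown : -cfSum x ≤ (C + 20) * (x * L) := by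
    have := hkey (-1) (by simp) (fun z hz => ?_)
    · simpa using this
    · rw [neg_one_mul, neg_one_mul, neg_one_mul]
      have hz0 : 0 ≤ L⁻¹ * z := mul_nonneg hinv0.le hz.1
      have hz1 : L⁻¹ * z ≤ L⁻¹ := mul_le_of_le_one_right hinv0.le hz.2
      have hy : Real.exp (L + -L⁻¹ * z) = x * Real.exp (-(L⁻¹ * z)) := by
        rw [Real.exp_add, hLdef, Real.exp_log hx0, neg_mul]
      have he1 : Real.exp (-(L⁻¹ * z)) ≤ 1 := Real.exp_le_one_iff.mpr (by linarith)
      have he2 : 1 - L⁻¹ ≤ Real.exp (-(L⁻¹ * z)) := by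
        linarith [Real.add_one_le_exp (-(L⁻¹ * z))]
      have h3 := cfSum_sub_le (x := Real.exp (L + -L⁻¹ * z)) (y := x)
        (by rw [hy]; exact mul_le_of_le_one_right hx0.le he1) hx
      have h4 : x - Real.exp (L + -L⁻¹ * z) + 1 ≤ 2 * (x / L) := by
        have h5 : 1 ≤ x / L := by rw [le_div_iff₀ hL0]; linarith
        have h6 : x * (1 - L⁻¹) ≤ x * Real.exp (-(L⁻¹ * z)) := by gcongr
        rw [hy]
        have : x * (1 - L⁻¹) = x - x / L := by ring
        linarith
      have h8 : (x - Real.exp (L + -L⁻¹ * z) + 1) * L ^ 2 ≤ 2 * (x / L) * L ^ 2 := by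
        gcongr
      have h9 : 2 * (x / L) * L ^ 2 = 2 * (x * L) := by field_simp
      have h10 : 0 ≤ x * L := by positivity
      linarith
  have hA : 0 ≤ 2 * (Real.log 4 + 5) * (x * L) := by positivity
  rw [abs_le]
  constructor <;> linarith

end XiPrime

namespace XiPrime

open Set MeasureTheory Filter Topology ArithmeticFunction

/-! ### Summatory functions -/

/-- The summatory function `∑_{n ≤ x} f n`. -/
noncomputable def psum (f : ℕ → ℝ) (x : ℝ) : ℝ := ∑ n ∈ Finset.Icc 1 ⌊x⌋₊, f n

/-- `1 + log x`. -/
noncomputable def lg (x : ℝ) : ℝ := 1 + Real.log x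

/-- The logarithmic Riesz mean `∑_{n ≤ x} f n log^m (x / n)`. -/
noncomputable def riesz (f : ℕ → ℝ) (m : ℕ) (x : ℝ) : ℝ :=
  ∑ n ∈ Finset.Icc 1 ⌊x⌋₊, f n * Real.log (x / n) ^ m

lemma riesz_zero (f : ℕ → ℝ) (x : ℝ) : riesz f 0 x = psum f x := by simp [riesz, psum]

lemma mem_Icc_floor {x : ℝ} (hx : 1 ≤ x) {n : ℕ} (hn : n ∈ Finset.Icc 1 ⌊x⌋₊) :
    (1 : ℝ) ≤ n ∧ (n : ℝ) ≤ x := by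
  have h := Finset.mem_Icc.mp hn
  exact ⟨by exact_mod_cast h.1, (Nat.le_floor_iff (by linarith)).mp h.2⟩

lemma one_le_lg {x : ℝ} (hx : 1 ≤ x) : 1 ≤ lg x := by
  have := Real.log_nonneg hx
  unfold lg; linarith

lemma log_le_lg (x : ℝ) : Real.log x ≤ lg x := by unfold lg; linarith

lemma lg_mono {x y : ℝ} (hx : 1 ≤ x) (hxy : x ≤ y) : lg x ≤ lg y := by
  have := Real.log_le_log (by linarith) hxy
  unfold lg; linarith

lemma lg_le {x : ℝ} (hx : 1 ≤ x) : lg x ≤ x := by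
  have := Real.log_le_sub_one_of_pos (by linarith : 0 < x)
  unfold lg; linarith

lemma psum_mono {f g : ℕ → ℝ} {x : ℝ} (h : ∀ n ∈ Finset.Icc 1 ⌊x⌋₊, f n ≤ g n) :
    psum f x ≤ psum g x := Finset.sum_le_sum h

lemma psum_nonneg {f : ℕ → ℝ} (h : ∀ n, 0 ≤ f n) (x : ℝ) : 0 ≤ psum f x :=
  Finset.sum_nonneg fun n _ => h n

lemma abs_psum_le (f : ℕ → ℝ) (x : ℝ) : |psum f x| ≤ psum (fun n => |f n|) x :=
  Finset.abs_sum_le_sum_abs _ _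

/-- The term `n` is present exactly when `u ≥ n`, so indicators turn the sum into one over a fixed
finite range, which commutes with the integral. All partial summations below rest on this. -/
theorem integral_sum_Icc_floor {w : ℕ → ℝ → ℝ} {x : ℝ} (hx : 1 ≤ x)
    (hw : ∀ n ∈ Finset.Icc 1 ⌊x⌋₊, ContinuousOn (w n) (Icc (n : ℝ) x)) :
    IntervalIntegrable (fun u => ∑ n ∈ Finset.Icc 1 ⌊u⌋₊, w n u) volume 1 x ∧
      ∫ u in (1 : ℝ)..x, ∑ n ∈ Finset.Icc 1 ⌊u⌋₊, w n u =
        ∑ n ∈ Finset.Icc 1 ⌊x⌋₊, ∫ u in (n : ℝ)..x, w n u := by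
  have hpt : ∀ u ∈ Ioc 1 x, ∑ n ∈ Finset.Icc 1 ⌊x⌋₊, (Ici (n : ℝ)).indicator (w n) u =
      ∑ n ∈ Finset.Icc 1 ⌊u⌋₊, w n u := by
    intro u hu
    have hu0 : 0 ≤ u := by linarith [hu.1]
    symm
    rw [← Finset.sum_subset (Finset.Icc_subset_Icc_right (Nat.floor_le_floor hu.2))]
    · refine Finset.sum_congr rfl fun n hn => ?_
      have : (n : ℝ) ≤ u := (Nat.le_floor_iff hu0).mp (Finset.mem_Icc.mp hn).2
      exact (indicator_of_mem (s := Ici (n : ℝ)) this (w n)).symm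
    · intro n hn hn'
      refine indicator_of_notMem (fun h => hn' ?_) _
      exact Finset.mem_Icc.mpr ⟨(Finset.mem_Icc.mp hn).1, Nat.le_floor h⟩
  have hint : ∀ n ∈ Finset.Icc 1 ⌊x⌋₊,
      IntegrableOn ((Ici (n : ℝ)).indicator (w n)) (Ioc 1 x) := by
    intro n hn
    rw [integrableOn_indicator_iff measurableSet_Ici]
    exact ((hw n hn).integrableOn_Icc).mono_set fun u hu => ⟨hu.1, hu.2.2⟩
  have hpt' : EqOn (fun u => ∑ n ∈ Finset.Icc 1 ⌊x⌋₊, (Ici (n : ℝ)).indicator (w n) u)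
      (fun u => ∑ n ∈ Finset.Icc 1 ⌊u⌋₊, w n u) (Ioc 1 x) := hpt
  constructor
  · rw [intervalIntegrable_iff_integrableOn_Ioc_of_le hx]
    exact IntegrableOn.congr_fun (integrable_finsetSum _ hint) hpt' measurableSet_Ioc
  · rw [intervalIntegral.integral_of_le hx, ← setIntegral_congr_fun measurableSet_Ioc hpt',
      integral_finsetSum _ hint]
    refine Finset.sum_congr rfl fun n hn => ?_
    obtain ⟨h1, h2⟩ := mem_Icc_floor hx hn
    have hae : (Ici (n : ℝ)).indicator (w n) =ᵐ[volume.restrict (Ioc 1 x)]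
        (Ioi (n : ℝ)).indicator (w n) :=
      ae_restrict_of_ae (indicator_ae_eq_of_ae_eq_set Ioi_ae_eq_Ici.symm)
    rw [integral_congr_ae hae, setIntegral_indicator measurableSet_Ioi,
      intervalIntegral.integral_of_le h2]
    congr 2
    ext u
    simp only [mem_inter_iff, mem_Ioc, mem_Ioi]
    constructor
    · exact fun h => ⟨h.2, h.1.2⟩
    · exact fun h => ⟨⟨by linarith [h.1], h.2⟩, h.1⟩

lemma continuousOn_log_pow_div {a : ℝ} (ha : 0 < a) (b : ℝ) (m : ℕ) :
    ContinuousOn (fun u => Real.log (u / a) ^ m / u) (Icc a b) := by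
  have h : ∀ u ∈ Icc a b, u / a ≠ 0 := fun u hu => (div_pos (ha.trans_le hu.1) ha).ne'
  have h0 : ∀ u ∈ Icc a b, u ≠ 0 := fun u hu => (ha.trans_le hu.1).ne'
  exact (((continuousOn_id.div_const a).log h).pow m).div continuousOn_id h0

lemma integral_log_pow_div {a b : ℝ} (ha : 0 < a) (hab : a ≤ b) (m : ℕ) :
    ∫ u in a..b, Real.log (u / a) ^ m / u = Real.log (b / a) ^ (m + 1) / (m + 1) := by
  have hm : (m : ℝ) + 1 ≠ 0 := by positivity
  have h := intervalIntegral.integral_eq_sub_of_hasDerivAt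
    (f := fun u => Real.log (u / a) ^ (m + 1) / (m + 1)) (f' := fun u => Real.log (u / a) ^ m / u)
    (a := a) (b := b) ?_ ?_
  · rw [h, div_self ha.ne', Real.log_one, zero_pow (by omega), zero_div, sub_zero]
  · intro u hu
    rw [uIcc_of_le hab] at hu
    have hu0 : 0 < u := ha.trans_le hu.1
    have h1 : HasDerivAt (fun u => Real.log (u / a)) (1 / a / (u / a)) u :=
      ((hasDerivAt_id u).div_const a).log (div_pos hu0 ha).ne'
    convert! (h1.pow (m + 1)).div_const ((m : ℝ) + 1) using 1
    simp only [Nat.add_sub_cancel]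
    push_cast
    field_simp
  · refine ContinuousOn.intervalIntegrable ?_
    rw [uIcc_of_le hab]
    exact continuousOn_log_pow_div ha b m

lemma integral_log_pow_div_one {x : ℝ} (hx : 1 ≤ x) (m : ℕ) :
    ∫ u in (1 : ℝ)..x, Real.log u ^ m / u = Real.log x ^ (m + 1) / (m + 1) := by
  have := integral_log_pow_div one_pos hx m
  simpa using this

/-- Termwise, `log^{m+1}(x/n)` is `m+1` times the integral of `log^m(u/n)/u` from `n` to `x`. -/
lemma riesz_succ (f : ℕ → ℝ) (m : ℕ) {x : ℝ} (hx : 1 ≤ x) :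
    IntervalIntegrable (fun u => riesz f m u / u) volume 1 x ∧
      riesz f (m + 1) x = (m + 1) * ∫ u in (1 : ℝ)..x, riesz f m u / u := by
  have hfun : (fun u => riesz f m u / u) =
      fun u => ∑ n ∈ Finset.Icc 1 ⌊u⌋₊, f n * (Real.log (u / n) ^ m / u) := by
    funext u
    rw [riesz, Finset.sum_div]
    exact Finset.sum_congr rfl fun n _ => mul_div_assoc _ _ _
  have hpos : ∀ n ∈ Finset.Icc 1 ⌊x⌋₊, (0 : ℝ) < n := fun n hn =>
    zero_lt_one.trans_le (mem_Icc_floor hx hn).1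
  obtain ⟨h1, h2⟩ := integral_sum_Icc_floor (w := fun n u => f n * (Real.log (u / n) ^ m / u)) hx
    (fun n hn => (continuousOn_log_pow_div (hpos n hn) x m).const_mul (f n))
  rw [hfun]
  refine ⟨h1, ?_⟩
  rw [h2, riesz, Finset.mul_sum]
  refine Finset.sum_congr rfl fun n hn => ?_
  rw [intervalIntegral.integral_const_mul, integral_log_pow_div (hpos n hn) (mem_Icc_floor hx hn).2]
  field_simp

lemma abs_integral_div_le {g : ℝ → ℝ} {M x : ℝ} (hx : 1 ≤ x) (hg : ∀ u ∈ Icc 1 x, |g u| ≤ M) :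
    |∫ u in (1 : ℝ)..x, g u / u| ≤ M * Real.log x := by
  have h1 : ∫ u in (1 : ℝ)..x, M * (1 / u) = M * Real.log x := by
    rw [intervalIntegral.integral_const_mul, integral_one_div_of_pos one_pos (by linarith), div_one]
  rw [← h1, ← Real.norm_eq_abs]
  refine intervalIntegral.norm_integral_le_of_norm_le hx (Eventually.of_forall fun u hu => ?_) ?_
  · have hu0 : 0 < u := by linarith [hu.1]
    rw [norm_div, Real.norm_eq_abs, Real.norm_of_nonneg hu0.le, mul_one_div]
    gcongr
    exact hg u ⟨hu.1.le, hu.2⟩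
  · refine ContinuousOn.intervalIntegrable ?_
    rw [uIcc_of_le hx]
    exact (continuousOn_const.div continuousOn_id fun u hu => by simp; linarith [hu.1]).const_mul M

/-- Bounding a logarithmic mean of a function of linear growth. -/
lemma abs_riesz_one_le {f : ℕ → ℝ} {M x : ℝ} (hx : 1 ≤ x) (hf : ∀ u ∈ Icc 1 x, |psum f u| ≤ M * u) :
    |riesz f 1 x| ≤ M * x := by
  have h := (riesz_succ f 0 hx).2
  simp only [zero_add, Nat.cast_zero, one_mul, riesz_zero] at h
  rw [h]
  have hM : 0 ≤ M := by
    have := hf 1 ⟨le_rfl, hx⟩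
    have h0 := abs_nonneg (psum f 1)
    linarith
  have h2 := intervalIntegral.norm_integral_le_of_norm_le_const (a := 1) (b := x) (C := M)
    (f := fun u => psum f u / u) (fun u hu => by
      rw [uIoc_of_le hx] at hu
      have hu0 : 0 < u := by linarith [hu.1]
      rw [norm_div, Real.norm_of_nonneg hu0.le, div_le_iff₀ hu0]
      exact hf u ⟨hu.1.le, hu.2⟩)
  rw [Real.norm_eq_abs, abs_of_nonneg (by linarith : 0 ≤ x - 1)] at h2
  refine h2.trans ?_
  gcongr
  linarith

/-- Write `log n = log x - log(x/n)`. This adds or strips one logarithmic weight at the cost of a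
Riesz mean. -/
lemma psum_mul_log (f : ℕ → ℝ) {x : ℝ} (hx : 1 ≤ x) :
    psum (fun n => f n * Real.log n) x = Real.log x * psum f x - riesz f 1 x := by
  rw [psum, psum, riesz, Finset.mul_sum, ← Finset.sum_sub_distrib]
  refine Finset.sum_congr rfl fun n hn => ?_
  have h := mem_Icc_floor hx hn
  rw [Real.log_div (by linarith) (by linarith)]
  ring

/-- Replacing `log^j n` by `log^j x` in a sum of nonnegative terms. -/
lemma abs_psum_mul_log_pow_sub_le {f : ℕ → ℝ} (hf : ∀ n, 0 ≤ f n) {M x : ℝ} (hx : 1 ≤ x)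
    (hM : ∀ u ∈ Icc 1 x, |psum f u| ≤ M * u) (j : ℕ) :
    |psum (fun n => f n * Real.log n ^ j) x - Real.log x ^ j * psum f x| ≤
      j * Real.log x ^ (j - 1) * (M * x) := by
  have hL : 0 ≤ Real.log x := Real.log_nonneg hx
  have h1 : ∀ n ∈ Finset.Icc 1 ⌊x⌋₊, |f n * Real.log n ^ j - Real.log x ^ j * f n| ≤
      j * Real.log x ^ (j - 1) * (f n * Real.log (x / n) ^ 1) := by
    intro n hn
    obtain ⟨h1, h2⟩ := mem_Icc_floor hx hn
    have hl0 : 0 ≤ Real.log n := Real.log_nonneg h1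
    have hl : Real.log n ≤ Real.log x := Real.log_le_log (by linarith) h2
    have hp : Real.log n ^ j ≤ Real.log x ^ j := by gcongr
    -- A difference of `j`-th powers is the difference of the bases times `j` summands, each at most
    -- `log^{j-1} x`. For `j = 0` there are no summands, so the truncated `j - 1` is harmless.
    have hb : Real.log x ^ j - Real.log n ^ j ≤
        j * Real.log x ^ (j - 1) * (Real.log x - Real.log n) := by
      have h3 := (Commute.all (Real.log x) (Real.log n)).geom_sum₂_mul j
      rw [← h3]
      refine mul_le_mul_of_nonneg_right ?_ (by linarith)
      calc _ ≤ ∑ i ∈ Finset.range j, Real.log x ^ (j - 1) := by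
            refine Finset.sum_le_sum fun i hi => ?_
            have hij := Finset.mem_range.mp hi
            calc Real.log x ^ i * Real.log n ^ (j - 1 - i)
                ≤ Real.log x ^ i * Real.log x ^ (j - 1 - i) := by gcongr
              _ = Real.log x ^ (j - 1) := by rw [← pow_add]; congr 1; omega
        _ = _ := by simp
    rw [Real.log_div (by linarith) (by linarith), pow_one, mul_comm (Real.log x ^ j), ← mul_sub, abs_mul,
      abs_of_nonneg (hf n), abs_of_nonpos (by linarith)]
    have := hf n
    calc f n * -(Real.log n ^ j - Real.log x ^ j) = f n * (Real.log x ^ j - Real.log n ^ j) := by ring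
      _ ≤ f n * (j * Real.log x ^ (j - 1) * (Real.log x - Real.log n)) := by gcongr
      _ = _ := by ring
  have h2 : |psum (fun n => f n * Real.log n ^ j) x - Real.log x ^ j * psum f x| ≤
      j * Real.log x ^ (j - 1) * riesz f 1 x := by
    rw [psum, psum, riesz, Finset.mul_sum, Finset.mul_sum, ← Finset.sum_sub_distrib]
    exact (Finset.abs_sum_le_sum_abs _ _).trans (Finset.sum_le_sum h1)
  refine h2.trans ?_
  have := (le_abs_self _).trans (abs_riesz_one_le hx hM)
  gcongr

end XiPrime

namespace XiPrime

open Set MeasureTheory Filter Topology ArithmeticFunction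

/-! ### Sums of `Λ(n) log^j n` and `Λ(n)² log^j n` -/

lemma psum_one_sub_le {x : ℝ} (hx : 1 ≤ x) : |psum (fun _ => 1) x - x| ≤ 1 := by
  have h1 := Nat.floor_le (by linarith : 0 ≤ x)
  have h2 := Nat.lt_floor_add_one x
  have h3 : psum (fun _ => 1) x = ⌊x⌋₊ := by simp [psum]
  rw [h3, abs_le]
  constructor <;> linarith

lemma abs_psum_log_pow_sub_le (j : ℕ) {x : ℝ} (hx : 1 ≤ x) :
    |psum (fun n => Real.log n ^ (j + 1)) x - x * Real.log x ^ (j + 1)| ≤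
      (j + 2) * (x * lg x ^ j) := by
  have hL : 0 ≤ Real.log x := Real.log_nonneg hx
  have hLg := one_le_lg hx
  have h1 := abs_psum_mul_log_pow_sub_le (f := fun _ => 1) (fun _ => zero_le_one) (M := 1) hx
    (fun u hu => by
      have h3 : psum (fun _ => 1) u = ⌊u⌋₊ := by simp [psum]
      rw [h3, abs_of_nonneg (Nat.cast_nonneg _), one_mul]
      exact Nat.floor_le (by linarith [hu.1])) (j + 1)
  simp only [one_mul, Nat.add_sub_cancel] at h1
  have h2 := psum_one_sub_le hx
  have h3 : |Real.log x ^ (j + 1) * psum (fun _ => 1) x - x * Real.log x ^ (j + 1)| ≤ x * lg x ^ j := by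
    rw [mul_comm x, ← mul_sub, abs_mul, abs_of_nonneg (by positivity)]
    have hlx : Real.log x ≤ x := (log_le_lg x).trans (lg_le hx)
    calc _ ≤ Real.log x ^ (j + 1) * 1 := by gcongr
      _ = Real.log x * Real.log x ^ j := by ring
      _ ≤ x * lg x ^ j := by gcongr; exact log_le_lg x
  have h4 : ((j + 1 : ℕ) : ℝ) * Real.log x ^ j * x ≤ (j + 1) * (x * lg x ^ j) := by
    push_cast
    have : Real.log x ^ j ≤ lg x ^ j := by gcongr; exact log_le_lg x
    calc _ = (j + 1) * (x * Real.log x ^ j) := by ring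
      _ ≤ _ := by gcongr
  calc _ ≤ _ := abs_sub_le _ (Real.log x ^ (j + 1) * psum (fun _ => 1) x) _
    _ ≤ (j + 1) * (x * lg x ^ j) + x * lg x ^ j := add_le_add (h1.trans h4) h3
    _ = _ := by ring

lemma psum_vonMangoldt_le {x : ℝ} (hx : 0 ≤ x) : psum (fun n => Λ n) x ≤ (Real.log 4 + 4) * x :=
  Chebyshev.psi_le_const_mul_self hx

lemma log_four_nonneg : 0 ≤ Real.log 4 := Real.log_nonneg (by norm_num)

/-- Strip one logarithm from `cfSum`. The Riesz mean that appears needs only the Chebyshev bound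
`O(u log u)`, since averaging against `du/u` gives `O(x log x)`; then divide by `log x`, using the
trivial bound for `x ≤ 2`. -/
lemma exists_abs_psum_sub_one_mul_log_le :
    ∃ C : ℝ, 0 ≤ C ∧ ∀ x : ℝ, 1 ≤ x → |psum (fun n => (Λ n - 1) * Real.log n) x| ≤ C * x := by
  obtain ⟨C, hC0, hC⟩ := exists_abs_cfSum_le
  have h4 := log_four_nonneg
  set A := Real.log 4 + 5 with hA
  have triv : ∀ x : ℝ, 1 ≤ x → |psum (fun n => (Λ n - 1) * Real.log n) x| ≤ A * Real.log x * x := by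
    intro x hx
    have hL : 0 ≤ Real.log x := Real.log_nonneg hx
    refine (abs_psum_le _ x).trans ?_
    have : ∀ n ∈ Finset.Icc 1 ⌊x⌋₊, |(Λ n - 1) * Real.log n| ≤ (Λ n + 1) * Real.log x := by
      intro n hn
      obtain ⟨h1, h2⟩ := mem_Icc_floor hx hn
      have h0 := vonMangoldt_nonneg (n := n)
      rw [abs_mul, abs_of_nonneg (Real.log_nonneg h1)]
      have : |Λ n - 1| ≤ Λ n + 1 := by rw [abs_le]; constructor <;> linarith
      gcongr
    refine (psum_mono this).trans ?_
    rw [psum, ← Finset.sum_mul, Finset.sum_add_distrib, Finset.sum_const, nsmul_one, Nat.card_Icc,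
      Nat.add_sub_cancel]
    have h5 := psum_vonMangoldt_le (by linarith : 0 ≤ x)
    have h6 := Nat.floor_le (by linarith : 0 ≤ x)
    rw [psum] at h5
    calc _ ≤ ((Real.log 4 + 4) * x + x) * Real.log x := by gcongr
      _ = _ := by rw [hA]; ring
  have hl2 : 0 < Real.log 2 := Real.log_pos one_lt_two
  refine ⟨A * Real.log 2 + (C + A), by positivity, fun x hx => ?_⟩
  have hL : 0 ≤ Real.log x := Real.log_nonneg hx
  have hx0 : 0 < x := by linarith
  by_cases hx2 : x ≤ 2
  · have hlx : Real.log x ≤ Real.log 2 := Real.log_le_log hx0 hx2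
    refine (triv x hx).trans ?_
    gcongr
    have : A * Real.log x ≤ A * Real.log 2 := by gcongr
    linarith
  · have hAl : 0 ≤ A * Real.log 2 := by positivity
    push Not at hx2
    have hLpos : 0 < Real.log x := Real.log_pos (by linarith)
    have h1 : cfSum x = Real.log x * psum (fun n => (Λ n - 1) * Real.log n) x -
        riesz (fun n => (Λ n - 1) * Real.log n) 1 x := by
      rw [← psum_mul_log _ hx, psum, cfSum]
      exact Finset.sum_congr rfl fun n _ => by simp only [cf]; ring
    have h2 := abs_riesz_one_le (f := fun n => (Λ n - 1) * Real.log n) (M := A * Real.log x) hx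
      (fun u hu => by
        refine (triv u hu.1).trans ?_
        have h0 := hu.1
        have := Real.log_le_log (by linarith [hu.1]) hu.2
        gcongr)
    have h3 := hC x hx
    have h5 : Real.log x * |psum (fun n => (Λ n - 1) * Real.log n) x| ≤
        Real.log x * ((C + A) * x) := by
      rw [← abs_of_pos hLpos, ← abs_mul, abs_of_pos hLpos]
      have : Real.log x * psum (fun n => (Λ n - 1) * Real.log n) x =
          cfSum x + riesz (fun n => (Λ n - 1) * Real.log n) 1 x := by rw [h1]; ring
      rw [this]
      calc _ ≤ _ := abs_add_le _ _
        _ ≤ _ := add_le_add h3 h2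
        _ = _ := by ring
    have h6 := le_of_mul_le_mul_left h5 hLpos
    exact h6.trans (mul_le_mul_of_nonneg_right (by linarith) hx0.le)

lemma exists_abs_psum_sub_one_mul_log_cube_le :
    ∃ C : ℝ, 0 ≤ C ∧ ∀ x : ℝ, 1 ≤ x →
      |psum (fun n => (Λ n - 1) * Real.log n ^ 3) x| ≤ C * (x * lg x ^ 2) := by
  obtain ⟨C, hC0, hC⟩ := exists_abs_cfSum_le
  refine ⟨2 * C, by positivity, fun x hx => ?_⟩
  have hL : 0 ≤ Real.log x := Real.log_nonneg hx
  have hx0 : 0 < x := by linarith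
  have h1 : psum (fun n => (Λ n - 1) * Real.log n ^ 3) x = Real.log x * cfSum x - riesz cf 1 x := by
    have h := psum_mul_log cf hx
    have e : psum cf x = cfSum x := rfl
    rw [← e, ← h]
    exact Finset.sum_congr rfl fun n _ => by simp only [cf]; ring
  have h2 := abs_riesz_one_le (f := cf) (M := C * Real.log x) hx (fun u hu => by
    have h0 := hu.1
    have := Real.log_le_log (by linarith [hu.1]) hu.2
    refine (hC u h0).trans ?_
    calc C * (u * Real.log u) ≤ C * (u * Real.log x) := by gcongr
      _ = _ := by ring)
  have hlg := one_le_lg hx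
  have hll := log_le_lg x
  rw [h1]
  calc _ ≤ _ := abs_sub _ _
    _ ≤ Real.log x * (C * (x * Real.log x)) + C * Real.log x * x := by
      rw [abs_mul, abs_of_nonneg hL]
      gcongr
      exact hC x hx
    _ = C * x * (Real.log x * Real.log x + Real.log x * 1) := by ring
    _ ≤ C * x * (lg x * lg x + lg x * lg x) := by gcongr
    _ = _ := by ring

/-- `∑_{n ≤ x} Λ(n) log^j n` for `j = 1, 2, 3`. -/
lemma exists_abs_psum_vonMangoldt_mul_log_pow_le {j : ℕ} (hj : j < 3) :
    ∃ C : ℝ, 0 ≤ C ∧ ∀ x : ℝ, 1 ≤ x →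
      |psum (fun n => Λ n * Real.log n ^ (j + 1)) x - x * Real.log x ^ (j + 1)| ≤ C * (x * lg x ^ j) := by
  have key : ∃ C : ℝ, 0 ≤ C ∧ ∀ x : ℝ, 1 ≤ x →
      |psum (fun n => (Λ n - 1) * Real.log n ^ (j + 1)) x| ≤ C * (x * lg x ^ j) := by
    interval_cases j
    · simpa using exists_abs_psum_sub_one_mul_log_le
    · obtain ⟨C, hC0, hC⟩ := exists_abs_cfSum_le
      refine ⟨C, hC0, fun x hx => (hC x hx).trans ?_⟩
      have := log_le_lg x
      have h0 := Real.log_nonneg hx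
      rw [pow_one]
      gcongr
    · exact exists_abs_psum_sub_one_mul_log_cube_le
  obtain ⟨C, hC0, hC⟩ := key
  refine ⟨C + (j + 2), by positivity, fun x hx => ?_⟩
  have h1 := hC x hx
  have h2 := abs_psum_log_pow_sub_le j hx
  have h3 : psum (fun n => Λ n * Real.log n ^ (j + 1)) x - x * Real.log x ^ (j + 1) =
      psum (fun n => (Λ n - 1) * Real.log n ^ (j + 1)) x +
        (psum (fun n => Real.log n ^ (j + 1)) x - x * Real.log x ^ (j + 1)) := by
    have : psum (fun n => Λ n * Real.log n ^ (j + 1)) x =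
        psum (fun n => (Λ n - 1) * Real.log n ^ (j + 1)) x +
          psum (fun n => Real.log n ^ (j + 1)) x := by
      rw [psum, psum, psum, ← Finset.sum_add_distrib]
      exact Finset.sum_congr rfl fun n _ => by ring
    rw [this]; ring
  rw [h3]
  calc _ ≤ _ := abs_add_le _ _
    _ ≤ _ := add_le_add h1 h2
    _ = _ := by ring

/-- The von Mangoldt function on integers that are not prime. -/
noncomputable def lambdaNonprime : ArithmeticFunction ℝ :=
  ⟨fun n => if n.Prime then 0 else Λ n, by simp⟩

lemma lambdaNonprime_apply (n : ℕ) : lambdaNonprime n = if n.Prime then 0 else Λ n := rfl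

lemma lambdaNonprime_nonneg (n : ℕ) : 0 ≤ lambdaNonprime n := by
  rw [lambdaNonprime_apply]
  split_ifs
  · exact le_rfl
  · exact vonMangoldt_nonneg

lemma lambdaNonprime_le (n : ℕ) : lambdaNonprime n ≤ Λ n := by
  rw [lambdaNonprime_apply]
  split_ifs
  · exact vonMangoldt_nonneg
  · exact le_rfl

lemma psum_lambdaNonprime_le {x : ℝ} (hx : 1 ≤ x) :
    psum (fun n => lambdaNonprime n) x ≤ 2 * √x * Real.log x := by
  refine le_trans (le_of_eq ?_) (Chebyshev.psi_sub_theta_le hx)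
  rw [Chebyshev.psi_sub_theta_eq_sum_not_prime, psum, Finset.sum_filter]
  simp only [lambdaNonprime_apply]
  refine Finset.sum_congr (by ext; simp; omega) fun n _ => ?_
  split_ifs <;> rfl

lemma exists_log_pow_mul_psum_lambdaNonprime_le (m : ℕ) {ε : ℝ} (hε : 0 < ε) :
    ∃ C : ℝ, 0 ≤ C ∧ ∀ x : ℝ, 1 ≤ x →
      Real.log x ^ m * psum (fun n => lambdaNonprime n) x ≤ C * x ^ (1 / 2 + ε : ℝ) := by
  -- There are `m + 1` logarithms to absorb: the given `m`, and one from the bound for `ψ - θ`.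
  set δ := ε / (m + 1) with hδ
  have hδ0 : 0 < δ := by positivity
  refine ⟨2 * (1 / δ) ^ (m + 1), by positivity, fun x hx => ?_⟩
  have hx0 : 0 < x := by linarith
  have h1 : Real.log x ≤ x ^ δ / δ := Real.log_le_rpow_div hx0.le hδ0
  have h0 : 0 ≤ Real.log x := Real.log_nonneg hx
  calc _ ≤ Real.log x ^ m * (2 * √x * Real.log x) := by gcongr; exact psum_lambdaNonprime_le hx
    _ = 2 * √x * Real.log x ^ (m + 1) := by ring
    _ ≤ 2 * √x * (x ^ δ / δ) ^ (m + 1) := by gcongr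
    _ = 2 * (1 / δ) ^ (m + 1) * (√x * (x ^ δ) ^ (m + 1)) := by
      rw [div_eq_mul_one_div (x ^ δ), mul_pow]; ring
    _ = _ := by
      rw [Real.sqrt_eq_rpow, ← Real.rpow_natCast (x ^ δ), ← Real.rpow_mul hx0.le, ← Real.rpow_add hx0]
      congr 3
      rw [hδ]; push_cast; field_simp

/-- `∑_{n ≤ x} Λ(n)² log^j n` for `j = 0, 1, 2`. -/
theorem exists_abs_psum_vonMangoldt_sq_mul_log_pow_le {j : ℕ} (hj : j < 3) :
    ∃ C : ℝ, 0 ≤ C ∧ ∀ x : ℝ, 1 ≤ x →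
      |psum (fun n => Λ n ^ 2 * Real.log n ^ j) x - x * Real.log x ^ (j + 1)| ≤ C * (x * lg x ^ j) := by
  obtain ⟨C, hC0, hC⟩ := exists_abs_psum_vonMangoldt_mul_log_pow_le hj
  obtain ⟨D, hD0, hD⟩ := exists_log_pow_mul_psum_lambdaNonprime_le (j + 1) (one_half_pos (α := ℝ))
  refine ⟨D + C, by positivity, fun x hx => ?_⟩
  have hL : 0 ≤ Real.log x := Real.log_nonneg hx
  -- At primes `Λ = log`, so the two summands agree except at proper prime powers.
  have h1 : |psum (fun n => Λ n ^ 2 * Real.log n ^ j) x - psum (fun n => Λ n * Real.log n ^ (j + 1)) x| ≤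
      Real.log x ^ (j + 1) * psum (fun n => lambdaNonprime n) x := by
    rw [psum, psum, psum, ← Finset.sum_sub_distrib, Finset.mul_sum]
    refine (Finset.abs_sum_le_sum_abs _ _).trans (Finset.sum_le_sum fun n hn => ?_)
    obtain ⟨h1, h2⟩ := mem_Icc_floor hx hn
    rw [lambdaNonprime_apply]
    split_ifs with hp
    · rw [vonMangoldt_apply_prime hp]
      simp only [mul_zero]
      rw [show Real.log n ^ 2 * Real.log n ^ j - Real.log n * Real.log n ^ (j + 1) = 0 by ring, abs_zero]
    · have h0 := vonMangoldt_nonneg (n := n)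
      have hle := vonMangoldt_le_log (n := n)
      have hl0 : 0 ≤ Real.log n := Real.log_nonneg h1
      have hl : Real.log n ≤ Real.log x := Real.log_le_log (by linarith) h2
      have e : Λ n ^ 2 * Real.log n ^ j - Λ n * Real.log n ^ (j + 1) =
          -(Λ n * Real.log n ^ j * (Real.log n - Λ n)) := by ring
      rw [e, abs_neg, abs_of_nonneg (mul_nonneg (by positivity) (by linarith))]
      calc _ ≤ Λ n * Real.log x ^ j * Real.log x := by gcongr; linarith
        _ = _ := by ring
  have h2 := hD x hx
  rw [show (1 / 2 + 1 / 2 : ℝ) = 1 by norm_num, Real.rpow_one] at h2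
  have hlg : 1 ≤ lg x ^ j := one_le_pow₀ (one_le_lg hx)
  calc _ ≤ _ := abs_sub_le _ (psum (fun n => Λ n * Real.log n ^ (j + 1)) x) _
    _ ≤ D * x + C * (x * lg x ^ j) := add_le_add (h1.trans h2) (hC x hx)
    _ ≤ D * (x * lg x ^ j) + C * (x * lg x ^ j) := by
      gcongr
      exact le_mul_of_one_le_right (by linarith) hlg
    _ = _ := by ring

end XiPrime

namespace XiPrime

open Set MeasureTheory Filter Topology ArithmeticFunction

/-! ### Dirichlet convolutions of nonnegative functions -/

lemma mul_apply_nonneg {f g : ArithmeticFunction ℝ} (hf : ∀ n, 0 ≤ f n) (hg : ∀ n, 0 ≤ g n) (n : ℕ) :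
    0 ≤ (f * g) n := by
  rw [mul_apply]
  exact Finset.sum_nonneg fun x _ => mul_nonneg (hf _) (hg _)

lemma pow_apply_nonneg {f : ArithmeticFunction ℝ} (hf : ∀ n, 0 ≤ f n) (k n : ℕ) : 0 ≤ (f ^ k) n := by
  induction k generalizing n with
  | zero =>
    rw [pow_zero, one_apply]
    split_ifs <;> simp
  | succ k ih =>
    rw [pow_succ]
    exact mul_apply_nonneg ih hf n

/-- Cauchy–Schwarz with weight `f`. For `f = Λ` the divisor sum is only `log n`. -/
lemma sq_mul_apply_le {f g : ArithmeticFunction ℝ} (hf : ∀ n, 0 ≤ f n) (n : ℕ) :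
    (f * g) n ^ 2 ≤ (∑ d ∈ n.divisors, f d) * (f * pmul g g) n := by
  have h1 : ∑ d ∈ n.divisors, f d = ∑ x ∈ n.divisorsAntidiagonal, f x.1 := by
    rw [Nat.sum_divisorsAntidiagonal (fun a _ => f a)]
  rw [h1, mul_apply, mul_apply]
  refine Finset.sum_sq_le_sum_mul_sum_of_sq_le_mul _ (fun x _ => hf _) (fun x _ => ?_) fun x _ => ?_
  · exact mul_nonneg (hf _) (by rw [pmul_apply]; exact mul_self_nonneg _)
  · rw [pmul_apply]
    exact le_of_eq (by ring)

lemma convLambda_zero : convLambda 0 = 1 := pow_zero _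

lemma convLambda_one : convLambda 1 = Λ := pow_one _

lemma convLambda_succ (k : ℕ) : convLambda (k + 1) = Λ * convLambda k := pow_succ' _ _

lemma convLambda_nonneg (k n : ℕ) : 0 ≤ convLambda k n :=
  pow_apply_nonneg (fun _ => vonMangoldt_nonneg) k n

/-- The logarithm is additive over each factorization `n = d e`, hence a derivation for convolution.
-/
lemma pmul_log_mul (f g : ArithmeticFunction ℝ) :
    pmul (f * g) log = pmul f log * g + f * pmul g log := by
  ext n
  rw [pmul_apply, ArithmeticFunction.add_apply, mul_apply, mul_apply, mul_apply, Finset.sum_mul, ← Finset.sum_add_distrib]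
  refine Finset.sum_congr rfl fun x hx => ?_
  obtain ⟨h1, h2⟩ := Nat.mem_divisorsAntidiagonal.mp hx
  have hx1 : (x.1 : ℝ) ≠ 0 := by
    have : x.1 ≠ 0 := by rintro h; rw [h, zero_mul] at h1; exact h2 h1.symm
    exact_mod_cast this
  have hx2 : (x.2 : ℝ) ≠ 0 := by
    have : x.2 ≠ 0 := by rintro h; rw [h, mul_zero] at h1; exact h2 h1.symm
    exact_mod_cast this
  rw [pmul_apply, pmul_apply, log_apply, log_apply, log_apply, ← h1, Nat.cast_mul,
    Real.log_mul hx1 hx2]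
  ring

/-- The power rule for this derivation. -/
lemma pmul_convLambda_succ_log (k : ℕ) :
    pmul (convLambda (k + 1)) log = (k + 1 : ℕ) • (convLambda k * lambdaLog) := by
  induction k with
  | zero => simp [convLambda, lambdaLog]
  | succ k ih =>
    rw [convLambda_succ, pmul_log_mul, ih, ← lambdaLog, convLambda_succ k]
    simp only [nsmul_eq_mul]
    push_cast
    ring

lemma alpha_succ_apply (k n : ℕ) :
    alpha (k + 1) n = Real.log n * convLambda (k + 1) n / (k + 1) := by
  have h := congrArg (fun f : ArithmeticFunction ℝ => f n) (pmul_convLambda_succ_log k)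
  have e : ((k + 1 : ℕ) • (convLambda k * lambdaLog)) n = (k + 1 : ℝ) * (convLambda k * lambdaLog) n := by
    have h3 : ∀ (m : ℕ) (f : ArithmeticFunction ℝ), (m • f) n = (m : ℝ) * f n := by
      intro m f
      induction m with
      | zero => simp
      | succ m ih => rw [add_smul, one_smul, ArithmeticFunction.add_apply, ih]; push_cast; ring
    rw [h3]; push_cast; rfl
  simp only [pmul_apply, log_apply, e] at h
  have hk : (k : ℝ) + 1 ≠ 0 := by positivity
  rw [alpha, mul_comm (Real.log n), h]
  field_simp

/-- Induction on `k`, each factor being summed by `∑_{d ∣ n} Λ(d) = log n`. -/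
lemma convLambda_le_log_pow (k : ℕ) {n : ℕ} (hn : n ≠ 0) : convLambda k n ≤ Real.log n ^ k := by
  induction k generalizing n with
  | zero =>
    rw [convLambda_zero, one_apply, pow_zero]
    split_ifs <;> simp
  | succ k ih =>
    rw [convLambda_succ, mul_apply, pow_succ']
    calc _ ≤ ∑ x ∈ n.divisorsAntidiagonal, Λ x.1 * Real.log n ^ k := by
          refine Finset.sum_le_sum fun x hx => ?_
          obtain ⟨h1, h2⟩ := Nat.mem_divisorsAntidiagonal.mp hx
          have hx2 : x.2 ≠ 0 := by rintro h; rw [h, mul_zero] at h1; exact h2 h1.symm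
          have hle : x.2 ≤ n := Nat.le_of_dvd (Nat.pos_of_ne_zero hn) ⟨x.1, by rw [mul_comm]; exact h1.symm⟩
          have hl : Real.log x.2 ≤ Real.log n := by
            refine Real.log_le_log ?_ (by exact_mod_cast hle)
            exact_mod_cast Nat.pos_of_ne_zero hx2
          have h0 := vonMangoldt_nonneg (n := x.1)
          have h3 : 0 ≤ Real.log x.2 := Real.log_natCast_nonneg _
          have := ih hx2
          have : convLambda k x.2 ≤ Real.log n ^ k := this.trans (by gcongr)
          gcongr
      _ = Real.log n * Real.log n ^ k := by
          rw [← Finset.sum_mul, Nat.sum_divisorsAntidiagonal (fun a _ => Λ a), vonMangoldt_sum]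

/-! ### Convolution powers at squarefree integers -/

lemma primeFactors_div_of_squarefree {n p : ℕ} (hn : Squarefree n) (hp : p.Prime) (hpn : p ∣ n) :
    (n / p).primeFactors = n.primeFactors.erase p := by
  obtain ⟨m, rfl⟩ := hpn
  have hc := (Nat.squarefree_mul_iff.mp hn).1
  rw [Nat.mul_div_cancel_left _ hp.pos, hc.primeFactors_mul, hp.primeFactors, ← Finset.insert_eq,
    Finset.erase_insert]
  intro h
  exact (Nat.Prime.coprime_iff_not_dvd hp).mp hc (Nat.dvd_of_mem_primeFactors h)

lemma mul_apply_of_squarefree {f : ArithmeticFunction ℝ} (hf : ∀ n, Squarefree n → ¬ n.Prime → f n = 0)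
    (g : ArithmeticFunction ℝ) {n : ℕ} (hn : Squarefree n) :
    (f * g) n = ∑ p ∈ n.primeFactors, f p * g (n / p) := by
  rw [mul_apply, Nat.sum_divisorsAntidiagonal (fun a b => f a * g b)]
  symm
  refine Finset.sum_subset (fun p hp => ?_) fun d hd hd' => ?_
  · exact Nat.mem_divisors.mpr ⟨Nat.dvd_of_mem_primeFactors hp, hn.ne_zero⟩
  · have hdn := Nat.dvd_of_mem_divisors hd
    rw [hf d (hn.squarefree_of_dvd hdn) (fun hp => hd' (Nat.mem_primeFactors.mpr ⟨hp, hdn, hn.ne_zero⟩)),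
      zero_mul]

/-- Only ordered factorizations of `n` into primes survive, and these are the `k!` orderings of its
prime factors. In the induction the first prime can be chosen in `k + 1` ways. -/
theorem pow_apply_of_squarefree {f : ArithmeticFunction ℝ}
    (hf : ∀ n, Squarefree n → ¬ n.Prime → f n = 0) (k : ℕ) {n : ℕ} (hn : Squarefree n) :
    (f ^ k) n = if n.primeFactors.card = k then (k.factorial : ℝ) * ∏ p ∈ n.primeFactors, f p else 0 := by
  induction k generalizing n with
  | zero =>
    rw [pow_zero, one_apply]
    by_cases h : n = 1
    · simp [h]
    · have : n.primeFactors.card ≠ 0 := by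
        rw [Finset.card_ne_zero, Nat.nonempty_primeFactors]
        have := hn.ne_zero
        omega
      rw [if_neg h, if_neg this]
  | succ k ih =>
    rw [pow_succ', mul_apply_of_squarefree hf _ hn]
    have hterm : ∀ p ∈ n.primeFactors, f p * (f ^ k) (n / p) =
        if n.primeFactors.card = k + 1 then (k.factorial : ℝ) * ∏ q ∈ n.primeFactors, f q else 0 := by
      intro p hp
      have hpp := Nat.prime_of_mem_primeFactors hp
      have hpn := Nat.dvd_of_mem_primeFactors hp
      rw [ih (hn.squarefree_of_dvd (Nat.div_dvd_of_dvd hpn)), primeFactors_div_of_squarefree hn hpp hpn,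
        Finset.card_erase_of_mem hp]
      have hpos : 0 < n.primeFactors.card := Finset.card_pos.mpr ⟨p, hp⟩
      by_cases hc : n.primeFactors.card = k + 1
      · rw [if_pos hc, if_pos (by omega), ← Finset.mul_prod_erase _ _ hp]
        ring
      · rw [if_neg hc, if_neg (by omega), mul_zero]
    rw [Finset.sum_congr rfl hterm, Finset.sum_const, nsmul_eq_mul]
    split_ifs with hc
    · rw [hc, Nat.factorial_succ]; push_cast; ring
    · simp

lemma prime_of_squarefree_of_isPrimePow {n : ℕ} (hn : Squarefree n) (h : IsPrimePow n) : n.Prime := by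
  obtain ⟨p, k, hp, hk, rfl⟩ := h
  have hk1 : k = 1 := by
    by_contra hne
    have h2 : 2 ≤ k := by omega
    have : p * p ∣ p ^ k := by rw [← sq]; exact pow_dvd_pow p h2
    exact hp.not_isUnit (hn p this)
  rw [hk1, pow_one]
  exact hp.nat_prime

lemma vonMangoldt_eq_zero_of_squarefree (n : ℕ) (hn : Squarefree n) (h : ¬ n.Prime) : Λ n = 0 :=
  vonMangoldt_eq_zero_iff.mpr fun hp => h (prime_of_squarefree_of_isPrimePow hn hp)

/-- The pointwise square of the von Mangoldt function. -/
noncomputable def lambdaSq : ArithmeticFunction ℝ := pmul Λ Λ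

lemma lambdaSq_apply (n : ℕ) : lambdaSq n = Λ n ^ 2 := by rw [lambdaSq, pmul_apply, sq]

lemma lambdaSq_nonneg (n : ℕ) : 0 ≤ lambdaSq n := by rw [lambdaSq_apply]; positivity

/-- Squaring `k! ∏ log p` gives `k!` times the value of the `k`-th power of `Λ²`; the surplus `k!`
ends up in the main term. -/
lemma convLambda_sq_of_squarefree (k : ℕ) {n : ℕ} (hn : Squarefree n) :
    convLambda k n ^ 2 = k.factorial * (lambdaSq ^ k) n := by
  rw [convLambda, pow_apply_of_squarefree vonMangoldt_eq_zero_of_squarefree k hn,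
    pow_apply_of_squarefree (f := lambdaSq) (fun m hm hp => by
      rw [lambdaSq_apply, vonMangoldt_eq_zero_of_squarefree m hm hp]; simp) k hn]
  split_ifs
  · rw [mul_pow, ← Finset.prod_pow, Finset.prod_congr rfl fun p _ => lambdaSq_apply p]
    ring
  · simp

lemma convLambda_mul_of_squarefree {k l : ℕ} (hkl : k ≠ l) {n : ℕ} (hn : Squarefree n) :
    convLambda k n * convLambda l n = 0 := by
  rw [convLambda, convLambda, pow_apply_of_squarefree vonMangoldt_eq_zero_of_squarefree k hn,
    pow_apply_of_squarefree vonMangoldt_eq_zero_of_squarefree l hn]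
  split_ifs with h1 h2
  · exact absurd (h1.symm.trans h2) hkl
  all_goals simp

lemma convLambda_prime {k p : ℕ} (hk : 2 ≤ k) (hp : p.Prime) : convLambda k p = 0 := by
  rw [convLambda, pow_apply_of_squarefree vonMangoldt_eq_zero_of_squarefree k
    (Nat.prime_iff.mp hp).squarefree, if_neg]
  rw [hp.primeFactors, Finset.card_singleton]
  omega

lemma convLambda_succ_of_squarefree (k : ℕ) {m p : ℕ} (hm : Squarefree m) (hp : p.Prime) (hpm : p ∣ m) :
    convLambda (k + 1) m = (k + 1) * Real.log p * convLambda k (m / p) := by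
  have hmem : p ∈ m.primeFactors := Nat.mem_primeFactors.mpr ⟨hp, hpm, hm.ne_zero⟩
  have hpos : 0 < m.primeFactors.card := Finset.card_pos.mpr ⟨p, hmem⟩
  rw [convLambda, convLambda, pow_apply_of_squarefree vonMangoldt_eq_zero_of_squarefree _ hm,
    pow_apply_of_squarefree vonMangoldt_eq_zero_of_squarefree k
      (hm.squarefree_of_dvd (Nat.div_dvd_of_dvd hpm)),
    primeFactors_div_of_squarefree hm hp hpm, Finset.card_erase_of_mem hmem]
  by_cases hc : m.primeFactors.card = k + 1
  · rw [if_pos hc, if_pos (by omega), ← Finset.mul_prod_erase _ _ hmem, vonMangoldt_apply_prime hp,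
      Nat.factorial_succ]
    push_cast; ring
  · rw [if_neg hc, if_neg (by omega), mul_zero]

/-- A sum of squares of nonnegative terms is at most the square of their sum. Unlike the squarefree
identity this holds for every `n`, so one error term covers both functions. -/
lemma lambdaSq_pow_le (k n : ℕ) : (lambdaSq ^ k) n ≤ convLambda k n ^ 2 := by
  induction k generalizing n with
  | zero =>
    rw [pow_zero, convLambda_zero, one_apply]
    split_ifs <;> simp
  | succ k ih =>
    rw [pow_succ', convLambda_succ, mul_apply, mul_apply]
    have hnn : ∀ x ∈ n.divisorsAntidiagonal, 0 ≤ Λ x.1 * convLambda k x.2 := fun x _ =>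
      mul_nonneg vonMangoldt_nonneg (convLambda_nonneg _ _)
    refine le_trans (Finset.sum_le_sum fun x _ => ?_) (Finset.sum_sq_le_sq_sum_of_nonneg hnn)
    rw [mul_pow, lambdaSq_apply]
    gcongr
    exact ih _

/-! ### Convolution powers at integers that are not squarefree -/

/-- The function supported on squares of primes with value `log² p` at `p²`. -/
noncomputable def primeSqLog : ArithmeticFunction ℝ :=
  ⟨fun n => if n.sqrt.Prime ∧ n.sqrt ^ 2 = n then Real.log n.sqrt ^ 2 else 0, by simp⟩

lemma primeSqLog_apply (n : ℕ) :
    primeSqLog n = if n.sqrt.Prime ∧ n.sqrt ^ 2 = n then Real.log n.sqrt ^ 2 else 0 := rfl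

lemma primeSqLog_nonneg (n : ℕ) : 0 ≤ primeSqLog n := by
  rw [primeSqLog_apply]
  split_ifs
  · positivity
  · exact le_rfl

lemma primeSqLog_sq {p : ℕ} (hp : p.Prime) : primeSqLog (p ^ 2) = Real.log p ^ 2 := by
  rw [primeSqLog_apply, Nat.sqrt_eq', if_pos ⟨hp, rfl⟩]

lemma primeSqLog_le (n : ℕ) : primeSqLog n ≤ Λ n ^ 2 := by
  rw [primeSqLog_apply]
  split_ifs with h
  · rw [← h.2, vonMangoldt_apply_pow two_ne_zero, vonMangoldt_apply_prime h.1, Nat.sqrt_eq']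
  · positivity

/-- The factorization `p · (p m)` is reread as `p² · m`; this is injective into the factorizations
of `n`. -/
lemma sum_divisors_repeated_prime_le (k n : ℕ) :
    ∑ x ∈ n.divisorsAntidiagonal with x.1.Prime ∧ x.1 ∣ x.2,
      Real.log x.1 ^ 2 * convLambda k (x.2 / x.1) ≤ (primeSqLog * convLambda k) n := by
  set S := n.divisorsAntidiagonal.filter fun x => x.1.Prime ∧ x.1 ∣ x.2
  have hinj : Set.InjOn (fun x : ℕ × ℕ => (x.1 ^ 2, x.2 / x.1)) S := by
    intro x hx y hy hxy
    simp only [Prod.mk.injEq] at hxy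
    obtain ⟨hx1, hx2, hx3⟩ := Finset.mem_filter.mp hx
    obtain ⟨hy1, hy2, hy3⟩ := Finset.mem_filter.mp hy
    have h1 : x.1 = y.1 := Nat.pow_left_injective two_ne_zero hxy.1
    refine Prod.ext h1 ?_
    rw [← Nat.mul_div_cancel' hx3, ← Nat.mul_div_cancel' hy3, hxy.2, h1]
  have e : ∑ x ∈ S, Real.log x.1 ^ 2 * convLambda k (x.2 / x.1) =
      ∑ y ∈ S.image (fun x : ℕ × ℕ => (x.1 ^ 2, x.2 / x.1)), primeSqLog y.1 * convLambda k y.2 := by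
    rw [Finset.sum_image hinj]
    refine Finset.sum_congr rfl fun x hx => ?_
    rw [primeSqLog_sq (Finset.mem_filter.mp hx).2.1]
  rw [e, mul_apply]
  refine Finset.sum_le_sum_of_subset_of_nonneg (fun y hy => ?_) fun y _ _ =>
    mul_nonneg (primeSqLog_nonneg _) (convLambda_nonneg _ _)
  obtain ⟨x, hx, rfl⟩ := Finset.mem_image.mp hy
  obtain ⟨hx1, hx2, hx3⟩ := Finset.mem_filter.mp hx
  obtain ⟨h1, h2⟩ := Nat.mem_divisorsAntidiagonal.mp hx1
  refine Nat.mem_divisorsAntidiagonal.mpr ⟨?_, h2⟩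
  rw [sq, mul_assoc, Nat.mul_div_cancel' hx3, h1]

/-- In a factorization of `n` into `k + 1` prime powers, either some factor is a proper prime power,
or all are primes and one repeats. The induction inspects the first factor: not prime, or with a
cofactor that is not squarefree, or a prime dividing a squarefree cofactor. -/
theorem convLambda_succ_le_of_not_squarefree (k : ℕ) {n : ℕ} (hn : ¬ Squarefree n) :
    convLambda (k + 1) n ≤ (k + 1) * (lambdaNonprime * convLambda k) n +
      (k + 1) * k * (primeSqLog * convLambda (k - 1)) n := by
  induction k generalizing n with
  | zero =>
    have hp : ¬ n.Prime := fun h => hn (Nat.prime_iff.mp h).squarefree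
    simp [convLambda_one, convLambda_zero, lambdaNonprime_apply, hp]
  | succ k ih =>
    have hstep : Λ * (lambdaNonprime * convLambda k) = lambdaNonprime * convLambda (k + 1) := by
      rw [convLambda_succ]; ring
    have hstep2 : (k : ℝ) * (Λ * (primeSqLog * convLambda (k - 1))) n =
        k * (primeSqLog * convLambda k) n := by
      -- For `k = 0` the index `k - 1` is truncated, but the coefficient `k` kills the term.
      rcases Nat.eq_zero_or_pos k with rfl | hk
      · simp
      · have : Λ * (primeSqLog * convLambda (k - 1)) = primeSqLog * convLambda k := by
          conv_rhs => rw [show k = (k - 1) + 1 by omega, convLambda_succ]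
          ring
        rw [this]
    have hterm : ∀ x ∈ n.divisorsAntidiagonal, Λ x.1 * convLambda (k + 1) x.2 ≤
        lambdaNonprime x.1 * convLambda (k + 1) x.2 +
        ((k + 1) * (Λ x.1 * (lambdaNonprime * convLambda k) x.2) +
          (k + 1) * k * (Λ x.1 * (primeSqLog * convLambda (k - 1)) x.2)) +
        (k + 1) * (if x.1.Prime ∧ x.1 ∣ x.2 then Real.log x.1 ^ 2 * convLambda k (x.2 / x.1) else 0) := by
      intro x hx
      obtain ⟨h1, h2⟩ := Nat.mem_divisorsAntidiagonal.mp hx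
      have n1 : 0 ≤ lambdaNonprime x.1 * convLambda (k + 1) x.2 :=
        mul_nonneg (lambdaNonprime_nonneg _) (convLambda_nonneg _ _)
      have n2 : 0 ≤ Λ x.1 * (lambdaNonprime * convLambda k) x.2 :=
        mul_nonneg vonMangoldt_nonneg (mul_apply_nonneg lambdaNonprime_nonneg (convLambda_nonneg k) _)
      have n3 : 0 ≤ Λ x.1 * (primeSqLog * convLambda (k - 1)) x.2 :=
        mul_nonneg vonMangoldt_nonneg (mul_apply_nonneg primeSqLog_nonneg (convLambda_nonneg _) _)
      have n4 : 0 ≤ if x.1.Prime ∧ x.1 ∣ x.2 then Real.log x.1 ^ 2 * convLambda k (x.2 / x.1) else 0 := by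
        split_ifs
        · exact mul_nonneg (by positivity) (convLambda_nonneg _ _)
        · exact le_rfl
      have m2 : 0 ≤ ((k : ℝ) + 1) * (Λ x.1 * (lambdaNonprime * convLambda k) x.2) := by positivity
      have m3 : 0 ≤ ((k : ℝ) + 1) * k * (Λ x.1 * (primeSqLog * convLambda (k - 1)) x.2) := by positivity
      have m4 : 0 ≤ ((k : ℝ) + 1) *
        (if x.1.Prime ∧ x.1 ∣ x.2 then Real.log x.1 ^ 2 * convLambda k (x.2 / x.1) else 0) := by positivity
      by_cases hp : x.1.Prime
      · by_cases hsf : Squarefree x.2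
        · have hdvd : x.1 ∣ x.2 := by
            by_contra hnd
            apply hn
            rw [← h1]
            exact Nat.squarefree_mul_iff.mpr ⟨(Nat.Prime.coprime_iff_not_dvd hp).mpr hnd,
              (Nat.prime_iff.mp hp).squarefree, hsf⟩
          have e : Λ x.1 * convLambda (k + 1) x.2 = (k + 1) *
              (if x.1.Prime ∧ x.1 ∣ x.2 then Real.log x.1 ^ 2 * convLambda k (x.2 / x.1) else 0) := by
            rw [if_pos ⟨hp, hdvd⟩, convLambda_succ_of_squarefree k hsf hp hdvd,
              vonMangoldt_apply_prime hp]
            ring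
          linarith
        · have e : Λ x.1 * convLambda (k + 1) x.2 ≤
              (k + 1) * (Λ x.1 * (lambdaNonprime * convLambda k) x.2) +
              (k + 1) * k * (Λ x.1 * (primeSqLog * convLambda (k - 1)) x.2) := by
            calc _ ≤ Λ x.1 * _ := mul_le_mul_of_nonneg_left (ih hsf) vonMangoldt_nonneg
              _ = _ := by ring
          linarith
      · have e : lambdaNonprime x.1 = Λ x.1 := by rw [lambdaNonprime_apply, if_neg hp]
        rw [e]
        linarith
    have hsum := Finset.sum_le_sum hterm
    rw [Finset.sum_add_distrib, Finset.sum_add_distrib, Finset.sum_add_distrib, ← Finset.mul_sum,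
      ← Finset.mul_sum, ← Finset.mul_sum, ← Finset.sum_filter, ← mul_apply, ← mul_apply, ← mul_apply,
      ← mul_apply, ← convLambda_succ, hstep, mul_assoc ((k : ℝ) + 1) k, hstep2] at hsum
    have hrep := sum_divisors_repeated_prime_le k n
    have hP : 0 ≤ (primeSqLog * convLambda k) n :=
      mul_apply_nonneg primeSqLog_nonneg (convLambda_nonneg _) n
    refine hsum.trans ?_
    push_cast
    have h5 : ((k : ℝ) + 1) * ∑ x ∈ n.divisorsAntidiagonal with x.1.Prime ∧ x.1 ∣ x.2,
        Real.log x.1 ^ 2 * convLambda k (x.2 / x.1) ≤ (k + 1) * (primeSqLog * convLambda k) n := by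
      gcongr
    -- The coefficient of the prime-square term comes out as `(k+1)k + (k+1) = (k+1)²`, at most the
    -- required `(k+2)(k+1)`.
    nlinarith

end XiPrime

namespace XiPrime

open Set MeasureTheory Filter Topology ArithmeticFunction

/-! ### Summatory functions of convolutions -/

lemma psum_mul (f g : ArithmeticFunction ℝ) (x : ℝ) :
    psum (fun n => (f * g) n) x = psum (fun d => f d * psum (fun n => g n) (x / d)) x := by
  have h := sum_Ioc_mul_eq_sum_sum f g ⌊x⌋₊
  have e : ∀ N : ℕ, Finset.Icc 1 N = Finset.Ioc 0 N := fun N => by ext; simp; omega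
  simp only [psum, e, h, Nat.floor_div_natCast]

lemma one_le_div_of_mem {x : ℝ} (hx : 1 ≤ x) {d : ℕ} (hd : d ∈ Finset.Icc 1 ⌊x⌋₊) :
    1 ≤ x / d ∧ x / d ≤ x := by
  obtain ⟨h1, h2⟩ := mem_Icc_floor hx hd
  exact ⟨by rw [le_div_iff₀ (by linarith)]; linarith, div_le_self (by linarith) h1⟩

lemma psum_mul_le {f g : ArithmeticFunction ℝ} (hf : ∀ n, 0 ≤ f n) {F D x : ℝ} (b : ℕ) (hx : 1 ≤ x)
    (hD : 0 ≤ D) (hF : psum (fun d => f d / d) x ≤ F)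
    (hg : ∀ y, 1 ≤ y → psum (fun n => g n) y ≤ D * (y * lg y ^ b)) :
    psum (fun n => (f * g) n) x ≤ F * D * (x * lg x ^ b) := by
  have hlg := one_le_lg hx
  rw [psum_mul]
  calc _ ≤ psum (fun d => f d / d * (D * (x * lg x ^ b))) x := by
        refine psum_mono fun d hd => ?_
        obtain ⟨h1, h2⟩ := one_le_div_of_mem hx hd
        have hd0 : (0 : ℝ) < d := by linarith [(mem_Icc_floor hx hd).1]
        have h3 : psum (fun n => g n) (x / d) ≤ D * (x / d * lg x ^ b) := by
          refine (hg _ h1).trans ?_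
          have := lg_mono h1 h2
          have := one_le_lg h1
          gcongr
        calc _ ≤ f d * (D * (x / d * lg x ^ b)) := mul_le_mul_of_nonneg_left h3 (hf d)
          _ = _ := by ring
    _ = psum (fun d => f d / d) x * (D * (x * lg x ^ b)) := by rw [psum, psum, Finset.sum_mul]
    _ ≤ F * (D * (x * lg x ^ b)) := by gcongr
    _ = _ := by ring

/-- Convolving with `f` costs the divisor sum `E` and the harmonic sum `F`. For `Λ` both are of
order a logarithm. For `lambdaNonprime` only `E` is, and for `primeSqLog`, which replaces two
factors, only `E = log² x` matters: each saves logarithms because `F = O(1)`. -/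
lemma psum_sq_mul_le {f g : ArithmeticFunction ℝ} (hf : ∀ n, 0 ≤ f n) {E F D x : ℝ} (b : ℕ) (hx : 1 ≤ x)
    (hD : 0 ≤ D) (hF : psum (fun d => f d / d) x ≤ F)
    (hE : ∀ n ∈ Finset.Icc 1 ⌊x⌋₊, ∑ d ∈ n.divisors, f d ≤ E) (hE0 : 0 ≤ E)
    (hg : ∀ y, 1 ≤ y → psum (fun n => g n ^ 2) y ≤ D * (y * lg y ^ b)) :
    psum (fun n => (f * g) n ^ 2) x ≤ E * (F * D * (x * lg x ^ b)) := by
  have h1 := psum_mul_le (g := pmul g g) hf b hx hD hF (fun y hy => by simpa [sq] using hg y hy)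
  calc _ ≤ psum (fun n => E * (f * pmul g g) n) x := by
        refine psum_mono fun n hn => (sq_mul_apply_le hf n).trans ?_
        have : 0 ≤ (f * pmul g g) n :=
          mul_apply_nonneg hf (fun m => by rw [pmul_apply]; exact mul_self_nonneg _) n
        have := hE n hn
        gcongr
    _ = E * psum (fun n => (f * pmul g g) n) x := by rw [psum, psum, Finset.mul_sum]
    _ ≤ _ := by gcongr

/-- The upper half of Mertens' estimate: sum `Λ * 1 = log` over `n ≤ x`, and use `⌊x/d⌋ ≥ x/d - 1`
with Chebyshev's bound. -/
lemma exists_psum_vonMangoldt_div_le :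
    ∃ C : ℝ, 0 ≤ C ∧ ∀ x : ℝ, 1 ≤ x → psum (fun d => Λ d / d) x ≤ C * lg x := by
  have h4 := log_four_nonneg
  refine ⟨Real.log 4 + 5, by positivity, fun x hx => ?_⟩
  have hx0 : 0 < x := by linarith
  have h1 : psum (fun n => (Λ * (zeta : ArithmeticFunction ℝ)) n) x ≤ x * Real.log x := by
    rw [vonMangoldt_mul_zeta]
    calc _ ≤ psum (fun _ => Real.log x) x := by
          refine psum_mono fun n hn => ?_
          obtain ⟨h1, h2⟩ := mem_Icc_floor hx hn
          rw [log_apply]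
          exact Real.log_le_log (by linarith) h2
      _ = ⌊x⌋₊ * Real.log x := by simp [psum]
      _ ≤ _ := by
          have := Real.log_nonneg hx
          have := Nat.floor_le hx0.le
          gcongr
  have h2 : psum (fun d => Λ d * (x / d - 1)) x ≤ psum (fun n => (Λ * (zeta : ArithmeticFunction ℝ)) n) x := by
    rw [psum_mul]
    refine psum_mono fun d hd => mul_le_mul_of_nonneg_left ?_ vonMangoldt_nonneg
    have e : psum (fun n => (zeta : ArithmeticFunction ℝ) n) (x / d) = ⌊x / d⌋₊ := by
      rw [psum, Finset.sum_congr rfl (g := fun _ => (1 : ℝ))]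
      · simp
      · intro n hn
        have : n ≠ 0 := by have := (Finset.mem_Icc.mp hn).1; omega
        simp [natCoe_apply, zeta_apply, this]
    rw [e]
    linarith [Nat.lt_floor_add_one (x / d)]
  have h3 : psum (fun d => Λ d * (x / d - 1)) x = x * psum (fun d => Λ d / d) x - psum (fun d => Λ d) x := by
    rw [psum, psum, psum, Finset.mul_sum, ← Finset.sum_sub_distrib]
    exact Finset.sum_congr rfl fun d _ => by ring
  have h5 := psum_vonMangoldt_le hx0.le
  have h6 : x * psum (fun d => Λ d / d) x ≤ x * ((Real.log 4 + 5) * lg x) := by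
    have h7 : x * psum (fun d => Λ d / d) x ≤ x * Real.log x + (Real.log 4 + 4) * x := by linarith
    refine h7.trans ?_
    have h8 := one_le_lg hx
    have h9 := log_le_lg x
    calc x * Real.log x + (Real.log 4 + 4) * x = x * (Real.log x + (Real.log 4 + 4) * 1) := by ring
      _ ≤ x * (lg x + (Real.log 4 + 4) * lg x) := by gcongr
      _ = _ := by ring
  exact le_of_mul_le_mul_left h6 hx0

lemma psum_le_tsum {f : ℕ → ℝ} (hf : ∀ n, 0 ≤ f n) (hs : Summable f) (x : ℝ) : psum f x ≤ ∑' n, f n :=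
  hs.sum_le_tsum _ fun n _ => hf n

lemma exists_psum_lambdaNonprime_div_le :
    ∃ C : ℝ, 0 ≤ C ∧ ∀ x : ℝ, psum (fun d => lambdaNonprime d / d) x ≤ C := by
  -- Modulus 1: the only residue class is all of the integers.
  have h := vonMangoldt.summable_residueClass_non_primes_div (q := 1) 0
  have e : (fun n : ℕ => (if n.Prime then 0 else vonMangoldt.residueClass (0 : ZMod 1) n) / (n : ℝ)) =
      fun d => lambdaNonprime d / d := by
    funext n
    rw [lambdaNonprime_apply]
    congr 2
    simp [vonMangoldt.residueClass, Subsingleton.elim _ (0 : ZMod 1)]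
  rw [e] at h
  have hnn : ∀ n : ℕ, 0 ≤ lambdaNonprime n / n := fun n => div_nonneg (lambdaNonprime_nonneg n) n.cast_nonneg
  exact ⟨_, tsum_nonneg hnn, psum_le_tsum hnn h⟩

lemma exists_psum_primeSqLog_div_le :
    ∃ C : ℝ, 0 ≤ C ∧ ∀ x : ℝ, psum (fun d => primeSqLog d / d) x ≤ C := by
  have hnn : ∀ n : ℕ, 0 ≤ primeSqLog n / n := fun n => div_nonneg (primeSqLog_nonneg n) n.cast_nonneg
  refine ⟨_, tsum_nonneg hnn, psum_le_tsum hnn ?_⟩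
  have hinj : Function.Injective fun m : ℕ => m ^ 2 := Nat.pow_left_injective two_ne_zero
  rw [← hinj.summable_iff]
  · refine Summable.of_nonneg_of_le (fun m => hnn _) (fun m => ?_)
      ((Real.summable_nat_rpow (p := -(3 / 2))).mpr (by norm_num) |>.mul_left 16)
    simp only [Function.comp_apply]
    rcases Nat.eq_zero_or_pos m with rfl | hm
    · simp
    · have hm0 : (0 : ℝ) < m := by exact_mod_cast hm
      have h1 : primeSqLog (m ^ 2) ≤ Real.log m ^ 2 := by
        rw [primeSqLog_apply, Nat.sqrt_eq']
        split_ifs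
        · exact le_rfl
        · positivity
      have h2 : Real.log m ≤ (m : ℝ) ^ (1 / 4 : ℝ) / (1 / 4) := Real.log_le_rpow_div hm0.le (by norm_num)
      have h3 : 0 ≤ Real.log m := Real.log_natCast_nonneg m
      push_cast
      calc primeSqLog (m ^ 2) / (m : ℝ) ^ 2 ≤ ((m : ℝ) ^ (1 / 4 : ℝ) / (1 / 4)) ^ 2 / (m : ℝ) ^ 2 := by
            gcongr
            exact h1.trans (by gcongr)
        _ = 16 * (((m : ℝ) ^ (1 / 4 : ℝ)) ^ 2 / (m : ℝ) ^ 2) := by ring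
        _ = _ := by
            rw [← Real.rpow_natCast, ← Real.rpow_natCast, ← Real.rpow_mul hm0.le, ← Real.rpow_sub hm0]
            norm_num
  · intro n hn
    rw [primeSqLog_apply, if_neg, zero_div]
    exact fun h => hn ⟨_, h.2⟩

lemma sum_divisors_lambdaNonprime_le {x : ℝ} (hx : 1 ≤ x) (n : ℕ) (hn : n ∈ Finset.Icc 1 ⌊x⌋₊) :
    ∑ d ∈ n.divisors, lambdaNonprime d ≤ Real.log x := by
  obtain ⟨h1, h2⟩ := mem_Icc_floor hx hn
  calc _ ≤ ∑ d ∈ n.divisors, Λ d := Finset.sum_le_sum fun d _ => lambdaNonprime_le d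
    _ = Real.log n := vonMangoldt_sum
    _ ≤ _ := Real.log_le_log (by linarith) h2

lemma sum_divisors_vonMangoldt_le {x : ℝ} (hx : 1 ≤ x) (n : ℕ) (hn : n ∈ Finset.Icc 1 ⌊x⌋₊) :
    ∑ d ∈ n.divisors, Λ d ≤ Real.log x := by
  obtain ⟨h1, h2⟩ := mem_Icc_floor hx hn
  rw [vonMangoldt_sum]
  exact Real.log_le_log (by linarith) h2

lemma sum_divisors_primeSqLog_le {x : ℝ} (hx : 1 ≤ x) (n : ℕ) (hn : n ∈ Finset.Icc 1 ⌊x⌋₊) :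
    ∑ d ∈ n.divisors, primeSqLog d ≤ Real.log x ^ 2 := by
  obtain ⟨h1, h2⟩ := mem_Icc_floor hx hn
  have hl0 : 0 ≤ Real.log n := Real.log_natCast_nonneg n
  calc _ ≤ (∑ d ∈ n.divisors, Λ d) ^ 2 :=
        (Finset.sum_le_sum fun d _ => primeSqLog_le d).trans
          (Finset.sum_sq_le_sq_sum_of_nonneg fun d _ => vonMangoldt_nonneg)
    _ = Real.log n ^ 2 := by rw [vonMangoldt_sum]
    _ ≤ _ := by
      have := Real.log_le_log (by linarith) h2
      gcongr

/-! ### Second moments of the convolution powers -/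

/-- Chebyshev gives one logarithm for `k = 1`, and each further factor `Λ` costs two. The truncated
exponent is 0 at `k = 0`, as it should be. -/
theorem exists_psum_convLambda_sq_le (k : ℕ) :
    ∃ C : ℝ, 0 ≤ C ∧ ∀ x : ℝ, 1 ≤ x →
      psum (fun n => convLambda k n ^ 2) x ≤ C * (x * lg x ^ (2 * k - 1)) := by
  have h4 := log_four_nonneg
  match k with
  | 0 =>
    refine ⟨1, zero_le_one, fun x hx => ?_⟩
    have : psum (fun n => convLambda 0 n ^ 2) x = 1 := by
      rw [psum, Finset.sum_eq_single 1]
      · simp [convLambda_zero]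
      · intro n _ hn
        simp [convLambda_zero, one_apply, hn]
      · intro h
        exact absurd (Finset.mem_Icc.mpr ⟨le_rfl, Nat.le_floor (by simpa using hx)⟩) h
    rw [this]
    simpa using hx
  | 1 =>
    refine ⟨Real.log 4 + 4, by positivity, fun x hx => ?_⟩
    have hl := Real.log_nonneg hx
    calc _ ≤ psum (fun n => Real.log x * Λ n) x := by
          refine psum_mono fun n hn => ?_
          obtain ⟨h1, h2⟩ := mem_Icc_floor hx hn
          rw [convLambda_one, sq]
          have := vonMangoldt_le_log.trans (Real.log_le_log (by linarith) h2)
          exact mul_le_mul_of_nonneg_right this vonMangoldt_nonneg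
      _ = Real.log x * psum (fun n => Λ n) x := by rw [psum, psum, Finset.mul_sum]
      _ ≤ lg x * ((Real.log 4 + 4) * x) := by
          have := psum_vonMangoldt_le (by linarith : 0 ≤ x)
          have := log_le_lg x
          have h5 : 0 ≤ psum (fun n => Λ n) x := psum_nonneg (fun _ => vonMangoldt_nonneg) x
          have := one_le_lg hx
          gcongr
      _ = _ := by simp; ring
  | k + 2 =>
    obtain ⟨D, hD0, hD⟩ := exists_psum_convLambda_sq_le (k + 1)
    obtain ⟨C, hC0, hC⟩ := exists_psum_vonMangoldt_div_le
    refine ⟨C * D, by positivity, fun x hx => ?_⟩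
    have hl := Real.log_nonneg hx
    have h := psum_sq_mul_le (f := Λ) (g := convLambda (k + 1)) (fun _ => vonMangoldt_nonneg)
      (2 * (k + 1) - 1) hx hD0 (hC x hx) (sum_divisors_vonMangoldt_le hx) hl hD
    rw [← convLambda_succ] at h
    refine h.trans ?_
    have := log_le_lg x
    have := one_le_lg hx
    calc _ ≤ lg x * (C * lg x * D * (x * lg x ^ (2 * (k + 1) - 1))) := by gcongr
      _ = C * D * (x * lg x ^ (2 * (k + 1) - 1 + 2)) := by ring
      _ = _ := by congr 3

/-- The saving of one logarithm over the full second moment, whose exponent for this function is `2k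
+ 1`. -/
theorem exists_psum_not_squarefree_le (k : ℕ) :
    ∃ C : ℝ, 0 ≤ C ∧ ∀ x : ℝ, 1 ≤ x →
      psum (fun n => if Squarefree n then 0 else convLambda (k + 1) n ^ 2) x ≤ C * (x * lg x ^ (2 * k)) := by
  -- `k = 0` is separate because the truncated `2k - 1` would lose a logarithm there; only proper
  -- prime powers occur in that case.
  rcases Nat.eq_zero_or_pos k with rfl | hk
  · obtain ⟨C, hC0, hC⟩ := exists_log_pow_mul_psum_lambdaNonprime_le 1 (one_half_pos (α := ℝ))
    refine ⟨C, hC0, fun x hx => ?_⟩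
    have h := hC x hx
    rw [show (1 / 2 + 1 / 2 : ℝ) = 1 by norm_num, Real.rpow_one] at h
    simp only [mul_zero, pow_zero, mul_one]
    refine le_trans ?_ h
    rw [psum, psum, Finset.mul_sum]
    refine Finset.sum_le_sum fun n hn => ?_
    obtain ⟨h1, h2⟩ := mem_Icc_floor hx hn
    have hl := Real.log_nonneg hx
    have hln := Real.log_le_log (by linarith) h2
    have h0 := lambdaNonprime_nonneg n
    split_ifs with hsf
    · positivity
    · have hp : ¬ n.Prime := fun h => hsf (Nat.prime_iff.mp h).squarefree
      rw [zero_add, convLambda_one, lambdaNonprime_apply, if_neg hp, pow_one, sq]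
      exact mul_le_mul_of_nonneg_right (vonMangoldt_le_log.trans hln) vonMangoldt_nonneg
  · obtain ⟨D, hD0, hD⟩ := exists_psum_convLambda_sq_le k
    obtain ⟨D', hD'0, hD'⟩ := exists_psum_convLambda_sq_le (k - 1)
    obtain ⟨F, hF0, hF⟩ := exists_psum_lambdaNonprime_div_le
    obtain ⟨F', hF'0, hF'⟩ := exists_psum_primeSqLog_div_le
    refine ⟨2 * (k + 1) ^ 2 * (F * D) + 2 * ((k + 1) * k) ^ 2 * (F' * D'), by positivity, fun x hx => ?_⟩
    have hl := Real.log_nonneg hx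
    have hllg := log_le_lg x
    have hlg := one_le_lg hx
    have h1 := psum_sq_mul_le (f := lambdaNonprime) (g := convLambda k) lambdaNonprime_nonneg
      (2 * k - 1) hx hD0 (hF x) (sum_divisors_lambdaNonprime_le hx) hl hD
    have h2 := psum_sq_mul_le (f := primeSqLog) (g := convLambda (k - 1)) primeSqLog_nonneg
      (2 * (k - 1) - 1) hx hD'0 (hF' x) (sum_divisors_primeSqLog_le hx) (by positivity) hD'
    have h1' : psum (fun n => (lambdaNonprime * convLambda k) n ^ 2) x ≤ F * D * (x * lg x ^ (2 * k)) := by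
      refine h1.trans ?_
      calc _ ≤ lg x * (F * D * (x * lg x ^ (2 * k - 1))) := by gcongr
        _ = F * D * (x * lg x ^ (2 * k - 1 + 1)) := by ring
        _ = _ := by congr 3; omega
    have h2' : psum (fun n => (primeSqLog * convLambda (k - 1)) n ^ 2) x ≤
        F' * D' * (x * lg x ^ (2 * k)) := by
      refine h2.trans ?_
      calc _ ≤ lg x ^ 2 * (F' * D' * (x * lg x ^ (2 * (k - 1) - 1))) := by gcongr
        _ = F' * D' * (x * lg x ^ (2 * (k - 1) - 1 + 2)) := by ring
        -- The exponent is `2k - 1` for `k ≥ 2`, and `2 = 2k` for `k = 1`, where the subtraction is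
        -- truncated.
        _ ≤ _ := by gcongr; omega
    calc _ ≤ psum (fun n => 2 * (k + 1) ^ 2 * (lambdaNonprime * convLambda k) n ^ 2 +
          2 * ((k + 1) * k) ^ 2 * (primeSqLog * convLambda (k - 1)) n ^ 2) x := by
          refine psum_mono fun n _ => ?_
          split_ifs with hsf
          · positivity
          · have h3 := convLambda_succ_le_of_not_squarefree k hsf
            have h0 := convLambda_nonneg (k + 1) n
            calc _ ≤ ((k + 1) * (lambdaNonprime * convLambda k) n +
                  (k + 1) * k * (primeSqLog * convLambda (k - 1)) n) ^ 2 := by gcongr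
              _ ≤ 2 * (((k + 1) * (lambdaNonprime * convLambda k) n) ^ 2 +
                  ((k + 1) * k * (primeSqLog * convLambda (k - 1)) n) ^ 2) := add_sq_le
              _ = _ := by ring
      _ = 2 * (k + 1) ^ 2 * psum (fun n => (lambdaNonprime * convLambda k) n ^ 2) x +
          2 * ((k + 1) * k) ^ 2 * psum (fun n => (primeSqLog * convLambda (k - 1)) n ^ 2) x := by
          rw [psum, psum, psum, Finset.sum_add_distrib, Finset.mul_sum, Finset.mul_sum]
      _ ≤ 2 * (k + 1) ^ 2 * (F * D * (x * lg x ^ (2 * k))) +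
          2 * ((k + 1) * k) ^ 2 * (F' * D' * (x * lg x ^ (2 * k))) := by gcongr
      _ = _ := by ring

end XiPrime

namespace XiPrime

open Set MeasureTheory Filter Topology ArithmeticFunction

/-! ### Asymptotics for the convolution powers of `Λ²` -/

/-- Integrating an asymptotic formula against `du/u` raises both the main and the error power of the
logarithm by one. -/
lemma abs_integral_div_sub_le {g : ℝ → ℝ} {a C x : ℝ} {q p : ℕ} (hx : 1 ≤ x) (hC : 0 ≤ C)
    (hint : IntervalIntegrable (fun u => g u / u) volume 1 x)
    (hg : ∀ u ∈ Icc 1 x, |g u - a * Real.log u ^ q| ≤ C * lg u ^ p) :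
    |(∫ u in (1 : ℝ)..x, g u / u) - a / (q + 1) * Real.log x ^ (q + 1)| ≤ C * lg x ^ (p + 1) := by
  have h1 : a / (q + 1) * Real.log x ^ (q + 1) = ∫ u in (1 : ℝ)..x, a * (Real.log u ^ q / u) := by
    rw [intervalIntegral.integral_const_mul, integral_log_pow_div_one hx]
    ring
  have hint2 : IntervalIntegrable (fun u => a * (Real.log u ^ q / u)) volume 1 x := by
    refine ContinuousOn.intervalIntegrable ?_
    rw [uIcc_of_le hx]
    have := continuousOn_log_pow_div one_pos x q
    simp only [div_one] at this
    exact this.const_mul a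
  rw [h1, ← intervalIntegral.integral_sub hint hint2]
  have e : (fun u => g u / u - a * (Real.log u ^ q / u)) = fun u => (g u - a * Real.log u ^ q) / u := by
    funext u; ring
  rw [e]
  have h2 := abs_integral_div_le (g := fun u => g u - a * Real.log u ^ q) (M := C * lg x ^ p) hx
    (fun u hu => (hg u hu).trans (by
      have := lg_mono hu.1 hu.2
      have := one_le_lg hu.1
      gcongr))
  refine h2.trans ?_
  have := log_le_lg x
  have := one_le_lg hx
  calc _ ≤ C * lg x ^ p * lg x := by gcongr
    _ = _ := by ring

lemma exists_abs_psum_lambdaSq_sub_le :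
    ∃ C : ℝ, 0 ≤ C ∧ ∀ x : ℝ, 1 ≤ x → |psum (fun n => lambdaSq n) x - x * Real.log x| ≤ C * x := by
  obtain ⟨C, hC0, hC⟩ := exists_abs_psum_vonMangoldt_sq_mul_log_pow_le (j := 0) (by norm_num)
  refine ⟨C, hC0, fun x hx => ?_⟩
  simpa [lambdaSq_apply] using hC x hx

lemma integral_inv_sq {a b : ℝ} (ha : 0 < a) (hab : a ≤ b) :
    ContinuousOn (fun u : ℝ => 1 / u ^ 2) (Icc a b) ∧ ∫ u in a..b, 1 / u ^ 2 = 1 / a - 1 / b := by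
  have hc : ContinuousOn (fun u : ℝ => 1 / u ^ 2) (Icc a b) :=
    continuousOn_const.div (by fun_prop) fun u hu => by
      have : 0 < u := ha.trans_le hu.1
      positivity
  refine ⟨hc, ?_⟩
  rw [intervalIntegral.integral_eq_sub_of_hasDerivAt (f := fun u => -u⁻¹)]
  · ring
  · intro u hu
    rw [uIcc_of_le hab] at hu
    have hu0 : u ≠ 0 := (ha.trans_le hu.1).ne'
    convert! (hasDerivAt_inv hu0).neg using 1
    rw [neg_neg, one_div]
  · rw [← uIcc_of_le hab] at hc
    exact hc.intervalIntegrable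

lemma psum_div_eq (f : ℕ → ℝ) {x : ℝ} (hx : 1 ≤ x) :
    IntervalIntegrable (fun u => psum f u / u / u) volume 1 x ∧
      psum (fun n => f n / n) x = psum f x / x + ∫ u in (1 : ℝ)..x, psum f u / u / u := by
  have hfun : (fun u => psum f u / u / u) = fun u => ∑ n ∈ Finset.Icc 1 ⌊u⌋₊, f n * (1 / u ^ 2) := by
    funext u
    rw [psum, ← Finset.sum_mul, div_div, ← sq, mul_one_div]
  have hpos : ∀ n ∈ Finset.Icc 1 ⌊x⌋₊, (0 : ℝ) < n := fun n hn =>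
    zero_lt_one.trans_le (mem_Icc_floor hx hn).1
  obtain ⟨h1, h2⟩ := integral_sum_Icc_floor (w := fun n u => f n * (1 / u ^ 2)) hx
    (fun n hn => (integral_inv_sq (hpos n hn) (mem_Icc_floor hx hn).2).1.const_mul (f n))
  rw [hfun]
  refine ⟨h1, ?_⟩
  rw [h2, psum, psum, Finset.sum_div, ← Finset.sum_add_distrib]
  refine Finset.sum_congr rfl fun n hn => ?_
  rw [intervalIntegral.integral_const_mul, (integral_inv_sq (hpos n hn) (mem_Icc_floor hx hn).2).2]
  ring

/-- The function `Λ(n)² / n`. -/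
noncomputable def lambdaSqDiv (n : ℕ) : ℝ := lambdaSq n / n

/-- Partial summation gives `(log² x)/2` for `m = 0`. Each further order multiplies by `m + 1` and
integrates `log^{m+2} u` against `du/u`, so the coefficient gains `(m+1)/(m+3)`. -/
lemma exists_abs_riesz_lambdaSqDiv_sub_le (m : ℕ) :
    ∃ C : ℝ, 0 ≤ C ∧ ∀ x : ℝ, 1 ≤ x →
      |riesz lambdaSqDiv m x - m.factorial / (m + 2).factorial * Real.log x ^ (m + 2)| ≤
        C * lg x ^ (m + 1) := by
  induction m with
  | zero =>
    obtain ⟨C, hC0, hC⟩ := exists_abs_psum_lambdaSq_sub_le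
    refine ⟨2 * C + 1, by positivity, fun x hx => ?_⟩
    have hdiv : ∀ u ∈ Icc 1 x, |psum (fun n => lambdaSq n) u / u - 1 * Real.log u ^ 1| ≤ C * lg u ^ 0 := by
      intro u hu
      have hu0 : 0 < u := by linarith [hu.1]
      have e : psum (fun n => lambdaSq n) u / u - 1 * Real.log u ^ 1 =
          (psum (fun n => lambdaSq n) u - u * Real.log u) / u := by field_simp
      rw [e, abs_div, abs_of_pos hu0, div_le_iff₀ hu0, pow_zero, mul_one]
      exact hC u hu.1
    obtain ⟨hi, heq⟩ := psum_div_eq (fun n => lambdaSq n) hx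
    have h1 := abs_integral_div_sub_le hx hC0 hi hdiv
    have h2 := hdiv x ⟨hx, le_rfl⟩
    have e : psum lambdaSqDiv x = psum (fun n => lambdaSq n / n) x := rfl
    rw [riesz_zero, e, heq]
    have hlg := one_le_lg hx
    have hl := Real.log_nonneg hx
    have hllg := log_le_lg x
    norm_num [Nat.factorial] at h1 h2 ⊢
    rw [abs_le] at h1 h2 ⊢
    have : C ≤ C * lg x := le_mul_of_one_le_right hC0 hlg
    constructor <;> nlinarith
  | succ m ih =>
    obtain ⟨C, hC0, hC⟩ := ih
    refine ⟨(m + 1) * C, by positivity, fun x hx => ?_⟩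
    obtain ⟨hi, heq⟩ := riesz_succ lambdaSqDiv m hx
    have h1 := abs_integral_div_sub_le hx hC0 hi (fun u hu => hC u hu.1)
    have hm : (0 : ℝ) ≤ m + 1 := by positivity
    have e : ((m + 1).factorial : ℝ) / (m + 1 + 2).factorial * Real.log x ^ (m + 1 + 2) =
        (m + 1) * ((m.factorial : ℝ) / (m + 2).factorial / ((m + 2 : ℕ) + 1) * Real.log x ^ (m + 2 + 1)) := by
      rw [show m + 1 + 2 = (m + 2) + 1 by ring, Nat.factorial_succ (m + 2), Nat.factorial_succ m]
      push_cast
      have h3 : ((m + 2).factorial : ℝ) ≠ 0 := by positivity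
      have h4 : (m : ℝ) + 2 + 1 ≠ 0 := by positivity
      field_simp
    rw [heq, e, ← mul_sub, abs_mul, abs_of_nonneg hm, mul_assoc]
    gcongr

/-- Peel off one factor `Λ²(d)` and insert the formula at `x/d`. The main term is a Riesz mean of
order `2k + 1`, whose coefficient turns `1/(2k+1)!` into `1/(2k+3)!`; the error is multiplied by `∑
Λ(d)²/d = O((1 + log x)²)`. -/
theorem exists_abs_psum_lambdaSq_pow_sub_le (k : ℕ) :
    ∃ C : ℝ, 0 ≤ C ∧ ∀ x : ℝ, 1 ≤ x →
      |psum (fun n => (lambdaSq ^ (k + 1)) n) x - x * Real.log x ^ (2 * k + 1) / (2 * k + 1).factorial| ≤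
        C * (x * lg x ^ (2 * k)) := by
  induction k with
  | zero =>
    obtain ⟨C, hC0, hC⟩ := exists_abs_psum_lambdaSq_sub_le
    exact ⟨C, hC0, fun x hx => by simpa using hC x hx⟩
  | succ k ih =>
    obtain ⟨C, hC0, hC⟩ := ih
    obtain ⟨D, hD0, hD⟩ := exists_abs_riesz_lambdaSqDiv_sub_le 0
    obtain ⟨R, hR0, hR⟩ := exists_abs_riesz_lambdaSqDiv_sub_le (2 * k + 1)
    refine ⟨C * (D + 1) + R, by positivity, fun x hx => ?_⟩
    have hx0 : 0 < x := by linarith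
    have hlg := one_le_lg hx
    have hl := Real.log_nonneg hx
    have hllg := log_le_lg x
    have hd : psum lambdaSqDiv x ≤ (D + 1) * lg x ^ 2 := by
      have := hD x hx
      rw [riesz_zero] at this
      norm_num [Nat.factorial] at this
      have h2 := (abs_le.mp this).2
      have h3 : Real.log x ^ 2 ≤ lg x ^ 2 := by gcongr
      have h4 : D * lg x ≤ D * lg x ^ 2 := by
        gcongr
        exact le_self_pow₀ hlg two_ne_zero
      nlinarith [sq_nonneg (Real.log x)]
    have hmain : |psum (fun n => (lambdaSq ^ (k + 1 + 1)) n) x -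
        x / (2 * k + 1).factorial * riesz lambdaSqDiv (2 * k + 1) x| ≤
        C * (x * lg x ^ (2 * k)) * psum lambdaSqDiv x := by
      rw [pow_succ', psum_mul, psum, psum, riesz, Finset.mul_sum, Finset.mul_sum, ← Finset.sum_sub_distrib]
      refine (Finset.abs_sum_le_sum_abs _ _).trans (Finset.sum_le_sum fun d hd => ?_)
      obtain ⟨h1, h2⟩ := one_le_div_of_mem hx hd
      have hd0 : (0 : ℝ) < d := by linarith [(mem_Icc_floor hx hd).1]
      have h3 := hC _ h1
      have e : lambdaSq d * psum (fun n => (lambdaSq ^ (k + 1)) n) (x / d) -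
          x / (2 * k + 1).factorial * (lambdaSqDiv d * Real.log (x / d) ^ (2 * k + 1)) =
          lambdaSq d * (psum (fun n => (lambdaSq ^ (k + 1)) n) (x / d) -
            x / d * Real.log (x / d) ^ (2 * k + 1) / (2 * k + 1).factorial) := by
        rw [lambdaSqDiv]; ring
      rw [e, abs_mul, abs_of_nonneg (lambdaSq_nonneg d)]
      have hn := lambdaSq_nonneg d
      have := lg_mono h1 h2
      have := one_le_lg h1
      calc _ ≤ lambdaSq d * (C * (x / d * lg (x / d) ^ (2 * k))) := by gcongr
        _ ≤ lambdaSq d * (C * (x / d * lg x ^ (2 * k))) := by gcongr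
        _ = _ := by rw [lambdaSqDiv]; ring
    have hr := hR x hx
    have e : x * Real.log x ^ (2 * (k + 1) + 1) / (2 * (k + 1) + 1).factorial =
        x / (2 * k + 1).factorial * ((2 * k + 1).factorial / (2 * k + 1 + 2).factorial *
          Real.log x ^ (2 * k + 1 + 2)) := by
      have h3 : ((2 * k + 1).factorial : ℝ) ≠ 0 := by positivity
      rw [show 2 * (k + 1) + 1 = 2 * k + 1 + 2 by ring]
      field_simp
    have hfac : (1 : ℝ) ≤ (2 * k + 1).factorial := by exact_mod_cast Nat.factorial_pos _
    have hr' : |x / (2 * k + 1).factorial * riesz lambdaSqDiv (2 * k + 1) x -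
        x * Real.log x ^ (2 * (k + 1) + 1) / (2 * (k + 1) + 1).factorial| ≤ x * (R * lg x ^ (2 * k + 2)) := by
      rw [e, ← mul_sub, abs_mul, abs_of_nonneg (by positivity)]
      gcongr
      exact div_le_self hx0.le hfac
    calc _ ≤ _ := abs_sub_le _ (x / (2 * k + 1).factorial * riesz lambdaSqDiv (2 * k + 1) x) _
      _ ≤ C * (x * lg x ^ (2 * k)) * ((D + 1) * lg x ^ 2) + x * (R * lg x ^ (2 * k + 2)) := by
        refine add_le_add (hmain.trans ?_) hr'
        gcongr
      _ = (C * (D + 1) + R) * (x * lg x ^ (2 * (k + 1))) := by ring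

/-- Squarefree integers match exactly. Elsewhere both functions are controlled by `Λ_{k+1}²`, whose
sum over integers that are not squarefree is an error term. -/
theorem exists_abs_psum_convLambda_sq_sub_le (k : ℕ) :
    ∃ C : ℝ, 0 ≤ C ∧ ∀ x : ℝ, 1 ≤ x →
      |psum (fun n => convLambda (k + 1) n ^ 2) x -
        (k + 1).factorial / (2 * k + 1).factorial * (x * Real.log x ^ (2 * k + 1))| ≤
        C * (x * lg x ^ (2 * k)) := by
  obtain ⟨C, hC0, hC⟩ := exists_abs_psum_lambdaSq_pow_sub_le k
  obtain ⟨D, hD0, hD⟩ := exists_psum_not_squarefree_le k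
  set K : ℝ := ((k + 1).factorial : ℝ)
  have hK : 0 ≤ K := by positivity
  refine ⟨(1 + K) * D + K * C, by positivity, fun x hx => ?_⟩
  have h1 : |psum (fun n => convLambda (k + 1) n ^ 2) x - K * psum (fun n => (lambdaSq ^ (k + 1)) n) x| ≤
      (1 + K) * psum (fun n => if Squarefree n then 0 else convLambda (k + 1) n ^ 2) x := by
    rw [psum, psum, psum, Finset.mul_sum, Finset.mul_sum, ← Finset.sum_sub_distrib]
    refine (Finset.abs_sum_le_sum_abs _ _).trans (Finset.sum_le_sum fun n _ => ?_)
    split_ifs with hsf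
    · rw [convLambda_sq_of_squarefree _ hsf, sub_self, abs_zero, mul_zero]
    · have h2 := lambdaSq_pow_le (k + 1) n
      have h3 := pow_apply_nonneg lambdaSq_nonneg (k + 1) n
      have h4 : K * (lambdaSq ^ (k + 1)) n ≤ K * convLambda (k + 1) n ^ 2 := by gcongr
      have h5 : 0 ≤ K * (lambdaSq ^ (k + 1)) n := by positivity
      have h6 : 0 ≤ convLambda (k + 1) n ^ 2 := by positivity
      rw [abs_le]
      constructor <;> linarith
  have e : K / (2 * k + 1).factorial * (x * Real.log x ^ (2 * k + 1)) =
      K * (x * Real.log x ^ (2 * k + 1) / (2 * k + 1).factorial) := by ring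
  have h2 : |K * psum (fun n => (lambdaSq ^ (k + 1)) n) x -
      K / (2 * k + 1).factorial * (x * Real.log x ^ (2 * k + 1))| ≤ K * (C * (x * lg x ^ (2 * k))) := by
    rw [e, ← mul_sub, abs_mul, abs_of_nonneg hK]
    gcongr
    exact hC x hx
  calc _ ≤ _ := abs_sub_le _ (K * psum (fun n => (lambdaSq ^ (k + 1)) n) x) _
    _ ≤ (1 + K) * (D * (x * lg x ^ (2 * k))) + K * (C * (x * lg x ^ (2 * k))) := by
      refine add_le_add (h1.trans ?_) h2
      gcongr
      exact hD x hx
    _ = _ := by ring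

end XiPrime

/-! ### The sums `A_{k,l}` -/

namespace XiPrime
open Set MeasureTheory Filter Topology ArithmeticFunction

lemma Akl_eq_psum (k l : ℕ) (x : ℝ) : Akl k l x = psum (fun n => alpha k n * alpha l n) x := rfl

lemma Akl_comm (k l : ℕ) (x : ℝ) : Akl k l x = Akl l k x := by
  simp only [Akl_eq_psum, mul_comm]

lemma alpha_zero_apply (n : ℕ) : alpha 0 n = -Λ n := by
  simp [alpha]

lemma alpha_one_apply (n : ℕ) : alpha 1 n = Real.log n * Λ n := by
  have h := alpha_succ_apply 0 n
  simpa [convLambda_one] using h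

lemma alpha_apply_one (k : ℕ) : alpha k 1 = 0 := by
  cases k with
  | zero => simp [alpha_zero_apply]
  | succ k => simp [alpha_succ_apply]

lemma Akl_eq_zero_of_lt_two (k l : ℕ) {x : ℝ} (hx : 1 ≤ x) (hx2 : x < 2) : Akl k l x = 0 := by
  have h : ⌊x⌋₊ = 1 := by
    rw [Nat.floor_eq_iff (by linarith)]
    norm_num
    exact ⟨hx, hx2⟩
  simp [Akl, h, alpha_apply_one]

lemma lg_le_mul_log {x : ℝ} (hx : 2 ≤ x) : lg x ≤ 3 * Real.log x := by
  have h1 : Real.log 2 ≤ Real.log x := Real.log_le_log (by norm_num) hx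
  have h2 := Real.log_two_gt_d9
  unfold lg
  linarith

/-- An error term in `1 + log x` may be replaced by one in `log x`, as `A_{k,l}` vanishes
on `[1, 2)`. -/
lemma exists_abs_Akl_sub_le_log {k l q : ℕ} {c : ℝ}
    (h : ∃ C : ℝ, 0 ≤ C ∧ ∀ x : ℝ, 1 ≤ x →
      |Akl k l x - c * (x * Real.log x ^ (q + 1))| ≤ C * (x * lg x ^ q)) :
    ∃ C : ℝ, ∀ x : ℝ, 1 ≤ x →
      |Akl k l x - c * (x * Real.log x ^ (q + 1))| ≤ C * (x * Real.log x ^ q) := by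
  obtain ⟨C, hC0, hC⟩ := h
  refine ⟨C * 3 ^ q + |c|, fun x hx => ?_⟩
  have hlog : 0 ≤ Real.log x := Real.log_nonneg hx
  have hb : 0 ≤ x * Real.log x ^ q := by positivity
  rcases lt_or_ge x 2 with h2 | h2
  · rw [Akl_eq_zero_of_lt_two k l hx h2, zero_sub, abs_neg, abs_mul,
      abs_of_nonneg (by positivity : 0 ≤ x * Real.log x ^ (q + 1))]
    have h3 : Real.log x ≤ 1 := by
      have := Real.log_le_sub_one_of_pos (by linarith : 0 < x)
      linarith
    have h4 : x * Real.log x ^ (q + 1) ≤ x * Real.log x ^ q := by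
      rw [pow_succ, ← mul_assoc]
      exact mul_le_of_le_one_right hb h3
    have h5 : 0 ≤ C * 3 ^ q * (x * Real.log x ^ q) := by positivity
    nlinarith [mul_le_mul_of_nonneg_left h4 (abs_nonneg c)]
  · have h3 : lg x ^ q ≤ 3 ^ q * Real.log x ^ q := by
      rw [← mul_pow]
      exact pow_le_pow_left₀ (by linarith [one_le_lg hx]) (lg_le_mul_log h2) q
    calc _ ≤ C * (x * lg x ^ q) := hC x hx
      _ ≤ C * (x * (3 ^ q * Real.log x ^ q)) := by gcongr
      _ ≤ _ := by nlinarith [mul_nonneg (abs_nonneg c) hb]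

lemma Akl_zero_zero (x : ℝ) : Akl 0 0 x = psum (fun n => Λ n ^ 2 * Real.log n ^ 0) x := by
  rw [Akl_eq_psum]; congr 1; ext n; rw [alpha_zero_apply]; ring

lemma Akl_one_zero (x : ℝ) : Akl 1 0 x = -psum (fun n => Λ n ^ 2 * Real.log n ^ 1) x := by
  rw [Akl_eq_psum, psum, psum, ← Finset.sum_neg_distrib]
  refine Finset.sum_congr rfl fun n _ => ?_
  rw [alpha_zero_apply, alpha_one_apply]; ring

lemma Akl_one_one (x : ℝ) : Akl 1 1 x = psum (fun n => Λ n ^ 2 * Real.log n ^ 2) x := by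
  rw [Akl_eq_psum]; congr 1; ext n; rw [alpha_one_apply]; ring

lemma exists_abs_Akl_zero_zero_sub_le : ∃ C : ℝ, 0 ≤ C ∧ ∀ x : ℝ, 1 ≤ x →
    |Akl 0 0 x - 1 * (x * Real.log x ^ 1)| ≤ C * (x * lg x ^ 0) := by
  obtain ⟨C, hC0, hC⟩ := exists_abs_psum_vonMangoldt_sq_mul_log_pow_le (j := 0) (by norm_num)
  exact ⟨C, hC0, fun x hx => by simpa only [Akl_zero_zero, one_mul] using hC x hx⟩

lemma exists_abs_Akl_one_zero_sub_le : ∃ C : ℝ, 0 ≤ C ∧ ∀ x : ℝ, 1 ≤ x →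
    |Akl 1 0 x - (-1) * (x * Real.log x ^ 2)| ≤ C * (x * lg x ^ 1) := by
  obtain ⟨C, hC0, hC⟩ := exists_abs_psum_vonMangoldt_sq_mul_log_pow_le (j := 1) (by norm_num)
  refine ⟨C, hC0, fun x hx => ?_⟩
  rw [Akl_one_zero, ← abs_neg]
  convert hC x hx using 2
  ring

lemma exists_abs_Akl_one_one_sub_le : ∃ C : ℝ, 0 ≤ C ∧ ∀ x : ℝ, 1 ≤ x →
    |Akl 1 1 x - 1 * (x * Real.log x ^ 3)| ≤ C * (x * lg x ^ 2) := by
  obtain ⟨C, hC0, hC⟩ := exists_abs_psum_vonMangoldt_sq_mul_log_pow_le (j := 2) (by norm_num)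
  exact ⟨C, hC0, fun x hx => by simpa only [Akl_one_one, one_mul] using hC x hx⟩

lemma log_natCast_nonneg_le {n : ℕ} {x : ℝ} (hn : 1 ≤ n) (hnx : (n : ℝ) ≤ x) :
    0 ≤ Real.log n ∧ Real.log n ≤ Real.log x := by
  have h1 : (1 : ℝ) ≤ n := by exact_mod_cast hn
  exact ⟨Real.log_nonneg h1, Real.log_le_log (by linarith) hnx⟩

lemma alpha_succ_nonneg (k : ℕ) {n : ℕ} (hn : 1 ≤ n) : 0 ≤ alpha (k + 1) n := by
  rw [alpha_succ_apply]
  have h1 := (log_natCast_nonneg_le hn le_rfl).1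
  have h2 := convLambda_nonneg (k + 1) n
  positivity

lemma alpha_succ_le (k : ℕ) {n : ℕ} (hn : 1 ≤ n) : alpha (k + 1) n ≤ Real.log n ^ (k + 2) := by
  rw [alpha_succ_apply]
  have h1 := (log_natCast_nonneg_le hn le_rfl).1
  have h2 := convLambda_le_log_pow (k + 1) (n := n) (by omega)
  have h3 := convLambda_nonneg (k + 1) n
  have hk : (1 : ℝ) ≤ (k : ℝ) + 1 := by linarith [(Nat.cast_nonneg k : (0 : ℝ) ≤ k)]
  calc _ ≤ Real.log n * convLambda (k + 1) n := div_le_self (by positivity) hk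
    _ ≤ Real.log n * Real.log n ^ (k + 1) := by gcongr
    _ = _ := by ring

/-- For `k ≥ 2` the products `α_k α_0` and `α_k α_1` are supported on proper prime powers. -/
lemma exists_abs_Akl_le_rpow {k l : ℕ} (hk : 2 ≤ k) (hl : l ≤ 1) {ε : ℝ} (hε : 0 < ε) :
    ∃ C : ℝ, 0 ≤ C ∧ ∀ x : ℝ, 1 ≤ x → |Akl k l x| ≤ C * x ^ (1 / 2 + ε : ℝ) := by
  obtain ⟨k, rfl⟩ : ∃ m, k = m + 2 := ⟨k - 2, by omega⟩
  obtain ⟨C, hC0, hC⟩ := exists_log_pow_mul_psum_lambdaNonprime_le (k + 3 + l) hε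
  refine ⟨C, hC0, fun x hx => le_trans ?_ (hC x hx)⟩
  rw [Akl_eq_psum, psum, psum, Finset.mul_sum]
  refine (Finset.abs_sum_le_sum_abs _ _).trans (Finset.sum_le_sum fun n hn => ?_)
  obtain ⟨hn1, hnx⟩ := mem_Icc_floor hx hn
  replace hn1 : 1 ≤ n := by exact_mod_cast hn1
  obtain ⟨hl0, hlx⟩ := log_natCast_nonneg_le hn1 hnx
  have hlogx : 0 ≤ Real.log x := Real.log_nonneg hx
  -- At a prime the factor with index at least 2 vanishes; elsewhere the other factor supplies
  -- `Λ(n)` at a proper prime power or is 0.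
  by_cases hp : n.Prime
  · have : alpha (k + 2) n = 0 := by
      rw [alpha_succ_apply, convLambda_prime (by omega) hp]; simp
    rw [this, zero_mul, abs_zero]
    exact mul_nonneg (by positivity) (lambdaNonprime_nonneg n)
  · have hΛ : lambdaNonprime n = Λ n := by rw [lambdaNonprime_apply, if_neg hp]
    have h1 : |alpha l n| = Real.log n ^ l * Λ n := by
      interval_cases l
      · simp [alpha_zero_apply, abs_of_nonneg vonMangoldt_nonneg]
      · rw [alpha_one_apply, abs_of_nonneg (mul_nonneg hl0 vonMangoldt_nonneg), pow_one]
    rw [abs_mul, h1, abs_of_nonneg (alpha_succ_nonneg _ hn1), hΛ, ← mul_assoc]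
    refine mul_le_mul_of_nonneg_right ?_ vonMangoldt_nonneg
    calc _ ≤ Real.log n ^ (k + 3) * Real.log n ^ l := by
          gcongr; exact alpha_succ_le (k + 1) hn1
      _ = Real.log n ^ (k + 3 + l) := by ring
      _ ≤ _ := by gcongr

/-- The summand is `Λ_{k+1}² log² n/(k+1)²`. Replacing `log² n` by `log² x` costs one logarithm by
the crude second moment, and `(k+1)!/((k+1)² (2k+1)!) = 2 k!/(2k+2)!`. -/
lemma exists_abs_Akl_diag_sub_le (k : ℕ) : ∃ C : ℝ, 0 ≤ C ∧ ∀ x : ℝ, 1 ≤ x →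
    |Akl (k + 1) (k + 1) x - 2 * ((k.factorial : ℝ) / ((2 * (k + 1)).factorial : ℝ)) *
      (x * Real.log x ^ (2 * (k + 1) + 1))| ≤ C * (x * lg x ^ (2 * (k + 1))) := by
  obtain ⟨C, hC0, hC⟩ := exists_abs_psum_convLambda_sq_sub_le k
  obtain ⟨D, hD0, hD⟩ := exists_psum_convLambda_sq_le (k + 1)
  refine ⟨2 * D + C, by positivity, fun x hx => ?_⟩
  have hlogx : 0 ≤ Real.log x := Real.log_nonneg hx
  have hlg1 := one_le_lg hx
  have hle := log_le_lg x
  have hx0 : 0 ≤ x := by linarith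
  set f : ℕ → ℝ := fun n => convLambda (k + 1) n ^ 2 with hf
  have e1 : Akl (k + 1) (k + 1) x =
      1 / ((k : ℝ) + 1) ^ 2 * psum (fun n => f n * Real.log n ^ 2) x := by
    rw [Akl_eq_psum, psum, psum, Finset.mul_sum]
    refine Finset.sum_congr rfl fun n _ => ?_
    rw [alpha_succ_apply, hf]
    have : (k : ℝ) + 1 ≠ 0 := by positivity
    field_simp
  have e2 : 2 * ((k.factorial : ℝ) / ((2 * (k + 1)).factorial : ℝ)) =
      1 / ((k : ℝ) + 1) ^ 2 * ((k + 1).factorial / (2 * k + 1).factorial) := by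
    have h1 : (2 * (k + 1)).factorial = (2 * k + 2) * (2 * k + 1).factorial := by
      rw [show 2 * (k + 1) = (2 * k + 1) + 1 by ring, Nat.factorial_succ]
    have h2 : ((2 * k + 1).factorial : ℝ) ≠ 0 := by positivity
    have h3 : (k : ℝ) + 1 ≠ 0 := by positivity
    rw [h1, Nat.factorial_succ k]
    push_cast
    have h4 : (2 * (k : ℝ) + 2) ≠ 0 := by positivity
    field_simp
  have hM : ∀ u ∈ Icc 1 x, |psum f u| ≤ D * lg x ^ (2 * k + 1) * u := by
    intro u hu
    rw [abs_of_nonneg (psum_nonneg (fun n => by positivity) u)]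
    calc _ ≤ D * (u * lg u ^ (2 * (k + 1) - 1)) := hD u hu.1
      _ = D * lg u ^ (2 * k + 1) * u := by
          rw [show 2 * (k + 1) - 1 = 2 * k + 1 by omega]; ring
      _ ≤ _ := by
          have h1 := one_le_lg hu.1
          have h2 := hu.1
          gcongr
          exact lg_mono hu.1 hu.2
  have a1 := abs_psum_mul_log_pow_sub_le (f := f) (fun n => by positivity) hx hM 2
  have a2 := hC x hx
  set P := psum (fun n => f n * Real.log n ^ 2) x
  set Q := psum f x
  set c : ℝ := (k + 1).factorial / (2 * k + 1).factorial
  have a3 : |P - c * (x * Real.log x ^ (2 * (k + 1) + 1))| ≤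
      (2 * D + C) * (x * lg x ^ (2 * (k + 1))) := by
    have b1 : |P - Real.log x ^ 2 * Q| ≤ 2 * D * (x * lg x ^ (2 * (k + 1))) := by
      refine a1.trans ?_
      norm_num only
      rw [pow_one]
      calc _ ≤ 2 * lg x * (D * lg x ^ (2 * k + 1) * x) := by gcongr
        _ = _ := by ring
    have b2 : |Real.log x ^ 2 * Q - Real.log x ^ 2 * (c * (x * Real.log x ^ (2 * k + 1)))| ≤
        C * (x * lg x ^ (2 * (k + 1))) := by
      rw [← mul_sub, abs_mul, abs_of_nonneg (by positivity)]
      calc _ ≤ lg x ^ 2 * (C * (x * lg x ^ (2 * k))) := by gcongr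
        _ = _ := by ring
    have b3 : c * (x * Real.log x ^ (2 * (k + 1) + 1)) =
        Real.log x ^ 2 * (c * (x * Real.log x ^ (2 * k + 1))) := by ring
    rw [b3]
    calc _ ≤ _ := abs_sub_le _ (Real.log x ^ 2 * Q) _
      _ ≤ _ := add_le_add b1 b2
      _ = _ := by ring
  rw [e1, e2, mul_assoc, ← mul_sub, abs_mul, abs_of_nonneg (by positivity)]
  have hk1 : 1 / ((k : ℝ) + 1) ^ 2 ≤ 1 := by
    rw [div_le_one (by positivity)]
    nlinarith [(Nat.cast_nonneg k : (0 : ℝ) ≤ k)]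
  exact (mul_le_of_le_one_left (abs_nonneg _) hk1).trans a3

/-- Off the diagonal only non-squarefree integers contribute. -/
lemma exists_abs_Akl_off_diag_le {k l : ℕ} (hkl : k ≠ l) : ∃ C : ℝ, 0 ≤ C ∧ ∀ x : ℝ, 1 ≤ x →
    |Akl (k + 1) (l + 1) x| ≤ C * (x * lg x ^ (k + 1 + (l + 1))) := by
  obtain ⟨C, hC0, hC⟩ := exists_psum_not_squarefree_le k
  obtain ⟨D, hD0, hD⟩ := exists_psum_not_squarefree_le l
  refine ⟨√(C * D), by positivity, fun x hx => ?_⟩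
  have hlogx : 0 ≤ Real.log x := Real.log_nonneg hx
  have hlg1 := one_le_lg hx
  have hle := log_le_lg x
  have hx0 : 0 ≤ x := by linarith
  set F : ℕ → ℕ → ℝ := fun k n => if Squarefree n then 0 else convLambda (k + 1) n with hF
  have hFsq (k : ℕ) : psum (fun n => F k n ^ 2) x =
      psum (fun n => if Squarefree n then 0 else convLambda (k + 1) n ^ 2) x := by
    congr 1; ext n; simp only [hF]; split_ifs <;> simp
  have hF0 (k n : ℕ) : 0 ≤ F k n := by
    simp only [hF]; split_ifs
    exacts [le_rfl, convLambda_nonneg _ _]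
  have h1 : |Akl (k + 1) (l + 1) x| ≤ lg x ^ 2 * psum (fun n => F k n * F l n) x := by
    rw [Akl_eq_psum, psum, psum, Finset.mul_sum]
    refine (Finset.abs_sum_le_sum_abs _ _).trans (Finset.sum_le_sum fun n hn => ?_)
    obtain ⟨hn1, hnx⟩ := mem_Icc_floor hx hn
    replace hn1 : 1 ≤ n := by exact_mod_cast hn1
    obtain ⟨hl0, hlx⟩ := log_natCast_nonneg_le hn1 hnx
    have key (k : ℕ) : alpha (k + 1) n ≤ lg x * convLambda (k + 1) n := by
      rw [alpha_succ_apply]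
      have h3 := convLambda_nonneg (k + 1) n
      have hk : (1 : ℝ) ≤ (k : ℝ) + 1 := by linarith [(Nat.cast_nonneg k : (0 : ℝ) ≤ k)]
      refine (div_le_self (by positivity) hk).trans ?_
      exact mul_le_mul_of_nonneg_right (hlx.trans hle) h3
    by_cases hs : Squarefree n
    · have : alpha (k + 1) n * alpha (l + 1) n = 0 := by
        rw [alpha_succ_apply, alpha_succ_apply]
        have h2 := convLambda_mul_of_squarefree (k := k + 1) (l := l + 1) (by omega) hs
        rcases mul_eq_zero.mp h2 with h | h <;> simp [h]
      simp [this, hF, hs]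
    · simp only [hF, if_neg hs]
      rw [abs_of_nonneg (mul_nonneg (alpha_succ_nonneg _ hn1) (alpha_succ_nonneg _ hn1))]
      calc _ ≤ (lg x * convLambda (k + 1) n) * (lg x * convLambda (l + 1) n) :=
            mul_le_mul (key k) (key l) (alpha_succ_nonneg _ hn1)
              (mul_nonneg (by linarith) (convLambda_nonneg _ _))
        _ = _ := by ring
  -- Cauchy–Schwarz: the exponents `2k` and `2l` average to `k + l`; the two factors `log n` in the
  -- `α`s supply the remaining 2.
  have h2 : psum (fun n => F k n * F l n) x ≤ √(C * D) * (x * lg x ^ (k + l)) := by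
    have h3 : (psum (fun n => F k n * F l n) x) ^ 2 ≤ (√(C * D) * (x * lg x ^ (k + l))) ^ 2 := by
      calc _ ≤ psum (fun n => F k n ^ 2) x * psum (fun n => F l n ^ 2) x :=
            Finset.sum_mul_sq_le_sq_mul_sq _ _ _
        _ ≤ (C * (x * lg x ^ (2 * k))) * (D * (x * lg x ^ (2 * l))) := by
            refine mul_le_mul ?_ ?_ (psum_nonneg (fun n => by positivity) x) (by positivity)
            · rw [hFsq]; exact hC x hx
            · rw [hFsq]; exact hD x hx
        _ = _ := by
            rw [mul_pow, Real.sq_sqrt (by positivity)]; ring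
    exact le_of_sq_le_sq h3 (by positivity)
  calc _ ≤ _ := h1
    _ ≤ lg x ^ 2 * (√(C * D) * (x * lg x ^ (k + l))) := by gcongr
    _ = _ := by ring

/-! ### Assembling `A(x)` -/

/-- The coefficient of `x (log x)^(k+l+1)` in `A_{k,l}(x)`. -/
noncomputable def mainCoeff : ℕ → ℕ → ℝ
  | 0, 0 => 1
  | 0, l + 1 => if l = 0 then -1 else 0
  | k + 1, 0 => if k = 0 then -1 else 0
  | k + 1, l + 1 =>
    if k = l then 2 * ((k.factorial : ℝ) / ((2 * (k + 1)).factorial : ℝ)) else 0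

lemma mainCoeff_comm (k l : ℕ) : mainCoeff k l = mainCoeff l k := by
  cases k <;> cases l <;> simp [mainCoeff]
  rename_i k l
  by_cases h : k = l
  · subst h; simp
  · simp [h, Ne.symm h]

lemma exists_abs_Akl_succ_zero_sub_le (k : ℕ) : ∃ C : ℝ, 0 ≤ C ∧ ∀ x : ℝ, 1 ≤ x →
    |Akl (k + 1) 0 x - mainCoeff (k + 1) 0 * (x * Real.log x ^ (k + 1 + 0 + 1))| ≤
      C * (x * lg x ^ (k + 1 + 0)) := by
  rcases Nat.eq_zero_or_pos k with rfl | hk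
  · simpa [mainCoeff] using exists_abs_Akl_one_zero_sub_le
  · obtain ⟨C, hC0, hC⟩ := exists_abs_Akl_le_rpow (k := k + 1) (l := 0) (by omega) (by norm_num)
      (ε := 1 / 2) (by norm_num)
    refine ⟨C, hC0, fun x hx => ?_⟩
    have h1 := hC x hx
    norm_num at h1
    simp only [mainCoeff, hk.ne', if_false, zero_mul, sub_zero]
    refine h1.trans ?_
    gcongr
    exact le_mul_of_one_le_right (by linarith) (one_le_pow₀ (one_le_lg hx))

/-- The asymptotic formula for `A_{k,l}(x)`, for all `k` and `l` at once. -/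
lemma exists_abs_Akl_sub_le (k l : ℕ) : ∃ C : ℝ, 0 ≤ C ∧ ∀ x : ℝ, 1 ≤ x →
    |Akl k l x - mainCoeff k l * (x * Real.log x ^ (k + l + 1))| ≤ C * (x * lg x ^ (k + l)) := by
  cases k with
  | zero =>
    cases l with
    | zero => simpa [mainCoeff] using exists_abs_Akl_zero_zero_sub_le
    | succ l =>
      rw [mainCoeff_comm, add_comm 0 (l + 1)]
      simp only [Akl_comm 0 (l + 1)]
      exact exists_abs_Akl_succ_zero_sub_le l
  | succ k =>
    cases l with
    | zero => exact exists_abs_Akl_succ_zero_sub_le k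
    | succ l =>
      by_cases h : k = l
      · subst h
        simp only [mainCoeff, if_true, ← two_mul]
        exact exists_abs_Akl_diag_sub_le k
      · simp only [mainCoeff, h, if_false, zero_mul, sub_zero]
        exact exists_abs_Akl_off_diag_le h

lemma bigA_eq (K : ℕ) (T x : ℝ) :
    bigA K T x = ∑ k ∈ Finset.range (K + 1), ∑ l ∈ Finset.range (K + 1),
      Akl k l x / calL T ^ (k + l) := by
  simp only [bigA, sq_abs]
  simp only [sq, Finset.sum_mul_sum, Akl, Finset.sum_div]
  rw [Finset.sum_comm]
  refine Finset.sum_congr rfl fun k _ => ?_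
  rw [Finset.sum_comm]
  refine Finset.sum_congr rfl fun l _ => Finset.sum_congr rfl fun n _ => ?_
  rw [div_mul_div_comm, pow_add]

lemma sum_mainCoeff {K : ℕ} (hK : 1 ≤ K) (r : ℝ) :
    ∑ k ∈ Finset.range (K + 1), ∑ l ∈ Finset.range (K + 1), mainCoeff k l * r ^ (k + l) =
      1 - 2 * r + 2 * ∑ k ∈ Finset.Icc 1 K,
        (((k - 1).factorial : ℝ) / ((2 * k).factorial : ℝ)) * r ^ (2 * k) := by
  have h0 : (0 : ℕ) ∈ Finset.range K := Finset.mem_range.mpr hK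
  -- Row 0 contributes `1 - r`, row 1 a second `-r` from its entry in column 0, and every row from 1
  -- on its diagonal entry.
  have e1 : ∀ k ∈ Finset.range K, ∑ l ∈ Finset.range (K + 1),
      mainCoeff (k + 1) l * r ^ (k + 1 + l) =
      2 * ((k.factorial : ℝ) / ((2 * (k + 1)).factorial : ℝ) * r ^ (2 * (k + 1))) +
        if k = 0 then -r else 0 := by
    intro k hk
    rw [Finset.sum_range_succ']
    congr 1
    · simp only [mainCoeff, ite_mul, zero_mul]
      rw [Finset.sum_ite_eq, if_pos hk, ← two_mul]; ring
    · by_cases h : k = 0 <;> simp [mainCoeff, h]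
  have e2 : ∑ l ∈ Finset.range (K + 1), mainCoeff 0 l * r ^ (0 + l) = 1 - r := by
    rw [Finset.sum_range_succ']
    simp only [mainCoeff, ite_mul, zero_mul]
    rw [Finset.sum_ite_eq_of_mem' _ _ _ h0]
    simp; ring
  have e3 : ∑ k ∈ Finset.Icc 1 K,
        (((k - 1).factorial : ℝ) / ((2 * k).factorial : ℝ)) * r ^ (2 * k) =
      ∑ k ∈ Finset.range K, (k.factorial : ℝ) / ((2 * (k + 1)).factorial : ℝ) *
        r ^ (2 * (k + 1)) := by
    rw [Finset.range_eq_Ico]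
    exact (Finset.sum_Ico_add' (fun k => (((k - 1).factorial : ℝ) /
      ((2 * k).factorial : ℝ)) * r ^ (2 * k)) 0 K 1).symm
  rw [Finset.sum_range_succ', Finset.sum_congr rfl e1, e2, Finset.sum_add_distrib,
    Finset.sum_ite_eq_of_mem' _ _ _ h0, ← Finset.mul_sum, e3]
  ring

lemma calL_lower {T₀ T : ℝ} (hT₀ : 2 * Real.pi < T₀) (hT : T₀ ≤ T) :
    0 < calL T₀ ∧ calL T₀ ≤ calL T := by
  have hpi := Real.pi_pos
  have h1 : 1 < T₀ / (2 * Real.pi) := by rwa [one_lt_div (by positivity)]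
  have h2 : Real.log (T₀ / (2 * Real.pi)) ≤ Real.log (T / (2 * Real.pi)) :=
    Real.log_le_log (by linarith) (by gcongr)
  have h3 := Real.log_pos h1
  unfold calL
  constructor <;> linarith

lemma log_eq_calL {T : ℝ} (hT : 0 < T) : Real.log T = 2 * calL T + Real.log (2 * Real.pi) := by
  rw [calL, Real.log_div hT.ne' (by positivity)]; ring

/-- Each pair `(k, l)` has error `O(x ((1 + log x)/𝓛)^{k+l})`, which is `O(x)` since `(log x)/𝓛 ≤ R`
and `1/𝓛 ≤ 1/L₀`. -/
lemma exists_abs_bigA_sub_le {K : ℕ} (hK : 1 ≤ K) {R L₀ : ℝ} (hL₀ : 0 < L₀) :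
    ∃ C : ℝ, ∀ T x : ℝ, L₀ ≤ calL T → 1 ≤ x → Real.log x / calL T ≤ R →
      |bigA K T x - x * Real.log x * (1 - 2 * (Real.log x / calL T) +
        2 * ∑ k ∈ Finset.Icc 1 K, (((k - 1).factorial : ℝ) / ((2 * k).factorial : ℝ)) *
          (Real.log x / calL T) ^ (2 * k))| ≤ C * x := by
  choose C hC0 hC using exists_abs_Akl_sub_le
  refine ⟨∑ k ∈ Finset.range (K + 1), ∑ l ∈ Finset.range (K + 1),
    C k l * (R + 1 / L₀) ^ (k + l), fun T x hT hx hxR => ?_⟩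
  have hL : 0 < calL T := by linarith
  have hlg1 := one_le_lg hx
  have hx0 : 0 ≤ x := by linarith
  rw [← sum_mainCoeff hK, bigA_eq, Finset.mul_sum, ← Finset.sum_sub_distrib, Finset.sum_mul]
  refine (Finset.abs_sum_le_sum_abs _ _).trans (Finset.sum_le_sum fun k _ => ?_)
  rw [Finset.mul_sum, ← Finset.sum_sub_distrib, Finset.sum_mul]
  refine (Finset.abs_sum_le_sum_abs _ _).trans (Finset.sum_le_sum fun l _ => ?_)
  have e : Akl k l x / calL T ^ (k + l) -
      x * Real.log x * (mainCoeff k l * (Real.log x / calL T) ^ (k + l)) =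
      (Akl k l x - mainCoeff k l * (x * Real.log x ^ (k + l + 1))) / calL T ^ (k + l) := by
    rw [div_pow]; field_simp; ring
  rw [e, abs_div, abs_of_pos (pow_pos hL _)]
  have h1 : lg x / calL T ≤ R + 1 / L₀ := by
    rw [lg, add_div, add_comm]
    exact add_le_add hxR (one_div_le_one_div_of_le hL₀ hT)
  calc _ ≤ C k l * (x * lg x ^ (k + l)) / calL T ^ (k + l) := by gcongr; exact hC k l x hx
    _ = C k l * x * (lg x / calL T) ^ (k + l) := by rw [div_pow]; ring
    _ ≤ C k l * x * (R + 1 / L₀) ^ (k + l) := by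
        have := hC0 k l
        gcongr
    _ = _ := by ring

end XiPrime

theorem mainTheorem6 :
    -- the diagonal case `k = ℓ = 0` and the cases `A_{1,0}` and `A_{k,0}`, `k ≥ 2`
    (∃ C : ℝ, ∀ x : ℝ, 1 ≤ x →
      |XiPrime.Akl 0 0 x - x * Real.log x| ≤ C * x) ∧
    (∃ C : ℝ, ∀ x : ℝ, 1 ≤ x →
      |XiPrime.Akl 1 0 x - (-(x * Real.log x ^ 2))| ≤ C * (x * Real.log x)) ∧
    (∀ k : ℕ, 2 ≤ k → ∀ ε : ℝ, 0 < ε → ∃ C : ℝ, ∀ x : ℝ, 1 ≤ x →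
      |XiPrime.Akl k 0 x| ≤ C * x ^ (1 / 2 + ε : ℝ)) ∧
    -- the cases `A_{1,1}` and `A_{k,1}`, `k ≥ 2`
    (∃ C : ℝ, ∀ x : ℝ, 1 ≤ x →
      |XiPrime.Akl 1 1 x - x * Real.log x ^ 3| ≤ C * (x * Real.log x ^ 2)) ∧
    (∀ k : ℕ, 2 ≤ k → ∀ ε : ℝ, 0 < ε → ∃ C : ℝ, ∀ x : ℝ, 1 ≤ x →
      |XiPrime.Akl k 1 x| ≤ C * x ^ (1 / 2 + ε : ℝ)) ∧
    -- the diagonal case `k = ℓ ≥ 1`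
    (∀ k : ℕ, 1 ≤ k → ∃ C : ℝ, ∀ x : ℝ, 1 ≤ x →
      |XiPrime.Akl k k x -
          2 * ((Nat.factorial (k - 1) : ℝ) / (Nat.factorial (2 * k) : ℝ)) *
            (x * Real.log x ^ (2 * k + 1))|
        ≤ C * (x * Real.log x ^ (2 * k))) ∧
    -- the off-diagonal case `k > ℓ ≥ 2`
    (∀ k l : ℕ, 2 ≤ l → l < k → ∃ C : ℝ, ∀ x : ℝ, 1 ≤ x →
      |XiPrime.Akl k l x| ≤ C * (x * Real.log x ^ (k + l))) ∧
    -- the consequence for `A(x)`, with `x = T ^ a`, uniformly in `0 < a ≤ C₀` and `T ≥ T₀`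
    (∀ K : ℕ, 1 ≤ K → ∀ C₀ : ℝ, 0 < C₀ → ∀ T₀ : ℝ, 2 * Real.pi < T₀ →
      ∃ C : ℝ, ∀ T : ℝ, T₀ ≤ T → ∀ a : ℝ, 0 < a → a ≤ C₀ → ∀ x : ℝ, x = T ^ a →
        |XiPrime.bigA K T x -
            x * Real.log x *
              (1 - 2 * (Real.log x / XiPrime.calL T) +
                2 * ∑ k ∈ Finset.Icc 1 K,
                  ((Nat.factorial (k - 1) : ℝ) / (Nat.factorial (2 * k) : ℝ)) *
                    (Real.log x / XiPrime.calL T) ^ (2 * k))|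
          ≤ C * x) := by
  refine ⟨?_, ?_, ?_, ?_, ?_, ?_, ?_, ?_⟩
  · simpa using XiPrime.exists_abs_Akl_sub_le_log XiPrime.exists_abs_Akl_zero_zero_sub_le
  · simpa using XiPrime.exists_abs_Akl_sub_le_log XiPrime.exists_abs_Akl_one_zero_sub_le
  · intro k hk ε hε
    obtain ⟨C, -, hC⟩ := XiPrime.exists_abs_Akl_le_rpow (l := 0) hk (by norm_num) hε
    exact ⟨C, hC⟩
  · simpa using XiPrime.exists_abs_Akl_sub_le_log XiPrime.exists_abs_Akl_one_one_sub_le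
  · intro k hk ε hε
    obtain ⟨C, -, hC⟩ := XiPrime.exists_abs_Akl_le_rpow (l := 1) hk le_rfl hε
    exact ⟨C, hC⟩
  · intro k hk
    obtain ⟨k, rfl⟩ : ∃ m, k = m + 1 := ⟨k - 1, by omega⟩
    exact XiPrime.exists_abs_Akl_sub_le_log (XiPrime.exists_abs_Akl_diag_sub_le k)
  · intro k l hl hlk
    obtain ⟨k, rfl⟩ : ∃ m, k = m + 1 := ⟨k - 1, by omega⟩
    obtain ⟨l, rfl⟩ : ∃ m, l = m + 1 := ⟨l - 1, by omega⟩
    have h := XiPrime.exists_abs_Akl_off_diag_le (k := k) (l := l) (by omega)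
    simpa using XiPrime.exists_abs_Akl_sub_le_log (c := 0) (by simpa using h)
  · intro K hK C₀ hC₀ T₀ hT₀
    have hpi := Real.pi_pos
    have hpi3 := Real.pi_gt_three
    have hlog : 0 ≤ Real.log (2 * Real.pi) := Real.log_nonneg (by linarith)
    have hL₀ := (XiPrime.calL_lower hT₀ le_rfl).1
    -- For `x = T^a`, `(log x)/𝓛 = a (2 + log(2π)/𝓛)`, and `𝓛` is smallest at `T₀`.
    obtain ⟨C, hC⟩ := XiPrime.exists_abs_bigA_sub_le hK
      (R := C₀ * (2 + Real.log (2 * Real.pi) / XiPrime.calL T₀)) hL₀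
    refine ⟨C, fun T hT a ha haC x hx => ?_⟩
    have hT1 : 1 ≤ T := by linarith
    have hLT := (XiPrime.calL_lower hT₀ hT).2
    have hL : 0 < XiPrime.calL T := by linarith
    refine hC T x hLT (hx ▸ Real.one_le_rpow hT1 ha.le) ?_
    rw [hx, Real.log_rpow (by linarith), XiPrime.log_eq_calL (by linarith), mul_div_assoc, add_div,
      mul_div_cancel_right₀ _ hL.ne']
    gcongr
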